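/- Let $M,N\ge 1$ be integers, let $\lambda_S,\lambda_R,\mu\ge 0$, and let $\nu$ be a probability measure on the circle $[-\pi,\pi]$ with $\int \sin\theta\cos\theta\,\nu(d\theta)=0$. Let $\sigma$ be the normalized uniform measure on the sphere $\mathbb S=\mathbb S^{M+N-1}(\sqrt{M+N})\subset\mathbb R^{M+N}$, whose points are written $(\mathbf v,\mathbf w)$ with $\mathbf v\in\mathbb R^M$, $\mathbf w\in\mathbb R^N$. For $1\le i<j\le M+N$ define on $L^1(\mathbb S,\sigma)$ $$(R_{ij}F)(x)=\int F(r_{ij}(\theta)^{-1}x)\,\nu(d\theta),$$ where $r_{ij}(\theta)^{-1}$ replaces the coordinates $(x_i,x_j)$ by $(x_i\cos\theta-x_j\sin\theta,\ x_i\sin\theta+x_j\cos\theta)$ and leaves the other coordinates unchanged, and let $$\mathcal L=\frac{\lambda_S}{M-1}\sum_{1\le i<j\le M}(R_{ij}-I)+\frac{\lambda_R}{N-1}\sum_{M<i<j\le M+N}(R_{ij}-I)+\frac{\mu}{N}\sum_{i=1}^{M}\sum_{j=M+1}^{M+N}(R_{ij}-I),$$ an empty sum (together with its prefactor) being $0$.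 Let $$(\mathcal N F)(\mathbf v,\mathbf w)=\int_{SO(N)}F(\mathbf v,A^{-1}\mathbf w)\,dA$$ with the normalized Haar measure on $SO(N)$, and for a probability density $F$ on $\mathbb S$ let $S(F)=\int_{\mathbb S}F\log F\,d\sigma\in[0,\infty]$. Let $F_0\in L^1(\mathbb S,\sigma)$ be a probability density, that is $F_0\ge 0$ and $\int F_0\,d\sigma=1$, which is invariant under all rotations $(\mathbf v,\mathbf w)\mapsto(\mathbf v,A\mathbf w)$, $A\in SO(N)$. Then for all $t\ge 0$ $$S(\mathcal N e^{\mathcal L t}F_0)\ \le\ \left[2\left(\frac{M}{M+N}+e^{-\mu_\nu t}\,\frac{N}{M+N}\right)+\frac MN\right]S(F_0),\qquad \mu_\nu=\mu\int\sin^2\theta\,\nu(d\theta).$$ -/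

import Mathlib

open MeasureTheory

noncomputable section

namespace KacReservoir

/-! ### Averages over families of measure preserving maps, as operators on `L¹` -/

theorem measurePreserving_family {Ω X : Type*} [MeasurableSpace Ω] [MeasurableSpace X]
    (P : Measure Ω) [IsProbabilityMeasure P] (σ : Measure X) [IsFiniteMeasure σ]
    (T : Ω → X → X) (hT : Measurable (Function.uncurry T))
    (hσ : ∀ ω, MeasurePreserving (T ω) σ σ) :
    MeasurePreserving (fun q : X × Ω => T q.2 q.1) (σ.prod P) σ := by
  have h1 : MeasurePreserving (fun q : Ω × X => (q.1, T q.1 q.2)) (P.prod σ) (P.prod σ) :=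
    (MeasurePreserving.id P).skew_product hT (Filter.Eventually.of_forall fun ω => (hσ ω).map_eq)
  exact (measurePreserving_snd.comp h1).comp Measure.measurePreserving_swap

theorem integrable_family {Ω X : Type*} [MeasurableSpace Ω] [MeasurableSpace X]
    (P : Measure Ω) [IsProbabilityMeasure P] (σ : Measure X) [IsFiniteMeasure σ]
    (T : Ω → X → X) (hT : Measurable (Function.uncurry T))
    (hσ : ∀ ω, MeasurePreserving (T ω) σ σ) (F : Lp ℝ 1 σ) :
    Integrable (fun q : X × Ω => F (T q.2 q.1)) (σ.prod P) :=
  (measurePreserving_family P σ T hT hσ).integrable_comp_of_integrable (L1.integrable_coeFn F)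

/-- The average `x ↦ ∫ F (T ω x) P(dω)` of an integrable function `F` over a jointly measurable
family of measure preserving maps, as a bounded operator on `L¹(σ)`. -/
def averageOp {Ω X : Type*} [MeasurableSpace Ω] [MeasurableSpace X]
    (P : Measure Ω) [IsProbabilityMeasure P] (σ : Measure X) [IsFiniteMeasure σ]
    (T : Ω → X → X) (hT : Measurable (Function.uncurry T))
    (hσ : ∀ ω, MeasurePreserving (T ω) σ σ) : Lp ℝ 1 σ →L[ℝ] Lp ℝ 1 σ :=
  LinearMap.mkContinuous
    { toFun := fun F => Integrable.toL1 (fun x => ∫ ω, F (T ω x) ∂P)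
        (integrable_family P σ T hT hσ F).integral_prod_left
      map_add' := by
        intro F G
        rw [← Integrable.toL1_add, Integrable.toL1_eq_toL1_iff]
        have h := Measure.ae_ae_of_ae_prod
          ((measurePreserving_family P σ T hT hσ).quasiMeasurePreserving.ae (Lp.coeFn_add F G))
        filter_upwards [h, (integrable_family P σ T hT hσ F).prod_right_ae,
          (integrable_family P σ T hT hσ G).prod_right_ae] with x hx hF hG
        simp only [Pi.add_apply]
        rw [← integral_add hF hG]
        exact integral_congr_ae hx
      map_smul' := by
        intro c F
        rw [RingHom.id_apply, ← Integrable.toL1_smul, Integrable.toL1_eq_toL1_iff]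
        have h := Measure.ae_ae_of_ae_prod
          ((measurePreserving_family P σ T hT hσ).quasiMeasurePreserving.ae (Lp.coeFn_smul c F))
        filter_upwards [h] with x hx
        exact (integral_congr_ae hx).trans (integral_smul c fun ω => F (T ω x)) }
    1 (by
      intro F
      rw [one_mul, LinearMap.coe_mk, AddHom.coe_mk, L1.norm_eq_integral_norm,
        L1.norm_eq_integral_norm]
      have hI := integrable_family P σ T hT hσ F
      calc ∫ x, ‖(Integrable.toL1 (fun x => ∫ ω, F (T ω x) ∂P) hI.integral_prod_left) x‖ ∂σ
          = ∫ x, ‖∫ ω, F (T ω x) ∂P‖ ∂σ := by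
            refine integral_congr_ae ?_
            filter_upwards [Integrable.coeFn_toL1 hI.integral_prod_left] with x hx
            rw [hx]
        _ ≤ ∫ x, ∫ ω, ‖F (T ω x)‖ ∂P ∂σ :=
            integral_mono hI.integral_prod_left.norm hI.norm.integral_prod_left
              (fun x => norm_integral_le_integral_norm _)
        _ = ∫ q : X × Ω, ‖F (T q.2 q.1)‖ ∂(σ.prod P) := (integral_prod _ hI.norm).symm
        _ = ∫ x, ‖F x‖ ∂σ := by
            have hm := measurePreserving_family P σ T hT hσ
            have h := integral_map (φ := fun q : X × Ω => T q.2 q.1) (μ := σ.prod P)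
              (f := fun x => ‖F x‖) hm.measurable.aemeasurable
              (by rw [hm.map_eq]; exact (L1.integrable_coeFn F).aestronglyMeasurable.norm)
            rw [hm.map_eq] at h
            exact h.symm)

/-! ### The energy sphere and its normalized surface measure -/

/-- Velocities `(v, w)`: the coordinates `Sum.inl i` are `v ∈ ℝᴹ` (the system), the coordinates
`Sum.inr j` are `w ∈ ℝᴺ` (the reservoir). -/
abbrev Velocities (M N : ℕ) : Type := EuclideanSpace ℝ (Fin M ⊕ Fin N)

/-- The sphere of radius `√(M + N)` in `ℝ^(M+N)`. -/
abbrev EnergySphere (M N : ℕ) : Type :=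
  Metric.sphere (0 : Velocities M N) (Real.sqrt ((M : ℝ) + N))

/-- The dilation from the unit sphere to the energy sphere. -/
def dilate (M N : ℕ) (u : Metric.sphere (0 : Velocities M N) 1) : EnergySphere M N :=
  ⟨Real.sqrt ((M : ℝ) + N) • (u : Velocities M N), by
    rw [mem_sphere_zero_iff_norm, norm_smul, norm_eq_of_mem_sphere u, mul_one,
      Real.norm_of_nonneg (Real.sqrt_nonneg _)]⟩

theorem measurable_dilate (M N : ℕ) : Measurable (dilate M N) :=
  by
  refine Continuous.measurable (Continuous.subtype_mk ?_ _)
  fun_prop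

/-- The uniform probability measure on the energy sphere: the surface measure of the unit sphere,
normalized and dilated. -/
def sphereMeasure (M N : ℕ) : Measure (EnergySphere M N) :=
  ((volume : Measure (Velocities M N)).toSphere Set.univ)⁻¹ •
    ((volume : Measure (Velocities M N)).toSphere).map (dilate M N)

instance instIsFiniteMeasureSphereMeasure (M N : ℕ) : IsFiniteMeasure (sphereMeasure M N) where
  measure_univ_lt_top := by
    rw [sphereMeasure, Measure.smul_apply,
      Measure.map_apply (measurable_dilate M N) MeasurableSet.univ, Set.preimage_univ, smul_eq_mul]
    exact lt_of_le_of_lt (ENNReal.inv_mul_le_one _) ENNReal.one_lt_top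

/-- The action of a linear isometry on a centred sphere. -/
def onSphere {E : Type*} [NormedAddCommGroup E] [InnerProductSpace ℝ E] {r : ℝ}
    (f : E →ₗᵢ[ℝ] E) (x : Metric.sphere (0 : E) r) : Metric.sphere (0 : E) r :=
  ⟨f x, by rw [mem_sphere_zero_iff_norm, f.norm_map, norm_eq_of_mem_sphere x]⟩

theorem continuous_onSphere {E : Type*} [NormedAddCommGroup E] [InnerProductSpace ℝ E] {r : ℝ}
    (f : E →ₗᵢ[ℝ] E) : Continuous (onSphere (r := r) f) :=
  (f.continuous.comp continuous_subtype_val).subtype_mk _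

theorem measurePreserving_onSphere_one {E : Type*} [NormedAddCommGroup E] [InnerProductSpace ℝ E]
    [FiniteDimensional ℝ E] [MeasurableSpace E] [BorelSpace E] (f : E →ₗᵢ[ℝ] E) :
    MeasurePreserving (onSphere (r := 1) f) (volume : Measure E).toSphere
      (volume : Measure E).toSphere := by
  refine ⟨(continuous_onSphere f).measurable, ?_⟩
  ext s hs
  have hpre := (continuous_onSphere (r := 1) f).measurable hs
  rw [Measure.map_apply (continuous_onSphere f).measurable hs, Measure.toSphere_apply' _ hpre,
    Measure.toSphere_apply' _ hs]
  congr 1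
  have hf := (f.toLinearIsometryEquiv rfl).measurePreserving
  symm
  rw [← hf.measure_preimage_emb
    (f.toLinearIsometryEquiv rfl).toHomeomorph.measurableEmbedding]
  congr 1
  symm
  ext x
  simp only [Set.mem_smul, Set.mem_image, Set.mem_preimage]
  constructor
  · rintro ⟨c, hc, _, ⟨u, hu, rfl⟩, rfl⟩
    exact ⟨c, hc, _, ⟨onSphere f u, hu, rfl⟩, (map_smul f c (u : E)).symm⟩
  · rintro ⟨c, hc, _, ⟨u, hu, rfl⟩, hx⟩
    have hg : ∀ y, f ((f.toLinearIsometryEquiv rfl).symm y) = y :=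
      fun y => (f.toLinearIsometryEquiv rfl).apply_symm_apply y
    have hgu : (f.toLinearIsometryEquiv rfl).symm (u : E) ∈ Metric.sphere (0 : E) 1 := by
      rw [mem_sphere_zero_iff_norm, LinearIsometryEquiv.norm_map, norm_eq_of_mem_sphere u]
    refine ⟨c, hc, _, ⟨⟨_, hgu⟩, ?_, rfl⟩, ?_⟩
    · have : onSphere f ⟨_, hgu⟩ = u := Subtype.ext (hg u)
      rw [this]
      exact hu
    · apply f.injective
      rw [map_smul, hg]
      exact hx

theorem measurePreserving_onSphere {M N : ℕ} (f : Velocities M N →ₗᵢ[ℝ] Velocities M N) :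
    MeasurePreserving (onSphere f) (sphereMeasure M N) (sphereMeasure M N) := by
  have h1 := measurePreserving_onSphere_one f
  refine ⟨(continuous_onSphere f).measurable, ?_⟩
  have hcomm : onSphere f ∘ dilate M N = dilate M N ∘ onSphere f := by
    funext u
    exact Subtype.ext (map_smul f _ _)
  rw [sphereMeasure, Measure.map_smul,
    Measure.map_map (continuous_onSphere f).measurable (measurable_dilate M N), hcomm,
    ← Measure.map_map (measurable_dilate M N) (continuous_onSphere f).measurable, h1.map_eq]

/-! ### Collisions and the Kac generator -/

/-- The rotation `r_ij(θ)⁻¹` in the plane of the coordinates `i ≠ j`. -/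
def collision {ι : Type*} [Fintype ι] [DecidableEq ι] {i j : ι} (hij : i ≠ j) (θ : ℝ) :
    EuclideanSpace ℝ ι →ₗᵢ[ℝ] EuclideanSpace ℝ ι where
  toFun x := WithLp.toLp 2 fun k =>
    if k = i then x i * Real.cos θ - x j * Real.sin θ
    else if k = j then x i * Real.sin θ + x j * Real.cos θ
    else x k
  map_add' x y := by
    ext k
    simp only [PiLp.add_apply]
    split_ifs <;> ring
  map_smul' c x := by
    ext k
    simp only [PiLp.smul_apply, smul_eq_mul, RingHom.id_apply]
    split_ifs <;> ring
  norm_map' x := by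
    simp only [LinearMap.coe_mk, AddHom.coe_mk, EuclideanSpace.norm_eq, Real.norm_eq_abs, sq_abs]
    congr 1
    have hsplit : ∀ g : ι → ℝ, ∑ k, g k
        = g i + (g j + ∑ k ∈ (Finset.univ.erase i).erase j, g k) := by
      intro g
      rw [Finset.add_sum_erase _ g (Finset.mem_erase.2 ⟨hij.symm, Finset.mem_univ j⟩),
        Finset.add_sum_erase _ g (Finset.mem_univ i)]
    rw [hsplit, hsplit (fun k => x k ^ 2)]
    have hrest : ∑ k ∈ (Finset.univ.erase i).erase j,
          (if k = i then x i * Real.cos θ - x j * Real.sin θ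
            else if k = j then x i * Real.sin θ + x j * Real.cos θ else x k) ^ 2
        = ∑ k ∈ (Finset.univ.erase i).erase j, x k ^ 2 := by
      refine Finset.sum_congr rfl fun k hk => ?_
      simp only [Finset.mem_erase] at hk
      rw [if_neg hk.2.1, if_neg hk.1]
    rw [hrest, if_pos rfl, if_neg hij.symm, if_pos rfl]
    linear_combination (x i ^ 2 + x j ^ 2) * Real.sin_sq_add_cos_sq θ

theorem measurable_collision {M N : ℕ} {i j : Fin M ⊕ Fin N} (hij : i ≠ j) :
    Measurable (Function.uncurry
      (fun (θ : ℝ) (x : EnergySphere M N) => onSphere (collision hij θ) x)) := by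
  refine Continuous.measurable (Continuous.subtype_mk ?_ _)
  refine (PiLp.continuous_toLp 2 _).comp (continuous_pi fun k => ?_)
  by_cases h1 : k = i
  · simp only [h1, if_true]; fun_prop
  · by_cases h2 : k = j
    · subst h2
      simp only [h1, if_true, if_false]; fun_prop
    · simp only [h1, h2, if_false]; fun_prop

/-- The collision operator `(R_ij F)(x) = ∫ F(r_ij(θ)⁻¹ x) ν(dθ)` on `L¹` of the energy sphere
(with the irrelevant convention `R_ii = I`). -/
def R (M N : ℕ) (ν : Measure ℝ) [IsProbabilityMeasure ν] (i j : Fin M ⊕ Fin N) :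
    Lp ℝ 1 (sphereMeasure M N) →L[ℝ] Lp ℝ 1 (sphereMeasure M N) :=
  if hij : i ≠ j then
    averageOp ν (sphereMeasure M N) (fun θ x => onSphere (collision hij θ) x)
      (measurable_collision hij) (fun θ => measurePreserving_onSphere (collision hij θ))
  else 1

/-- The generator `𝓛` of the Kac master equation for `M` system and `N` reservoir particles. -/
def generator (M N : ℕ) (lamS lamR mu : ℝ) (ν : Measure ℝ) [IsProbabilityMeasure ν] :
    Lp ℝ 1 (sphereMeasure M N) →L[ℝ] Lp ℝ 1 (sphereMeasure M N) :=
  (lamS / ((M : ℝ) - 1)) •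
      (∑ i : Fin M, ∑ j ∈ Finset.Ioi i, (R M N ν (Sum.inl i) (Sum.inl j) - 1))
    + (lamR / ((N : ℝ) - 1)) •
      (∑ i : Fin N, ∑ j ∈ Finset.Ioi i, (R M N ν (Sum.inr i) (Sum.inr j) - 1))
    + (mu / (N : ℝ)) •
      (∑ i : Fin M, ∑ j : Fin N, (R M N ν (Sum.inl i) (Sum.inr j) - 1))

/-- The solution operator `e^{𝓛t}` of the master equation. -/
def evolution (M N : ℕ) (lamS lamR mu : ℝ) (ν : Measure ℝ) [IsProbabilityMeasure ν] (t : ℝ) :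
    Lp ℝ 1 (sphereMeasure M N) →L[ℝ] Lp ℝ 1 (sphereMeasure M N) :=
  NormedSpace.exp (t • generator M N lamS lamR mu ν)

/-! ### Rotations of the reservoir variables and the marginal -/

/-- The special orthogonal group `SO(N)`. -/
abbrev SO (N : ℕ) : Type := Matrix.specialOrthogonalGroup (Fin N) ℝ

theorem SO_entry_continuous (N : ℕ) (i j : Fin N) :
    Continuous fun A : SO N => (A : Matrix (Fin N) (Fin N) ℝ) i j :=
  continuous_subtype_val.matrix_elem i j

theorem SO_inv_val {N : ℕ} (A : SO N) :
    ((A⁻¹ : SO N) : Matrix (Fin N) (Fin N) ℝ) = (A : Matrix (Fin N) (Fin N) ℝ).transpose := by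
  ext i j
  rfl

instance instIsTopologicalGroupSO (N : ℕ) : IsTopologicalGroup (SO N) where
  continuous_inv := by
    refine continuous_induced_rng.2 ?_
    have h : (Subtype.val ∘ fun A : SO N => A⁻¹)
        = fun A : SO N => (A : Matrix (Fin N) (Fin N) ℝ).transpose := funext SO_inv_val
    rw [h]
    exact continuous_subtype_val.matrix_transpose

instance instCompactSpaceSO (N : ℕ) : CompactSpace (SO N) := by
  refine isCompact_iff_compactSpace.1 ?_
  have hK : IsCompact (Set.univ.pi fun _ : Fin N => Set.univ.pi fun _ : Fin N =>
      Set.Icc (-1 : ℝ) 1) :=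
    isCompact_univ_pi fun _ => isCompact_univ_pi fun _ => isCompact_Icc
  have hcl : IsClosed {A : Matrix (Fin N) (Fin N) ℝ | A * star A = 1 ∧ A.det = 1} :=
    (isClosed_eq (continuous_id.mul continuous_star) continuous_const).inter
      (isClosed_eq continuous_id.matrix_det continuous_const)
  have heq : ((Matrix.specialOrthogonalGroup (Fin N) ℝ : Submonoid _) :
      Set (Matrix (Fin N) (Fin N) ℝ)) = {A | A * star A = 1 ∧ A.det = 1} := by
    ext A
    rw [SetLike.mem_coe, Matrix.mem_specialOrthogonalGroup_iff, Matrix.mem_orthogonalGroup_iff]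
    rfl
  rw [heq]
  refine IsCompact.of_isClosed_subset hK hcl ?_
  rintro A ⟨hA, -⟩
  refine Set.mem_univ_pi.2 fun i => Set.mem_univ_pi.2 fun j => ?_
  have h : ∑ k, A i k * A i k = 1 := by
    have := congrFun (congrFun hA i) i
    simpa [Matrix.mul_apply, Matrix.star_apply] using this
  have h2 : A i j * A i j ≤ 1 := by
    rw [← h]
    exact Finset.single_le_sum (f := fun k => A i k * A i k)
      (fun k _ => mul_self_nonneg _) (Finset.mem_univ j)
  exact abs_le.1 (abs_le_one_iff_mul_self_le_one.2 h2)

instance instSecondCountableSO (N : ℕ) : SecondCountableTopology (SO N) :=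
  haveI : SecondCountableTopology (Matrix (Fin N) (Fin N) ℝ) :=
    inferInstanceAs (SecondCountableTopology (Fin N → Fin N → ℝ))
  TopologicalSpace.Subtype.secondCountableTopology _

instance instMeasurableSpaceSO (N : ℕ) : MeasurableSpace (SO N) := borel _

instance instBorelSpaceSO (N : ℕ) : BorelSpace (SO N) := ⟨rfl⟩

/-- The normalized Haar measure on `SO(N)`. -/
def haarSO (N : ℕ) : Measure (SO N) := Measure.haarMeasure ⊤

instance instIsProbabilityMeasureHaarSO (N : ℕ) : IsProbabilityMeasure (haarSO N) :=
  ⟨by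
    have h := Measure.haarMeasure_self (K₀ := (⊤ : TopologicalSpace.PositiveCompacts (SO N)))
    rwa [TopologicalSpace.PositiveCompacts.coe_top] at h⟩

/-- The rotation `(v, w) ↦ (v, A⁻¹ w)`, for `A ∈ SO(N)`. -/
def reservoirRotation (M : ℕ) {N : ℕ} (A : SO N) : Velocities M N →ₗᵢ[ℝ] Velocities M N where
  toFun x := WithLp.toLp 2 (Sum.elim (fun i => x (Sum.inl i))
    (((A⁻¹ : SO N) : Matrix (Fin N) (Fin N) ℝ).mulVec fun j => x (Sum.inr j)))
  map_add' x y := by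
    ext k
    rcases k with i | j
    · simp
    · simp [Matrix.mulVec, dotProduct, mul_add, Finset.sum_add_distrib]
  map_smul' c x := by
    ext k
    rcases k with i | j
    · simp
    · simp [Matrix.mulVec, dotProduct, Finset.mul_sum, mul_left_comm]
  norm_map' x := by
    simp only [LinearMap.coe_mk, AddHom.coe_mk, EuclideanSpace.norm_eq, Real.norm_eq_abs, sq_abs,
      Fintype.sum_sum_type, Sum.elim_inl, Sum.elim_inr]
    congr 2
    have hA : (A : Matrix (Fin N) (Fin N) ℝ) * (A : Matrix (Fin N) (Fin N) ℝ).transpose = 1 :=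
      (Matrix.mem_orthogonalGroup_iff _ _).1 (Matrix.mem_specialOrthogonalGroup_iff.1 A.2).1
    have key : ∀ w : Fin N → ℝ, dotProduct
        ((A : Matrix (Fin N) (Fin N) ℝ).transpose.mulVec w)
        ((A : Matrix (Fin N) (Fin N) ℝ).transpose.mulVec w) = dotProduct w w := by
      intro w
      rw [Matrix.dotProduct_mulVec, Matrix.vecMul_transpose, Matrix.mulVec_mulVec, hA,
        Matrix.one_mulVec]
    have := key fun j => x (Sum.inr j)
    rw [SO_inv_val]
    simpa [dotProduct, sq] using this

theorem measurable_reservoirRotation (M N : ℕ) :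
    Measurable (Function.uncurry
      (fun (A : SO N) (x : EnergySphere M N) => onSphere (reservoirRotation M A) x)) := by
  refine Continuous.measurable (Continuous.subtype_mk ?_ _)
  refine (PiLp.continuous_toLp 2 _).comp (continuous_pi fun k => ?_)
  rcases k with i | j
  · simp only [Sum.elim_inl]; fun_prop
  · simp only [Sum.elim_inr, Matrix.mulVec, dotProduct]
    refine continuous_finsetSum _ fun l _ => Continuous.mul ?_ (by fun_prop)
    exact (SO_entry_continuous N j l).comp (continuous_inv.comp continuous_fst)

/-- The marginal `(𝒩F)(v, w) = ∫_{SO(N)} F(v, A⁻¹ w) dA`. -/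
def marginal (M N : ℕ) : Lp ℝ 1 (sphereMeasure M N) →L[ℝ] Lp ℝ 1 (sphereMeasure M N) :=
  averageOp (haarSO N) (sphereMeasure M N) (fun A x => onSphere (reservoirRotation M A) x)
    (measurable_reservoirRotation M N) (fun A => measurePreserving_onSphere (reservoirRotation M A))

/-! ### Entropy -/

/-- The entropy `∫ F log F dσ`, as the integral of the positive part minus the integral of the
negative part of `F log F`; on a probability space the latter is finite for `F ≥ 0`, so the
difference is a number in `(-∞, ∞]`. -/
def entropy {X : Type*} [MeasurableSpace X] (σ : Measure X) (F : X → ℝ) : EReal :=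
  ((∫⁻ x, ENNReal.ofReal (F x * Real.log (F x)) ∂σ : ENNReal) : EReal)
    - ((∫⁻ x, ENNReal.ofReal (-(F x * Real.log (F x))) ∂σ : ENNReal) : EReal)

end KacReservoir

end

noncomputable section

namespace KacReservoir

open scoped Topology
open InformationTheory (klFun klFun_apply klFun_nonneg klFun_zero klFun_one continuous_klFun)
open Filter (Tendsto atTop)

set_option linter.unusedSectionVars false

/-! ### Rotation-invariant calculus on polynomial functions of the sphere. -/

/-! ### Calculus on a centred sphere -/

/-! The entropy estimate is reduced to an estimate of Fisher informations by means of the heat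
semigroup `P_s` of the sphere. Along `P_s f` the entropy has derivative `-I(P_s f)`, with `I` the
total Fisher information, and it comes arbitrarily close to its value at the constant function of
the same mass. If `A` preserves positivity and mass, commutes with the Laplacian and satisfies `I(A
f) ≤ c I(f)`, then integrating `I(P_s A f) = I(A P_s f) ≤ c I(P_s f)` in `s` shows that `A`
contracts the entropy by the same factor (`entropy_le_of_fisher_le`). Averages over rotations have
the first three properties, and so do Euler steps `1 + h𝓛` with small `h`.

To find `c`, write `I = ½ ∑_a I_a` with `I_a(f) = ∫ ∑_b (L_ab f)² / f` and `L_ab = x_a ∂_b - x_b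
∂_a`. The corresponding `I_u(f)` for a vector `u` is quadratic in `u`, convex in `f`, and `I_u(f ∘
U) = I_{Uu}(f)` for isometries `U`. Hence (`fisher_avgL_le`) a collision of `i` and `j` replaces
`(I_i, I_j)` by at most its mixture with the doubly stochastic matrix of parameter `s = ∫ sin² dν`;
the mixed terms vanish because `∫ sin cos dν = 0`. The marginal annihilates the derivatives `L_ab`
in reservoir planes, so `I(𝒩 f)` is at most the sum of `I_i(f)` over the system directions only
(`totalFisher_marginalL_le`).

Start from weight `1` on the system and `0` on the reservoir directions and run the mixing dually.
An Euler step of length `h` keeps the total weight and multiplies the difference of the two weights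
by `1 - γ`, `γ = h s μ (1 + M/N)`. After `k` steps the system weight is `M/(M+N) + (1-γ)^k N/(M+N)`,
it dominates the reservoir weight, and `∑_a I_a = 2I` produces the factor `2` (`entropy_pow_le`). In
the limit of small steps the decay rate is `μ s (1 + M/N)`, which is at least the asserted `μ s`;
with the nonnegative term `M/N` added, the asserted bound follows.

The analysis takes place on polynomials of bounded degree. These form a finite dimensional space
stable under rotations and under the `L_ab`, so the heat semigroup is a matrix exponential. The
passage to `L¹` uses Euler's product for `e^{𝓛t}`, approximation by positive polynomials with
convergence of the entropies (`exists_poly_tendsto`), and Fatou's lemma. The entropy appears as `∫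
klFun F` with `klFun x = x log x + 1 - x`, which is continuous and nonnegative on `[0, ∞)` and gives
`S(F)` at mass one. -/

/-- The centred sphere of radius `r` in `ℝ^ι`. -/
abbrev Sph (ι : Type*) [Fintype ι] (r : ℝ) : Type _ := Metric.sphere (0 : EuclideanSpace ℝ ι) r

section Calculus

variable {ι : Type*} [Fintype ι] {r : ℝ}

/-- The extension of a function on the sphere that is homogeneous of degree `0`. -/
def homExt (f : Sph ι r → ℝ) (y : EuclideanSpace ℝ ι) : ℝ :=
  open Classical in
  if h : (r / ‖y‖) • y ∈ Metric.sphere (0 : EuclideanSpace ℝ ι) r then f ⟨_, h⟩ else 0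

/-- The tangential gradient of a function on the sphere. -/
def grad (f : Sph ι r → ℝ) (x : Sph ι r) : EuclideanSpace ℝ ι :=
  gradient (homExt f) (x : EuclideanSpace ℝ ι)

/-- Differentiability of a function on the sphere. -/
def SphDiff (f : Sph ι r → ℝ) : Prop :=
  ∀ x : Sph ι r, DifferentiableAt ℝ (homExt f) (x : EuclideanSpace ℝ ι)

theorem inner_grad (f : Sph ι r → ℝ) (x : Sph ι r) (z : EuclideanSpace ℝ ι) :
    inner ℝ (grad f x) z = fderiv ℝ (homExt f) (x : EuclideanSpace ℝ ι) z := by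
  rw [grad, ← toDual_gradient, InnerProductSpace.toDual_apply_apply]

variable [hr : Fact (0 < r)]

theorem scale_mem {y : EuclideanSpace ℝ ι} (hy : y ≠ 0) :
    (r / ‖y‖) • y ∈ Metric.sphere (0 : EuclideanSpace ℝ ι) r := by
  have hr0 := hr.out
  rw [mem_sphere_zero_iff_norm, norm_smul, Real.norm_of_nonneg (by positivity)]
  field_simp [norm_ne_zero_iff.2 hy]

theorem homExt_of_ne (f : Sph ι r → ℝ) {y : EuclideanSpace ℝ ι} (hy : y ≠ 0) :
    homExt f y = f ⟨_, scale_mem hy⟩ := dif_pos _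

theorem coe_ne_zero (x : Sph ι r) : (x : EuclideanSpace ℝ ι) ≠ 0 := by
  rw [← norm_ne_zero_iff, norm_eq_of_mem_sphere x]
  exact hr.out.ne'

theorem homExt_coe (f : Sph ι r → ℝ) (x : Sph ι r) : homExt f x = f x := by
  rw [homExt_of_ne f (coe_ne_zero x)]
  congr 1
  ext1
  simp [norm_eq_of_mem_sphere x, hr.out.ne']

theorem eventually_ne_zero (x : Sph ι r) : ∀ᶠ y in 𝓝 (x : EuclideanSpace ℝ ι), y ≠ 0 :=
  isOpen_ne.mem_nhds (coe_ne_zero x)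

theorem SphDiff.hasFDerivAt {f : Sph ι r → ℝ} (hf : SphDiff f) (x : Sph ι r) :
    HasFDerivAt (homExt f) (innerSL ℝ (grad f x)) (x : EuclideanSpace ℝ ι) := by
  have h : (innerSL ℝ (grad f x) : EuclideanSpace ℝ ι →L[ℝ] ℝ)
      = fderiv ℝ (homExt f) (x : EuclideanSpace ℝ ι) :=
    ContinuousLinearMap.ext fun z => by rw [innerSL_apply_apply, inner_grad]
  rw [h]
  exact (hf x).hasFDerivAt

theorem SphDiff.hasDerivAt_curve {f : Sph ι r → ℝ} (hf : SphDiff f)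
    {c : ℝ → EuclideanSpace ℝ ι} {c' : EuclideanSpace ℝ ι} {θ : ℝ} (x : Sph ι r)
    (hx : c θ = x) (hc : HasDerivAt c c' θ) :
    HasDerivAt (fun θ => homExt f (c θ)) (inner ℝ (grad f x) c') θ := by
  have h := hf.hasFDerivAt x
  rw [← hx] at h
  exact h.comp_hasDerivAt θ hc

theorem grad_eq_of_hasFDerivAt {f : Sph ι r → ℝ} {x : Sph ι r} {g : EuclideanSpace ℝ ι}
    (h : HasFDerivAt (homExt f) (innerSL ℝ g) (x : EuclideanSpace ℝ ι)) : grad f x = g := by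
  refine ext_inner_right ℝ fun z => ?_
  rw [inner_grad, h.fderiv, innerSL_apply_apply]

theorem sphDiff_const (c : ℝ) : SphDiff (fun _ : Sph ι r => c) := fun x =>
  (differentiableAt_const c).congr_of_eventuallyEq <| by
    filter_upwards [eventually_ne_zero x] with y hy using homExt_of_ne _ hy

theorem grad_const (c : ℝ) (x : Sph ι r) : grad (fun _ : Sph ι r => c) x = 0 := by
  refine grad_eq_of_hasFDerivAt ?_
  rw [map_zero]
  refine (hasFDerivAt_const c _).congr_of_eventuallyEq ?_
  filter_upwards [eventually_ne_zero x] with y hy using homExt_of_ne _ hy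

theorem SphDiff.hasFDerivAt_add {f g : Sph ι r → ℝ} (hf : SphDiff f) (hg : SphDiff g)
    (x : Sph ι r) : HasFDerivAt (homExt fun x => f x + g x) (innerSL ℝ (grad f x + grad g x))
      (x : EuclideanSpace ℝ ι) := by
  have h := (hf.hasFDerivAt x).add (hg.hasFDerivAt x)
  rw [map_add]
  refine h.congr_of_eventuallyEq ?_
  filter_upwards [eventually_ne_zero x] with y hy
  simp [homExt_of_ne _ hy]

theorem SphDiff.add {f g : Sph ι r → ℝ} (hf : SphDiff f) (hg : SphDiff g) :
    SphDiff (fun x => f x + g x) := fun x => (hf.hasFDerivAt_add hg x).differentiableAt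

theorem SphDiff.grad_add {f g : Sph ι r → ℝ} (hf : SphDiff f) (hg : SphDiff g)
    (x : Sph ι r) : grad (fun x => f x + g x) x = grad f x + grad g x :=
  grad_eq_of_hasFDerivAt (hf.hasFDerivAt_add hg x)

theorem SphDiff.hasFDerivAt_mul {f g : Sph ι r → ℝ} (hf : SphDiff f) (hg : SphDiff g)
    (x : Sph ι r) : HasFDerivAt (homExt fun x => f x * g x)
      (innerSL ℝ (f x • grad g x + g x • grad f x)) (x : EuclideanSpace ℝ ι) := by
  have h := (hf.hasFDerivAt x).mul (hg.hasFDerivAt x)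
  rw [homExt_coe, homExt_coe] at h
  rw [map_add, map_smul, map_smul]
  refine h.congr_of_eventuallyEq ?_
  filter_upwards [eventually_ne_zero x] with y hy
  simp [homExt_of_ne _ hy]

theorem SphDiff.mul {f g : Sph ι r → ℝ} (hf : SphDiff f) (hg : SphDiff g) :
    SphDiff (fun x => f x * g x) := fun x => (hf.hasFDerivAt_mul hg x).differentiableAt

theorem SphDiff.grad_mul {f g : Sph ι r → ℝ} (hf : SphDiff f) (hg : SphDiff g)
    (x : Sph ι r) : grad (fun x => f x * g x) x = f x • grad g x + g x • grad f x :=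
  grad_eq_of_hasFDerivAt (hf.hasFDerivAt_mul hg x)

theorem SphDiff.hasFDerivAt_log {f : Sph ι r → ℝ} (hf : SphDiff f) (hpos : ∀ x, 0 < f x)
    (x : Sph ι r) : HasFDerivAt (homExt fun x => Real.log (f x))
      (innerSL ℝ ((f x)⁻¹ • grad f x)) (x : EuclideanSpace ℝ ι) := by
  have h := (hf.hasFDerivAt x).log (by rw [homExt_coe]; exact (hpos x).ne')
  rw [homExt_coe] at h
  rw [map_smul]
  refine h.congr_of_eventuallyEq ?_
  filter_upwards [eventually_ne_zero x] with y hy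
  simp [homExt_of_ne _ hy]

theorem SphDiff.log {f : Sph ι r → ℝ} (hf : SphDiff f) (hpos : ∀ x, 0 < f x) :
    SphDiff (fun x => Real.log (f x)) := fun x => (hf.hasFDerivAt_log hpos x).differentiableAt

theorem SphDiff.grad_log {f : Sph ι r → ℝ} (hf : SphDiff f) (hpos : ∀ x, 0 < f x)
    (x : Sph ι r) : grad (fun x => Real.log (f x)) x = (f x)⁻¹ • grad f x :=
  grad_eq_of_hasFDerivAt (hf.hasFDerivAt_log hpos x)

theorem homExt_comp (f : Sph ι r → ℝ) (U : EuclideanSpace ℝ ι →ₗᵢ[ℝ] EuclideanSpace ℝ ι)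
    {y : EuclideanSpace ℝ ι} (hy : y ≠ 0) :
    homExt (fun x => f (onSphere U x)) y = homExt f (U y) := by
  have hU : U y ≠ 0 := by
    rw [← norm_ne_zero_iff, U.norm_map]
    exact norm_ne_zero_iff.2 hy
  rw [homExt_of_ne _ hy, homExt_of_ne _ hU]
  congr 1
  ext1
  simp [onSphere]

theorem SphDiff.inner_grad_comp {f : Sph ι r → ℝ} (hf : SphDiff f)
    (U : EuclideanSpace ℝ ι →ₗᵢ[ℝ] EuclideanSpace ℝ ι) (x : Sph ι r) (z : EuclideanSpace ℝ ι) :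
    inner ℝ (grad (fun x => f (onSphere U x)) x) z = inner ℝ (grad f (onSphere U x)) (U z) := by
  have h := (hf.hasFDerivAt (onSphere U x)).comp (x : EuclideanSpace ℝ ι)
    U.toContinuousLinearMap.hasFDerivAt
  have h2 := h.congr_of_eventuallyEq (f₁ := homExt fun x => f (onSphere U x)) (by
    filter_upwards [eventually_ne_zero x] with y hy using homExt_comp f U hy)
  rw [inner_grad, h2.fderiv]
  rfl

theorem SphDiff.map_grad_comp {f : Sph ι r → ℝ} (hf : SphDiff f)
    (U : EuclideanSpace ℝ ι →ₗᵢ[ℝ] EuclideanSpace ℝ ι) (x : Sph ι r) :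
    U (grad (fun x => f (onSphere U x)) x) = grad f (onSphere U x) := by
  refine ext_inner_right ℝ fun z => ?_
  obtain ⟨w, rfl⟩ := (U.toLinearIsometryEquiv rfl).surjective z
  change inner ℝ _ (U w) = inner ℝ _ (U w)
  rw [U.inner_map_map, hf.inner_grad_comp]

/-- The gradient of a function on the sphere is tangential. -/
theorem SphDiff.inner_grad_self {f : Sph ι r → ℝ} (hf : SphDiff f) (x : Sph ι r) :
    inner ℝ (grad f x) (x : EuclideanSpace ℝ ι) = 0 := by
  have hc : HasDerivAt (fun s : ℝ => s • (x : EuclideanSpace ℝ ι)) (x : EuclideanSpace ℝ ι) 1 := by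
    simpa using (hasDerivAt_id (1 : ℝ)).smul_const (x : EuclideanSpace ℝ ι)
  have h := hf.hasDerivAt_curve x (one_smul _ _) hc
  refine h.unique ((hasDerivAt_const (1 : ℝ) (f x)).congr_of_eventuallyEq ?_)
  filter_upwards [isOpen_Ioi.mem_nhds (show (1 : ℝ) ∈ Set.Ioi 0 by simp)] with s hs
  have hs' : (0 : ℝ) < s := hs
  rw [homExt_of_ne f (smul_ne_zero hs'.ne' (coe_ne_zero x))]
  congr 1
  ext1
  have hr0 := hr.out.ne'
  simp only [norm_smul, norm_eq_of_mem_sphere x, smul_smul, Real.norm_of_nonneg hs'.le]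
  rw [show r / (s * r) * s = 1 by field_simp, one_smul]

/-- The derivative along the rotations in the plane of the coordinates `a` and `b`. -/
def angD (a b : ι) (f : Sph ι r → ℝ) (x : Sph ι r) : ℝ :=
  (x : EuclideanSpace ℝ ι) a * grad f x b - (x : EuclideanSpace ℝ ι) b * grad f x a

variable [DecidableEq ι]

theorem hasDerivAt_collision {a b : ι} (hab : a ≠ b) (y : EuclideanSpace ℝ ι) (θ : ℝ) :
    HasDerivAt (fun θ => collision hab θ y)
      ((collision hab θ y) a • EuclideanSpace.single b (1 : ℝ)
        - (collision hab θ y) b • EuclideanSpace.single a (1 : ℝ)) θ := by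
  have key : HasDerivAt (fun θ => (collision hab θ y).ofLp)
      ((collision hab θ y) a • EuclideanSpace.single b (1 : ℝ)
        - (collision hab θ y) b • EuclideanSpace.single a (1 : ℝ)).ofLp θ := by
    rw [hasDerivAt_pi]
    intro k
    have hs := (Real.hasDerivAt_sin θ)
    have hc := (Real.hasDerivAt_cos θ)
    by_cases h1 : k = a
    · subst h1
      simp only [collision, LinearIsometry.coe_mk, LinearMap.coe_mk, AddHom.coe_mk, if_true]
      refine ((hc.const_mul (y k)).sub (hs.const_mul (y b))).congr_deriv ?_
      simp [hab, hab.symm]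
      ring
    · by_cases h2 : k = b
      · subst h2
        simp only [collision, LinearIsometry.coe_mk, LinearMap.coe_mk, AddHom.coe_mk, if_true,
          if_neg h1]
        refine ((hs.const_mul (y a)).add (hc.const_mul (y k))).congr_deriv ?_
        simp [hab.symm]
        ring
      · simp only [collision, LinearIsometry.coe_mk, LinearMap.coe_mk, AddHom.coe_mk, if_neg h1,
          if_neg h2]
        refine (hasDerivAt_const θ (y k)).congr_deriv ?_
        simp only [PiLp.sub_apply, PiLp.smul_apply, PiLp.single_apply, if_neg h1,
          if_neg h2, smul_zero, sub_zero]
  exact (PiLp.continuousLinearEquiv 2 ℝ (fun _ : ι => ℝ)).symm.toContinuousLinearMap.hasFDerivAt.comp_hasDerivAt θ key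

theorem SphDiff.hasDerivAt_rotation {f : Sph ι r → ℝ} (hf : SphDiff f) {a b : ι} (hab : a ≠ b)
    (x : Sph ι r) (θ : ℝ) :
    HasDerivAt (fun θ => f (onSphere (collision hab θ) x))
      (angD a b f (onSphere (collision hab θ) x)) θ := by
  have h := hf.hasDerivAt_curve (onSphere (collision hab θ) x) rfl (hasDerivAt_collision hab x θ)
  refine (h.congr_deriv ?_).congr_of_eventuallyEq (Filter.Eventually.of_forall fun θ =>
    (homExt_coe f (onSphere (collision hab θ) x)).symm)
  rw [inner_sub_right, inner_smul_right, inner_smul_right]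
  simp [angD, onSphere, EuclideanSpace.inner_single_right]

theorem collision_zero {a b : ι} (hab : a ≠ b) (y : EuclideanSpace ℝ ι) :
    collision hab 0 y = y := by
  ext k
  simp only [collision, LinearIsometry.coe_mk, LinearMap.coe_mk, AddHom.coe_mk]
  split_ifs with h1 h2 <;> simp [*]

theorem onSphere_collision_zero {a b : ι} (hab : a ≠ b) (x : Sph ι r) :
    onSphere (collision hab 0) x = x := Subtype.ext (collision_zero hab x)

theorem angD_self (a : ι) (f : Sph ι r → ℝ) (x : Sph ι r) : angD a a f x = 0 := by simp [angD]

/-- Reads off a rotational derivative from the values along one orbit, without computing a gradient.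
It serves for the coordinate functions and for functions invariant under a plane rotation. -/
theorem angD_unique {f : Sph ι r → ℝ} (hf : SphDiff f) {a b : ι} (hab : a ≠ b) (x : Sph ι r)
    {d : ℝ} (h : HasDerivAt (fun θ => f (onSphere (collision hab θ) x)) d 0) :
    angD a b f x = d := by
  have h2 := hf.hasDerivAt_rotation hab x 0
  rw [onSphere_collision_zero] at h2
  exact h2.unique h

theorem sphDiff_coord (a : ι) : SphDiff (fun x : Sph ι r => (x : EuclideanSpace ℝ ι) a) := by
  intro x
  have h : DifferentiableAt ℝ (fun y : EuclideanSpace ℝ ι => r / ‖y‖ * y a) x := by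
    have h1 : DifferentiableAt ℝ (fun y : EuclideanSpace ℝ ι => ‖y‖) x :=
      (contDiffAt_norm ℝ (coe_ne_zero x) (n := 1)).differentiableAt (by norm_num)
    have h2 : DifferentiableAt ℝ (fun y : EuclideanSpace ℝ ι => y a) x :=
      (EuclideanSpace.proj a : EuclideanSpace ℝ ι →L[ℝ] ℝ).differentiableAt
    have h3 : DifferentiableAt ℝ (fun y : EuclideanSpace ℝ ι => r / ‖y‖) x := by
      simp only [div_eq_mul_inv]
      exact (h1.inv (norm_ne_zero_iff.2 (coe_ne_zero x))).const_mul r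
    exact h3.mul h2
  refine h.congr_of_eventuallyEq ?_
  filter_upwards [eventually_ne_zero x] with y hy
  simp [homExt_of_ne _ hy]

theorem angD_coord {a b : ι} (hab : a ≠ b) (c : ι) (x : Sph ι r) :
    angD a b (fun x : Sph ι r => (x : EuclideanSpace ℝ ι) c) x
      = (if c = b then (x : EuclideanSpace ℝ ι) a else 0)
        - (if c = a then (x : EuclideanSpace ℝ ι) b else 0) := by
  refine angD_unique (sphDiff_coord c) hab x ?_
  have h := hasDerivAt_collision hab (x : EuclideanSpace ℝ ι) 0
  rw [collision_zero] at h
  have h2 := (EuclideanSpace.proj c : EuclideanSpace ℝ ι →L[ℝ] ℝ).hasFDerivAt.comp_hasDerivAt 0 h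
  refine h2.congr_deriv ?_
  simp

theorem SphDiff.angD_add {f g : Sph ι r → ℝ} (hf : SphDiff f) (hg : SphDiff g) (a b : ι)
    (x : Sph ι r) : angD a b (fun x => f x + g x) x = angD a b f x + angD a b g x := by
  simp only [angD, hf.grad_add hg, PiLp.add_apply]
  ring

theorem SphDiff.angD_mul {f g : Sph ι r → ℝ} (hf : SphDiff f) (hg : SphDiff g) (a b : ι)
    (x : Sph ι r) :
    angD a b (fun x => f x * g x) x = f x * angD a b g x + angD a b f x * g x := by
  simp only [angD, hf.grad_mul hg, PiLp.add_apply, PiLp.smul_apply, smul_eq_mul]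
  ring

theorem SphDiff.angD_log {f : Sph ι r → ℝ} (hf : SphDiff f) (hpos : ∀ x, 0 < f x) (a b : ι)
    (x : Sph ι r) : angD a b (fun x => Real.log (f x)) x = angD a b f x / f x := by
  simp only [angD, hf.grad_log hpos, PiLp.smul_apply, smul_eq_mul]
  field_simp

end Calculus

/-! ### Polynomial functions on the sphere -/

section Polynomials

variable {ι : Type*} [Fintype ι] {r : ℝ}

/-- A coordinate as a continuous function on the sphere. -/
def coordFn (r : ℝ) (a : ι) : C(Sph ι r, ℝ) :=
  ⟨fun x => (x : EuclideanSpace ℝ ι) a, by fun_prop⟩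

/-- The affine functions on the sphere. -/
def affineSpace (ι : Type*) [Fintype ι] (r : ℝ) : Submodule ℝ C(Sph ι r, ℝ) :=
  Submodule.span ℝ (insert 1 (Set.range (coordFn r)))

/-- The polynomials of degree at most `d` on the sphere. -/
def polySpace (ι : Type*) [Fintype ι] (r : ℝ) (d : ℕ) : Submodule ℝ C(Sph ι r, ℝ) :=
  affineSpace ι r ^ d

instance instFiniteDimensionalPolySpace (d : ℕ) : FiniteDimensional ℝ (polySpace ι r d) := by
  refine Module.Finite.iff_fg.2 (Submodule.FG.pow ?_ d)
  exact Submodule.fg_span ((Set.finite_range _).insert _)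

theorem one_mem_affineSpace : (1 : C(Sph ι r, ℝ)) ∈ affineSpace ι r :=
  Submodule.subset_span (Set.mem_insert _ _)

theorem coordFn_mem_affineSpace (a : ι) : coordFn r a ∈ affineSpace ι r :=
  Submodule.subset_span (Set.mem_insert_of_mem _ ⟨a, rfl⟩)

theorem const_mem_polySpace (d : ℕ) (c : ℝ) :
    (algebraMap ℝ C(Sph ι r, ℝ) c) ∈ polySpace ι r d := by
  rw [Algebra.algebraMap_eq_smul_one, ← one_pow d]
  exact Submodule.smul_mem _ _ (Submodule.pow_mem_pow _ one_mem_affineSpace d)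

variable [hr : Fact (0 < r)] [DecidableEq ι]

theorem SphDiff.const_mul {f : Sph ι r → ℝ} (hf : SphDiff f) (c : ℝ) :
    SphDiff (fun x => c * f x) := (sphDiff_const c).mul hf

theorem angD_const (c : ℝ) (a b : ι) (x : Sph ι r) : angD a b (fun _ => c) x = 0 := by
  simp [angD, grad_const]

theorem SphDiff.angD_const_mul {f : Sph ι r → ℝ} (hf : SphDiff f) (c : ℝ) (a b : ι)
    (x : Sph ι r) : angD a b (fun x => c * f x) x = c * angD a b f x := by
  rw [(sphDiff_const c).angD_mul hf, angD_const, zero_mul, add_zero]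

/-- A rotation generator sends a coordinate to plus or minus a coordinate or to zero, so it does not
raise the degree, unlike the partial derivatives of the homogeneous extension. -/
theorem affineSpace_angD {f : C(Sph ι r, ℝ)} (hf : f ∈ affineSpace ι r) :
    SphDiff f ∧ ∀ a b, ∃ g ∈ affineSpace ι r, ∀ x, g x = angD a b f x := by
  induction hf using Submodule.span_induction with
  | mem f hf =>
    rcases hf with rfl | ⟨c, rfl⟩
    · exact ⟨sphDiff_const 1, fun a b => ⟨0, zero_mem _, fun x => (angD_const 1 a b x).symm⟩⟩
    · refine ⟨sphDiff_coord c, fun a b => ?_⟩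
      by_cases hab : a = b
      · subst hab
        exact ⟨0, zero_mem _, fun x => (angD_self a _ x).symm⟩
      · refine ⟨(if c = b then coordFn r a else 0) - (if c = a then coordFn r b else 0),
          Submodule.sub_mem _ ?_ ?_, fun x => ?_⟩
        · split_ifs
          · exact coordFn_mem_affineSpace a
          · exact zero_mem _
        · split_ifs
          · exact coordFn_mem_affineSpace b
          · exact zero_mem _
        · refine Eq.trans ?_ (angD_coord hab c x).symm
          split_ifs <;> simp [coordFn]
  | zero => exact ⟨sphDiff_const 0, fun a b => ⟨0, zero_mem _, fun x => (angD_const 0 a b x).symm⟩⟩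
  | add f g _ _ hf hg =>
    refine ⟨hf.1.add hg.1, fun a b => ?_⟩
    obtain ⟨f', hf', hf2⟩ := hf.2 a b
    obtain ⟨g', hg', hg2⟩ := hg.2 a b
    exact ⟨f' + g', add_mem hf' hg', fun x => by
      rw [ContinuousMap.add_apply, hf2, hg2]; exact (hf.1.angD_add hg.1 a b x).symm⟩
  | smul c f _ hf =>
    refine ⟨hf.1.const_mul c, fun a b => ?_⟩
    obtain ⟨f', hf', hf2⟩ := hf.2 a b
    exact ⟨c • f', Submodule.smul_mem _ c hf', fun x => by
      rw [ContinuousMap.smul_apply, hf2]; exact (hf.1.angD_const_mul c a b x).symm⟩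

/-- The affine case propagates to powers by the Leibniz rule. -/
theorem polySpace_angD {d : ℕ} {f : C(Sph ι r, ℝ)} (hf : f ∈ polySpace ι r d) :
    SphDiff f ∧ ∀ a b, ∃ g ∈ polySpace ι r d, ∀ x, g x = angD a b f x := by
  induction hf using Submodule.pow_induction_on_left' with
  | algebraMap c =>
    exact ⟨sphDiff_const c, fun a b => ⟨0, zero_mem _, fun x => (angD_const c a b x).symm⟩⟩
  | add f g i _ _ hf hg =>
    refine ⟨hf.1.add hg.1, fun a b => ?_⟩
    obtain ⟨f', hf', hf2⟩ := hf.2 a b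
    obtain ⟨g', hg', hg2⟩ := hg.2 a b
    exact ⟨f' + g', add_mem hf' hg', fun x => by
      rw [ContinuousMap.add_apply, hf2, hg2]; exact (hf.1.angD_add hg.1 a b x).symm⟩
  | mem_mul m hm i f hf' hf =>
    have hm' := affineSpace_angD hm
    refine ⟨hm'.1.mul hf.1, fun a b => ?_⟩
    obtain ⟨f', hf', hf2⟩ := hf.2 a b
    obtain ⟨m', hm2, hm3⟩ := hm'.2 a b
    refine ⟨m * f' + m' * f, ?_, fun x => ?_⟩
    · rw [polySpace, pow_succ']
      exact add_mem (Submodule.mul_mem_mul hm hf') (Submodule.mul_mem_mul hm2 ‹_›)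
    · rw [ContinuousMap.add_apply, ContinuousMap.mul_apply, ContinuousMap.mul_apply, hf2, hm3]
      exact (hm'.1.angD_mul hf.1 a b x).symm

theorem sphDiff_poly {d : ℕ} (f : polySpace ι r d) : SphDiff f.1 := (polySpace_angD f.2).1

/-- The derivation `angD a b` on the polynomials of degree at most `d`. -/
def angDL (d : ℕ) (a b : ι) : polySpace ι r d →ₗ[ℝ] polySpace ι r d where
  toFun f := ⟨((polySpace_angD f.2).2 a b).choose, ((polySpace_angD f.2).2 a b).choose_spec.1⟩
  map_add' f g := by
    ext x
    simp only [Submodule.coe_add, ContinuousMap.add_apply]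
    rw [((polySpace_angD f.2).2 a b).choose_spec.2, ((polySpace_angD g.2).2 a b).choose_spec.2,
      ((polySpace_angD (f + g).2).2 a b).choose_spec.2]
    exact (sphDiff_poly f).angD_add (sphDiff_poly g) a b x
  map_smul' c f := by
    ext x
    simp only [Submodule.coe_smul, ContinuousMap.smul_apply, RingHom.id_apply]
    rw [((polySpace_angD f.2).2 a b).choose_spec.2,
      ((polySpace_angD (c • f).2).2 a b).choose_spec.2]
    exact (sphDiff_poly f).angD_const_mul c a b x

theorem angDL_apply {d : ℕ} (a b : ι) (f : polySpace ι r d) (x : Sph ι r) :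
    (angDL d a b f).1 x = angD a b f.1 x := ((polySpace_angD f.2).2 a b).choose_spec.2 x

/-- The spherical Laplacian on the polynomials of degree at most `d`. -/
def lap (ι : Type*) [Fintype ι] [DecidableEq ι] (r : ℝ) [Fact (0 < r)] (d : ℕ) :
    polySpace ι r d →ₗ[ℝ] polySpace ι r d :=
  (1 / 2 : ℝ) • ∑ a : ι, ∑ b : ι,
    (angDL d a b : polySpace ι r d →ₗ[ℝ] polySpace ι r d) ∘ₗ angDL d a b

theorem lap_apply {d : ℕ} (f : polySpace ι r d) (x : Sph ι r) :
    (lap ι r d f).1 x = 1 / 2 * ∑ a, ∑ b, angD a b (angDL d a b f).1 x := by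
  simp only [lap, LinearMap.smul_apply, LinearMap.sum_apply, LinearMap.comp_apply,
    Submodule.coe_smul, Submodule.coe_sum, ContinuousMap.smul_apply, ContinuousMap.sum_apply,
    smul_eq_mul, angDL_apply]

/-! ### Rotations of polynomials -/

theorem affineSpace_comp {f : C(Sph ι r, ℝ)} (hf : f ∈ affineSpace ι r)
    (U : EuclideanSpace ℝ ι →ₗᵢ[ℝ] EuclideanSpace ℝ ι) :
    f.comp ⟨onSphere U, continuous_onSphere U⟩ ∈ affineSpace ι r := by
  induction hf using Submodule.span_induction with
  | mem f hf =>
    rcases hf with rfl | ⟨c, rfl⟩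
    · exact one_mem_affineSpace
    · have h : (coordFn r c).comp ⟨onSphere U, continuous_onSphere U⟩
          = ∑ a : ι, (U (EuclideanSpace.single a 1)) c • coordFn r a := by
        ext x
        simp only [ContinuousMap.comp_apply, ContinuousMap.sum_apply, ContinuousMap.smul_apply,
          coordFn, ContinuousMap.coe_mk, onSphere]
        have hx : (x : EuclideanSpace ℝ ι)
            = ∑ a, (x : EuclideanSpace ℝ ι) a • EuclideanSpace.single a (1 : ℝ) := by
          ext k
          simp only [WithLp.ofLp_sum, Finset.sum_apply, PiLp.smul_apply,
            PiLp.single_apply, smul_eq_mul]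
          simp
        conv_lhs => rw [hx, map_sum]
        simp [mul_comm]
      rw [h]
      exact Submodule.sum_mem _ fun a _ => Submodule.smul_mem _ _ (coordFn_mem_affineSpace a)
  | zero => exact zero_mem _
  | add f g _ _ hf hg => exact add_mem hf hg
  | smul c f _ hf => exact Submodule.smul_mem _ c hf

theorem polySpace_comp {d : ℕ} {f : C(Sph ι r, ℝ)} (hf : f ∈ polySpace ι r d)
    (U : EuclideanSpace ℝ ι →ₗᵢ[ℝ] EuclideanSpace ℝ ι) :
    f.comp ⟨onSphere U, continuous_onSphere U⟩ ∈ polySpace ι r d := by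
  induction hf using Submodule.pow_induction_on_left' with
  | algebraMap c => exact const_mem_polySpace 0 c
  | add f g i _ _ hf hg => exact add_mem hf hg
  | mem_mul m hm i f hf' hf =>
    rw [polySpace, pow_succ']
    exact Submodule.mul_mem_mul (affineSpace_comp hm U) hf

/-- Composition with an isometry, on the polynomials of degree at most `d`. -/
def compL (d : ℕ) (U : EuclideanSpace ℝ ι →ₗᵢ[ℝ] EuclideanSpace ℝ ι) :
    polySpace ι r d →ₗ[ℝ] polySpace ι r d where
  toFun f := ⟨f.1.comp ⟨onSphere U, continuous_onSphere U⟩, polySpace_comp f.2 U⟩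
  map_add' _ _ := rfl
  map_smul' _ _ := rfl

theorem compL_apply {d : ℕ} (U : EuclideanSpace ℝ ι →ₗᵢ[ℝ] EuclideanSpace ℝ ι)
    (f : polySpace ι r d) (x : Sph ι r) : (compL d U f).1 x = f.1 (onSphere U x) := rfl

end Polynomials

/-! ### Integration by parts -/

/-- Invariance of a measure on a centred sphere under all linear isometries. -/
class RotInvariant {ι : Type*} [Fintype ι] {r : ℝ} (σ : Measure (Sph ι r)) : Prop where
  measurePreserving : ∀ U : EuclideanSpace ℝ ι →ₗᵢ[ℝ] EuclideanSpace ℝ ι,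
    MeasurePreserving (onSphere U) σ σ

section Integration

variable {ι : Type*} [Fintype ι] {r : ℝ} (σ : Measure (Sph ι r)) [IsProbabilityMeasure σ]

theorem integrable_of_continuous {f : Sph ι r → ℝ} (hf : Continuous f) : Integrable f σ :=
  hf.integrable_of_hasCompactSupport (HasCompactSupport.of_compactSpace f)

theorem integral_rotation [RotInvariant σ] {f : Sph ι r → ℝ} (hf : Continuous f)
    (U : EuclideanSpace ℝ ι →ₗᵢ[ℝ] EuclideanSpace ℝ ι) :
    ∫ x, f (onSphere U x) ∂σ = ∫ x, f x ∂σ := by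
  have hm := RotInvariant.measurePreserving (σ := σ) U
  have h := integral_map (μ := σ) (f := f) hm.measurable.aemeasurable
    hf.aestronglyMeasurable
  rw [hm.map_eq] at h
  exact h.symm

variable [hr : Fact (0 < r)] [DecidableEq ι] [RotInvariant σ]

/-- By invariance of the measure, `θ ↦ ∫ f(r_ab(θ)⁻¹ x)` is constant; its derivative at `0` is this
integral. Applied to products it gives integration by parts. -/
theorem integral_angD {f : Sph ι r → ℝ} (hf : SphDiff f) (hc : Continuous f) {a b : ι}
    (hc' : Continuous (angD a b f)) : ∫ x, angD a b f x ∂σ = 0 := by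
  by_cases hab : a = b
  · subst hab
    simp [angD_self]
  obtain ⟨C, hC⟩ := isCompact_univ.exists_bound_of_continuousOn (hc'.continuousOn (s := Set.univ))
  have h := (hasDerivAt_integral_of_dominated_loc_of_deriv_le (μ := σ) (x₀ := (0 : ℝ))
    (F := fun θ x => f (onSphere (collision hab θ) x))
    (F' := fun θ x => angD a b f (onSphere (collision hab θ) x)) (bound := fun _ => C)
    (s := Set.univ) Filter.univ_mem
    (Filter.Eventually.of_forall fun θ =>
      (hc.comp (continuous_onSphere _)).aestronglyMeasurable)
    (integrable_of_continuous σ (hc.comp (continuous_onSphere _)))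
    (hc'.comp (continuous_onSphere _)).aestronglyMeasurable
    (Filter.Eventually.of_forall fun x θ _ => hC _ trivial) (integrable_const C)
    (Filter.Eventually.of_forall fun x θ _ => hf.hasDerivAt_rotation hab x θ)).2
  simp only [integral_rotation σ hc, onSphere_collision_zero] at h
  exact h.unique (hasDerivAt_const _ _)

theorem integral_mul_angD {f g : Sph ι r → ℝ} (hf : SphDiff f) (hcf : Continuous f)
    (hg : SphDiff g) (hcg : Continuous g) {a b : ι} (hcf' : Continuous (angD a b f))
    (hcg' : Continuous (angD a b g)) :
    ∫ x, f x * angD a b g x ∂σ = - ∫ x, angD a b f x * g x ∂σ := by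
  have heq : angD a b (fun x => f x * g x) = fun x => f x * angD a b g x + angD a b f x * g x :=
    funext fun x => hf.angD_mul hg a b x
  have h := integral_angD σ (hf.mul hg) (hcf.mul hcg) (a := a) (b := b)
    (by rw [heq]; exact (hcf.mul hcg').add (hcf'.mul hcg))
  rw [heq] at h
  exact eq_neg_of_add_eq_zero_left ((integral_add (integrable_of_continuous σ (hcf.mul hcg'))
    (integrable_of_continuous σ (hcf'.mul hcg))).symm.trans h)

theorem continuous_angD_poly {d : ℕ} (f : polySpace ι r d) (a b : ι) :
    Continuous (angD a b f.1) := by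
  have h : angD a b f.1 = (angDL d a b f).1 := funext fun x => (angDL_apply a b f x).symm
  rw [h]
  exact (angDL d a b f).1.continuous

/-- Green's formula on the sphere. -/
theorem integral_mul_lap {d : ℕ} {g : Sph ι r → ℝ} (hg : SphDiff g) (hcg : Continuous g)
    (hcg' : ∀ a b, Continuous (angD a b g)) (f : polySpace ι r d) :
    ∫ x, g x * (lap ι r d f).1 x ∂σ
      = - ∫ x, 1 / 2 * ∑ a, ∑ b, angD a b g x * angD a b f.1 x ∂σ := by
  have h : ∀ a b, ∫ x, g x * angD a b (angDL d a b f).1 x ∂σ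
      = - ∫ x, angD a b g x * angD a b f.1 x ∂σ := by
    intro a b
    rw [integral_mul_angD σ hg hcg (sphDiff_poly _) (angDL d a b f).1.continuous (hcg' a b)
      (continuous_angD_poly _ a b)]
    simp only [angDL_apply]
  have hi : ∀ a b, Integrable (fun x => g x * angD a b (angDL d a b f).1 x) σ := fun a b =>
    integrable_of_continuous σ (hcg.mul (continuous_angD_poly _ a b))
  have hi' : ∀ a b, Integrable (fun x => angD a b g x * angD a b f.1 x) σ := fun a b =>
    integrable_of_continuous σ ((hcg' a b).mul (continuous_angD_poly _ a b))
  calc ∫ x, g x * (lap ι r d f).1 x ∂σ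
      = ∫ x, 1 / 2 * ∑ a, ∑ b, g x * angD a b (angDL d a b f).1 x ∂σ := by
        congr 1
        ext x
        rw [lap_apply]
        simp only [Finset.mul_sum]
        refine Finset.sum_congr rfl fun a _ => Finset.sum_congr rfl fun b _ => by ring
    _ = 1 / 2 * ∑ a, ∑ b, ∫ x, g x * angD a b (angDL d a b f).1 x ∂σ := by
        rw [integral_const_mul, integral_finsetSum _ fun a _ =>
          integrable_finsetSum _ fun b _ => hi a b]
        congr 1
        exact Finset.sum_congr rfl fun a _ => integral_finsetSum _ fun b _ => hi a b
    _ = - (1 / 2 * ∑ a, ∑ b, ∫ x, angD a b g x * angD a b f.1 x ∂σ) := by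
        simp only [h, Finset.sum_neg_distrib, mul_neg]
    _ = _ := by
        rw [integral_const_mul, integral_finsetSum _ fun a _ =>
          integrable_finsetSum _ fun b _ => hi' a b]
        congr 2
        exact Finset.sum_congr rfl fun a _ => (integral_finsetSum _ fun b _ => hi' a b).symm

theorem integral_lap {d : ℕ} (f : polySpace ι r d) : ∫ x, (lap ι r d f).1 x ∂σ = 0 := by
  have h := integral_mul_lap σ (sphDiff_const 1) continuous_const
    (fun a b => by simpa only [funext (angD_const 1 a b)] using continuous_const) f
  simpa [angD_const] using h

/-- The squared length of the gradient through the rotational derivatives. -/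
theorem sum_angD_mul {f g : Sph ι r → ℝ} (hf : SphDiff f) (x : Sph ι r) :
    1 / 2 * ∑ a, ∑ b, angD a b f x * angD a b g x = r ^ 2 * inner ℝ (grad f x) (grad g x) := by
  have hx : ∑ a, (x : EuclideanSpace ℝ ι) a * (x : EuclideanSpace ℝ ι) a = r ^ 2 := by
    have h := EuclideanSpace.real_norm_sq_eq (x : EuclideanSpace ℝ ι)
    rw [norm_eq_of_mem_sphere x] at h
    rw [h]
    exact Finset.sum_congr rfl fun a _ => (sq _).symm
  have hfx : ∑ a, grad f x a * (x : EuclideanSpace ℝ ι) a = 0 := by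
    have h := hf.inner_grad_self x
    rw [PiLp.inner_apply] at h
    simpa [mul_comm] using h
  have hfg : inner ℝ (grad f x) (grad g x) = ∑ a, grad f x a * grad g x a := by
    rw [PiLp.inner_apply]
    simp [mul_comm]
  -- The double sum factorizes into single sums; the mixed ones vanish since `grad f` is orthogonal
  -- to `x`, and the two others contribute `|x|² = r²` each, whence the factor `1 / 2`.
  have key : ∀ a b, angD a b f x * angD a b g x
      = ((x : EuclideanSpace ℝ ι) a * (x : EuclideanSpace ℝ ι) a) * (grad f x b * grad g x b)
        - ((x : EuclideanSpace ℝ ι) a * grad g x a) * (grad f x b * (x : EuclideanSpace ℝ ι) b)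
        - (grad f x a * (x : EuclideanSpace ℝ ι) a) * ((x : EuclideanSpace ℝ ι) b * grad g x b)
        + (grad f x a * grad g x a) * ((x : EuclideanSpace ℝ ι) b * (x : EuclideanSpace ℝ ι) b) :=
    fun a b => by simp only [angD]; ring
  simp only [key, Finset.sum_add_distrib, Finset.sum_sub_distrib, ← Finset.mul_sum,
    ← Finset.sum_mul, hx, hfx, hfg]
  ring

/-- By `sum_angD_mul` the integrand is an inner product of gradients, and gradients transform
isometrically under rotations. -/
theorem dirichlet_comp {d : ℕ} (f g : polySpace ι r d)
    (U : EuclideanSpace ℝ ι →ₗᵢ[ℝ] EuclideanSpace ℝ ι) :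
    ∫ x, 1 / 2 * ∑ a, ∑ b, angD a b (compL d U g).1 x * angD a b (compL d U f).1 x ∂σ
      = ∫ x, 1 / 2 * ∑ a, ∑ b, angD a b g.1 x * angD a b f.1 x ∂σ := by
  have hc : Continuous fun x => 1 / 2 * ∑ a, ∑ b, angD a b g.1 x * angD a b f.1 x :=
    continuous_const.mul (continuous_finsetSum _ fun a _ => continuous_finsetSum _ fun b _ =>
      (continuous_angD_poly g a b).mul (continuous_angD_poly f a b))
  rw [← integral_rotation σ hc U]
  congr 1
  ext x
  rw [sum_angD_mul (sphDiff_poly _), sum_angD_mul (sphDiff_poly _),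
    ← (sphDiff_poly f).map_grad_comp U x, ← (sphDiff_poly g).map_grad_comp U x, U.inner_map_map]
  rfl

theorem eq_zero_of_integral_sq [σ.IsOpenPosMeasure] {f : C(Sph ι r, ℝ)}
    (h : ∫ x, f x * f x ∂σ = 0) : f = 0 := by
  have hc : Continuous fun x => f x * f x := f.continuous.mul f.continuous
  rw [integral_eq_zero_iff_of_nonneg (fun x => mul_self_nonneg _)
    (integrable_of_continuous σ hc)] at h
  have h2 := hc.ae_eq_iff_eq σ continuous_const |>.1 h
  ext x
  exact mul_self_eq_zero.1 (congrFun h2 x)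

theorem compL_surjective (d : ℕ) (U : EuclideanSpace ℝ ι →ₗᵢ[ℝ] EuclideanSpace ℝ ι)
    (g : polySpace ι r d) : ∃ h, compL d U h = g := by
  refine ⟨compL d (U.toLinearIsometryEquiv rfl).symm.toLinearIsometry g, ?_⟩
  ext x
  rw [compL_apply, compL_apply]
  congr 1
  ext1
  exact (U.toLinearIsometryEquiv rfl).symm_apply_apply x

/-- The spherical Laplacian commutes with isometries. -/
theorem lap_compL [σ.IsOpenPosMeasure] {d : ℕ} (U : EuclideanSpace ℝ ι →ₗᵢ[ℝ] EuclideanSpace ℝ ι)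
    (f : polySpace ι r d) : lap ι r d (compL d U f) = compL d U (lap ι r d f) := by
  -- Weak formulation: the commutator is itself a rotated polynomial, so it can be tested against
  -- itself. Green's formula and the invariance of the Dirichlet form then give it zero `L²` norm.
  obtain ⟨h, hh⟩ := compL_surjective d U (lap ι r d (compL d U f) - compL d U (lap ι r d f))
  rw [← sub_eq_zero, ← hh]
  refine Subtype.ext (eq_zero_of_integral_sq σ ?_)
  have h1 := integral_mul_lap σ (sphDiff_poly (compL d U h)) (compL d U h).1.continuous
    (continuous_angD_poly _) (compL d U f)
  have h2 : ∫ x, h.1 (onSphere U x) * (lap ι r d f).1 (onSphere U x) ∂σ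
      = ∫ x, h.1 x * (lap ι r d f).1 x ∂σ :=
    integral_rotation σ (h.1.continuous.mul (lap ι r d f).1.continuous) U
  rw [dirichlet_comp, ← integral_mul_lap σ (sphDiff_poly h) h.1.continuous
    (continuous_angD_poly h) f, ← h2] at h1
  have h3 : ∀ x, (compL d U h).1 x * (compL d U h).1 x
      = (compL d U h).1 x * (lap ι r d (compL d U f)).1 x
          - h.1 (onSphere U x) * (lap ι r d f).1 (onSphere U x) := by
    intro x
    have h4 : (compL d U h).1 x
        = (lap ι r d (compL d U f)).1 x - (lap ι r d f).1 (onSphere U x) := by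
      rw [hh]
      rfl
    nth_rewrite 2 [h4]
    rw [mul_sub, compL_apply]
  simp only [h3]
  rw [integral_sub, h1, sub_self]
  · exact integrable_of_continuous σ ((compL d U h).1.continuous.mul
      (lap ι r d (compL d U f)).1.continuous)
  · exact integrable_of_continuous σ
      ((h.1.continuous.mul (lap ι r d f).1.continuous).comp (continuous_onSphere U))

end Integration

/-! ### Directional Fisher information -/

section Fisher

variable {ι : Type*} [Fintype ι] {r : ℝ}

/-- The component of the infinitesimal rotations of `f` in the direction `u`. -/
def rotField (u : EuclideanSpace ℝ ι) (f : Sph ι r → ℝ) (x : Sph ι r) : EuclideanSpace ℝ ι :=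
  inner ℝ u (x : EuclideanSpace ℝ ι) • grad f x - inner ℝ u (grad f x) • (x : EuclideanSpace ℝ ι)

/-- The Fisher information in the direction `u`. -/
def fisher (σ : Measure (Sph ι r)) (u : EuclideanSpace ℝ ι) (f : Sph ι r → ℝ) : ℝ :=
  ∫ x, ‖rotField u f x‖ ^ 2 / f x ∂σ

theorem rotField_add_left (u v : EuclideanSpace ℝ ι) (f : Sph ι r → ℝ) (x : Sph ι r) :
    rotField (u + v) f x = rotField u f x + rotField v f x := by
  simp only [rotField, inner_add_left]
  module

theorem rotField_smul_left (c : ℝ) (u : EuclideanSpace ℝ ι) (f : Sph ι r → ℝ) (x : Sph ι r) :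
    rotField (c • u) f x = c • rotField u f x := by
  simp only [rotField, real_inner_smul_left]
  module

theorem rotField_apply (u : EuclideanSpace ℝ ι) (f : Sph ι r → ℝ) (x : Sph ι r) (b : ι) :
    rotField u f x b = ∑ a, u a * angD a b f x := by
  simp only [rotField, angD, PiLp.inner_apply, PiLp.sub_apply, PiLp.smul_apply, smul_eq_mul,
    Finset.sum_mul, ← Finset.sum_sub_distrib, RCLike.inner_apply, conj_trivial]
  exact Finset.sum_congr rfl fun a _ => by ring

theorem norm_rotField_single [DecidableEq ι] (a : ι) (f : Sph ι r → ℝ) (x : Sph ι r) :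
    ‖rotField (EuclideanSpace.single a 1) f x‖ ^ 2 = ∑ b, angD a b f x ^ 2 := by
  rw [EuclideanSpace.real_norm_sq_eq]
  refine Finset.sum_congr rfl fun b _ => ?_
  rw [rotField_apply, Finset.sum_eq_single a]
  · simp
  · intro c _ hc
    simp [hc]
  · simp

variable [hr : Fact (0 < r)] [DecidableEq ι]

theorem continuous_rotField {d : ℕ} (u : EuclideanSpace ℝ ι) (f : polySpace ι r d) :
    Continuous (rotField u f.1) := by
  have h : Continuous fun x => (rotField u f.1 x).ofLp := by
    refine continuous_pi fun b => ?_
    simp only [rotField_apply]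
    exact continuous_finsetSum _ fun a _ => continuous_const.mul (continuous_angD_poly f a b)
  exact (PiLp.continuous_toLp 2 _).comp h

theorem continuous_fisherDensity {d : ℕ} (u : EuclideanSpace ℝ ι) (f : polySpace ι r d)
    (hf : ∀ x, 0 < f.1 x) : Continuous fun x => ‖rotField u f.1 x‖ ^ 2 / f.1 x :=
  ((continuous_rotField u f).norm.pow 2).div f.1.continuous fun x => (hf x).ne'

theorem fisher_nonneg (σ : Measure (Sph ι r)) (u : EuclideanSpace ℝ ι) {f : Sph ι r → ℝ}
    (hf : ∀ x, 0 < f x) : 0 ≤ fisher σ u f :=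
  integral_nonneg fun x => div_nonneg (sq_nonneg _) (hf x).le

theorem SphDiff.map_rotField_comp {f : Sph ι r → ℝ} (hf : SphDiff f)
    (U : EuclideanSpace ℝ ι →ₗᵢ[ℝ] EuclideanSpace ℝ ι) (u : EuclideanSpace ℝ ι) (x : Sph ι r) :
    U (rotField u (fun x => f (onSphere U x)) x) = rotField (U u) f (onSphere U x) := by
  rw [rotField, rotField, map_sub, map_smul, map_smul, hf.map_grad_comp,
    ← hf.map_grad_comp U x, U.inner_map_map]
  congr 2
  exact (U.inner_map_map _ _).symm

variable (σ : Measure (Sph ι r)) [IsProbabilityMeasure σ]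

/-- A rotation of the function is traded for a rotation of the direction. This turns averages over
collisions into mixtures of directional Fisher informations of one fixed `f`. -/
theorem fisher_compL [RotInvariant σ] {d : ℕ} (u : EuclideanSpace ℝ ι) {f : polySpace ι r d}
    (hf : ∀ x, 0 < f.1 x) (U : EuclideanSpace ℝ ι →ₗᵢ[ℝ] EuclideanSpace ℝ ι) :
    fisher σ u (compL d U f).1 = fisher σ (U u) f.1 := by
  rw [fisher, fisher, ← integral_rotation σ (continuous_fisherDensity (U u) f hf) U]
  congr 1
  ext x
  rw [← (sphDiff_poly f).map_rotField_comp, U.norm_map]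
  rfl

theorem rotField_add {d : ℕ} (u : EuclideanSpace ℝ ι) (f g : polySpace ι r d) (x : Sph ι r) :
    rotField u (f + g).1 x = rotField u f.1 x + rotField u g.1 x := by
  ext b
  simp only [rotField_apply, PiLp.add_apply, ← Finset.sum_add_distrib, ← mul_add]
  exact Finset.sum_congr rfl fun a _ => congrArg _ ((sphDiff_poly f).angD_add (sphDiff_poly g) a b x)

theorem rotField_smul {d : ℕ} (u : EuclideanSpace ℝ ι) (c : ℝ) (f : polySpace ι r d)
    (x : Sph ι r) : rotField u (c • f).1 x = c • rotField u f.1 x := by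
  ext b
  simp only [rotField_apply, PiLp.smul_apply, smul_eq_mul, Finset.mul_sum]
  refine Finset.sum_congr rfl fun a _ => ?_
  rw [mul_left_comm]
  exact congrArg _ ((sphDiff_poly f).angD_const_mul c a b x)

/-- The Fisher information is a supremum of linear functionals, which is attained. -/
theorem exists_fisher_support {d : ℕ} (u : EuclideanSpace ℝ ι) {f : polySpace ι r d}
    (hf : ∀ x, 0 < f.1 x) : ∃ l : polySpace ι r d →ₗ[ℝ] ℝ, l f = fisher σ u f.1 ∧
      ∀ g : polySpace ι r d, (∀ x, 0 < g.1 x) → l g ≤ fisher σ u g.1 := by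
  -- For `g > 0` one has `|v|² / g = sup_z (2⟨v, z⟩ - g |z|²)`, attained at `z = v / g`. Freezing
  -- `z` at its optimal value for `f` leaves an expression linear in `g`: a supporting functional,
  -- through which convexity is used below.
  obtain ⟨z, hz⟩ : ∃ z : Sph ι r → EuclideanSpace ℝ ι, z = fun x => (f.1 x)⁻¹ • rotField u f.1 x :=
    ⟨_, rfl⟩
  have hzc : Continuous z := by
    rw [hz]
    exact (f.1.continuous.inv₀ fun x => (hf x).ne').smul (continuous_rotField u f)
  have hc : ∀ g : polySpace ι r d, Continuous fun x =>
      2 * inner ℝ (rotField u g.1 x) (z x) - g.1 x * ‖z x‖ ^ 2 := fun g =>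
    (continuous_const.mul ((continuous_rotField u g).inner hzc)).sub
      (g.1.continuous.mul (hzc.norm.pow 2))
  refine ⟨{ toFun := fun g => ∫ x, (2 * inner ℝ (rotField u g.1 x) (z x) - g.1 x * ‖z x‖ ^ 2) ∂σ
            map_add' := ?_, map_smul' := ?_ }, ?_, ?_⟩
  · intro g h
    rw [← integral_add (integrable_of_continuous σ (hc g)) (integrable_of_continuous σ (hc h))]
    congr 1
    ext x
    rw [rotField_add, inner_add_left, Submodule.coe_add, ContinuousMap.add_apply]
    ring
  · intro c g
    rw [RingHom.id_apply, smul_eq_mul, ← integral_const_mul]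
    congr 1
    ext x
    rw [rotField_smul, real_inner_smul_left, Submodule.coe_smul, ContinuousMap.smul_apply,
      smul_eq_mul]
    ring
  · simp only [LinearMap.coe_mk, AddHom.coe_mk, fisher]
    congr 1
    ext x
    have h0 := (hf x).ne'
    simp only [hz]
    rw [real_inner_smul_right, real_inner_self_eq_norm_sq, norm_smul, mul_pow, norm_inv,
      Real.norm_of_nonneg (hf x).le]
    field_simp
    ring
  · intro g hg
    simp only [LinearMap.coe_mk, AddHom.coe_mk, fisher]
    refine integral_mono (integrable_of_continuous σ (hc g))
      (integrable_of_continuous σ (continuous_fisherDensity u g hg)) fun x => ?_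
    have h0 := hg x
    have h := sq_nonneg ‖rotField u g.1 x - g.1 x • z x‖
    rw [norm_sub_sq_real, real_inner_smul_right, norm_smul, Real.norm_of_nonneg h0.le] at h
    show _ ≤ ‖rotField u g.1 x‖ ^ 2 / g.1 x
    rw [le_div_iff₀ h0]
    nlinarith

end Fisher

/-! ### Heat flow, entropy dissipation and the comparison principle for entropies. -/

/-! ### Semigroups on finite dimensional spaces -/

section Semigroup

variable {W : Type*} [NormedAddCommGroup W] [NormedSpace ℝ W] [FiniteDimensional ℝ W]

/-- The exponential `e^{sL}` of a linear map on a finite dimensional space. -/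
def expFlow (L : W →ₗ[ℝ] W) (s : ℝ) : W →ₗ[ℝ] W :=
  ((NormedSpace.exp (s • L.toContinuousLinearMap) : W →L[ℝ] W) : W →ₗ[ℝ] W)

theorem expFlow_zero (L : W →ₗ[ℝ] W) (f : W) : expFlow L 0 f = f := by
  simp [expFlow, NormedSpace.exp_zero]

theorem hasDerivAt_expFlow (L : W →ₗ[ℝ] W) (f : W) (s : ℝ) :
    HasDerivAt (fun s => expFlow L s f) (L (expFlow L s f)) s := by
  have : CompleteSpace W := FiniteDimensional.complete ℝ W
  have h := hasDerivAt_exp_smul_const' (𝕂 := ℝ) L.toContinuousLinearMap s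
  exact (ContinuousLinearMap.apply ℝ W f).hasFDerivAt.comp_hasDerivAt s h

theorem continuous_expFlow (L : W →ₗ[ℝ] W) (f : W) : Continuous fun s => expFlow L s f :=
  continuous_iff_continuousAt.2 fun s => (hasDerivAt_expFlow L f s).continuousAt

theorem continuous_map_expFlow {W' : Type*} [NormedAddCommGroup W'] [NormedSpace ℝ W']
    (L : W →ₗ[ℝ] W) (l : W →ₗ[ℝ] W') (f : W) : Continuous fun s => l (expFlow L s f) :=
  l.toContinuousLinearMap.continuous.comp (continuous_expFlow L f)

theorem hasDerivAt_functional_expFlow (L : W →ₗ[ℝ] W) (l : W →ₗ[ℝ] ℝ) (f : W) (s : ℝ) :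
    HasDerivAt (fun s => l (expFlow L s f)) (l (L (expFlow L s f))) s :=
  l.toContinuousLinearMap.hasFDerivAt.comp_hasDerivAt s (hasDerivAt_expFlow L f s)

theorem expFlow_comm {L A : W →ₗ[ℝ] W} (hA : ∀ f, A (L f) = L (A f)) (s : ℝ) (f : W) :
    A (expFlow L s f) = expFlow L s (A f) := by
  have : CompleteSpace W := FiniteDimensional.complete ℝ W
  have h : Commute A.toContinuousLinearMap (s • L.toContinuousLinearMap) :=
    Commute.smul_right (ContinuousLinearMap.ext fun f => hA f) s
  exact congrArg (fun B : W →L[ℝ] W => B f) h.exp_right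

end Semigroup

/-! ### The heat semigroup on polynomials -/

section Heat

variable {ι : Type*} [Fintype ι] {r : ℝ} [hr : Fact (0 < r)] [DecidableEq ι]

/-- The heat semigroup on the polynomials of degree at most `d`. -/
def heat (d : ℕ) (s : ℝ) : polySpace ι r d →ₗ[ℝ] polySpace ι r d :=
  expFlow (W := polySpace ι r d) (lap ι r d) s

theorem heat_zero {d : ℕ} (f : polySpace ι r d) : heat d 0 f = f := expFlow_zero _ f

theorem heat_comm {d : ℕ} {A : polySpace ι r d →ₗ[ℝ] polySpace ι r d}
    (hA : ∀ f, A (lap ι r d f) = lap ι r d (A f)) (s : ℝ) (f : polySpace ι r d) :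
    A (heat d s f) = heat d s (A f) := expFlow_comm hA s f

/-- Evaluation at a point. -/
def evalL (d : ℕ) (x : Sph ι r) : polySpace ι r d →ₗ[ℝ] ℝ where
  toFun f := f.1 x
  map_add' _ _ := rfl
  map_smul' _ _ := rfl

theorem hasDerivAt_heat_apply {d : ℕ} (f : polySpace ι r d) (s : ℝ) (x : Sph ι r) :
    HasDerivAt (fun s => (heat d s f).1 x) ((lap ι r d (heat d s f)).1 x) s :=
  hasDerivAt_functional_expFlow (lap ι r d) (evalL d x) f s

theorem continuous_heat {d : ℕ} (f : polySpace ι r d) : Continuous fun s => (heat d s f).1 :=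
  continuous_map_expFlow (lap ι r d) (polySpace ι r d).subtype f

theorem continuous_lap_heat {d : ℕ} (f : polySpace ι r d) :
    Continuous fun s => (lap ι r d (heat d s f)).1 := by
  simp only [heat_comm (A := lap ι r d) fun _ => rfl]
  exact continuous_heat _

theorem continuous_heat_apply {d : ℕ} (f : polySpace ι r d) :
    Continuous fun p : ℝ × Sph ι r => (heat d p.1 f).1 p.2 := by
  have h : Continuous fun p : ℝ × Sph ι r => (heat d p.1 f).1 :=
    (continuous_heat f).comp continuous_fst
  exact h.eval continuous_snd

theorem continuous_lap_heat_apply {d : ℕ} (f : polySpace ι r d) :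
    Continuous fun p : ℝ × Sph ι r => (lap ι r d (heat d p.1 f)).1 p.2 := by
  have h : Continuous fun p : ℝ × Sph ι r => (lap ι r d (heat d p.1 f)).1 :=
    (continuous_lap_heat f).comp continuous_fst
  exact h.eval continuous_snd

/-- With a negative second derivative the minimum would also be a local maximum, so `φ` would be
locally constant and its second derivative zero. -/
theorem deriv_deriv_nonneg_of_isMin {φ : ℝ → ℝ} (hmin : ∀ θ, φ 0 ≤ φ θ) (hc : Continuous φ) :
    0 ≤ deriv (deriv φ) 0 := by
  by_contra! hneg
  have hloc : IsLocalMin φ 0 := Filter.Eventually.of_forall hmin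
  have hmax := isLocalMax_of_deriv_deriv_neg hneg hloc.deriv_eq_zero hc.continuousAt
  have hconst : φ =ᶠ[𝓝 0] fun _ => φ 0 := by
    filter_upwards [hmax] with θ hθ using le_antisymm hθ (hmin θ)
  have h1 : deriv φ =ᶠ[𝓝 0] fun _ => 0 := by
    simpa using hconst.deriv
  rw [h1.deriv_eq] at hneg
  simp at hneg

/-- The Laplacian is half the sum of second derivatives along rotation orbits, and each orbit has
its minimum at `x`. -/
theorem lap_nonneg_of_isMin {d : ℕ} (f : polySpace ι r d) {x : Sph ι r}
    (hx : ∀ y, f.1 x ≤ f.1 y) : 0 ≤ (lap ι r d f).1 x := by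
  rw [lap_apply]
  refine mul_nonneg (by norm_num) (Finset.sum_nonneg fun a _ => Finset.sum_nonneg fun b _ => ?_)
  by_cases hab : a = b
  · subst hab
    rw [angD_self]
  have h1 := (sphDiff_poly f).hasDerivAt_rotation hab x
  have h2 := (sphDiff_poly (angDL d a b f)).hasDerivAt_rotation hab x 0
  rw [onSphere_collision_zero] at h2
  have h3 : deriv (fun θ => f.1 (onSphere (collision hab θ) x))
      = fun θ => (angDL d a b f).1 (onSphere (collision hab θ) x) :=
    funext fun θ => by rw [(h1 θ).deriv, angDL_apply]
  have h4 := deriv_deriv_nonneg_of_isMin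
    (φ := fun θ => f.1 (onSphere (collision hab θ) x))
    (fun θ => by simpa only [onSphere_collision_zero] using hx _)
    (continuous_iff_continuousAt.2 fun θ => (h1 θ).continuousAt)
  rwa [h3, h2.deriv] at h4

/-- The minimum principle for the heat semigroup. -/
theorem le_heat {d : ℕ} {f : polySpace ι r d} {m : ℝ} (hf : ∀ x, m ≤ f.1 x) {s : ℝ} (hs : 0 ≤ s)
    (x : Sph ι r) : m ≤ (heat d s f).1 x := by
  -- The term `ε τ` makes the argument strict: at a space-time minimum with `τ > 0` the time
  -- derivative is at least `ε`, although moving back in time cannot decrease the function.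
  have key : ∀ ε > 0, m ≤ (heat d s f).1 x + ε * s := by
    intro ε hε
    have hc : Continuous fun p : ℝ × Sph ι r => (heat d p.1 f).1 p.2 + ε * p.1 :=
      (continuous_heat_apply f).add (continuous_const.mul continuous_fst)
    obtain ⟨⟨τ, y⟩, hmem, hmin⟩ := (isCompact_Icc.prod (isCompact_univ (X := Sph ι r))).exists_isMinOn
      ⟨(s, x), Set.right_mem_Icc.2 hs, trivial⟩ (hc.continuousOn (s := Set.Icc 0 s ×ˢ Set.univ))
    rw [isMinOn_iff] at hmin
    refine le_trans ?_ (hmin (s, x) ⟨Set.right_mem_Icc.2 hs, trivial⟩)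
    simp only
    have hτ : τ ∈ Set.Icc 0 s := hmem.1
    rcases hτ.1.eq_or_lt with h0 | h0
    · rw [← h0, heat_zero, mul_zero, add_zero]
      exact hf y
    · exfalso
      have hlap := lap_nonneg_of_isMin (heat d τ f) (x := y) fun z => by
        have := hmin (τ, z) ⟨hτ, trivial⟩
        simpa using this
      have hd : HasDerivAt (fun τ => (heat d τ f).1 y + ε * τ)
          ((lap ι r d (heat d τ f)).1 y + ε * 1) τ :=
        (hasDerivAt_heat_apply f τ y).add ((hasDerivAt_id τ).const_mul ε)
      have hloc : IsLocalMinOn (fun τ => (heat d τ f).1 y + ε * τ) (Set.Icc 0 s) τ := by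
        filter_upwards [self_mem_nhdsWithin] with τ' hτ' using hmin (τ', y) ⟨hτ', trivial⟩
      have hcone := hloc.hasFDerivWithinAt_nonneg hd.hasFDerivAt.hasFDerivWithinAt
        (sub_mem_posTangentConeAt_of_segment_subset (y := 0)
          ((convex_Icc 0 s).segment_subset hτ (Set.left_mem_Icc.2 hs)))
      simp at hcone
      nlinarith
  refine le_of_forall_pos_le_add fun δ hδ => ?_
  have h := key (δ / (s + 1)) (by positivity)
  refine h.trans ?_
  gcongr
  rw [div_mul_eq_mul_div, div_le_iff₀ (by positivity)]
  nlinarith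

theorem exists_pos_le {f : C(Sph ι r, ℝ)} (hf : ∀ x, 0 < f x) : ∃ m > 0, ∀ x, m ≤ f x := by
  rcases isEmpty_or_nonempty (Sph ι r) with h | h
  · exact ⟨1, one_pos, fun x => (h.false x).elim⟩
  obtain ⟨x, -, hx⟩ := isCompact_univ.exists_isMinOn Set.univ_nonempty f.continuous.continuousOn
  exact ⟨f x, hf x, fun y => hx (Set.mem_univ y)⟩

theorem heat_pos {d : ℕ} {f : polySpace ι r d} (hf : ∀ x, 0 < f.1 x) {s : ℝ} (hs : 0 ≤ s)
    (x : Sph ι r) : 0 < (heat d s f).1 x := by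
  obtain ⟨m, hm, hmf⟩ := exists_pos_le hf
  exact hm.trans_le (le_heat hmf hs x)

variable (σ : Measure (Sph ι r)) [IsProbabilityMeasure σ]

/-- Differentiation of `∫ φ(u)` along the heat flow. -/
theorem hasDerivAt_integral_heat {d : ℕ} (f : polySpace ι r d) {φ φ' : ℝ → ℝ} {O : Set ℝ}
    (hO : IsOpen O) (hφ : ∀ y ∈ O, HasDerivAt φ (φ' y) y) (hφ' : ContinuousOn φ' O) {s : ℝ}
    (hs : ∀ x, (heat d s f).1 x ∈ O) :
    HasDerivAt (fun s => ∫ x, φ ((heat d s f).1 x) ∂σ)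
      (∫ x, φ' ((heat d s f).1 x) * (lap ι r d (heat d s f)).1 x ∂σ) s := by
  -- Compactness of the sphere makes "all values lie in `O`" an open condition in the uniform
  -- topology, so it persists for times near `s`.
  have hopen : ∀ᶠ τ in 𝓝 s, ∀ x, (heat d τ f).1 x ∈ O := by
    have h := (ContinuousMap.isOpen_setOfPred_mapsTo (isCompact_univ (X := Sph ι r)) hO).preimage
      (continuous_heat f)
    filter_upwards [h.mem_nhds (show _ from fun x _ => hs x)] with τ hτ x using hτ trivial
  obtain ⟨δ, hδ, hball⟩ := Metric.nhds_basis_closedBall.mem_iff.1 hopen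
  have hcO : ∀ τ ∈ Metric.closedBall s δ, ∀ x, (heat d τ f).1 x ∈ O := fun τ hτ => hball hτ
  have hφc : ContinuousOn φ O := fun y hy => (hφ y hy).continuousAt.continuousWithinAt
  have hcont : ContinuousOn (fun p : ℝ × Sph ι r =>
      φ' ((heat d p.1 f).1 p.2) * (lap ι r d (heat d p.1 f)).1 p.2)
      (Metric.closedBall s δ ×ˢ Set.univ) :=
    (hφ'.comp (continuous_heat_apply f).continuousOn fun p hp => hcO p.1 hp.1 p.2).mul
      (continuous_lap_heat_apply f).continuousOn
  obtain ⟨C, hC⟩ := ((isCompact_closedBall s δ).prod isCompact_univ).exists_bound_of_continuousOn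
    hcont
  have hφ1 : ∀ τ ∈ Metric.closedBall s δ, Continuous fun x => φ ((heat d τ f).1 x) := fun τ hτ =>
    hφc.comp_continuous (heat d τ f).1.continuous (hcO τ hτ)
  have hss : s ∈ Metric.closedBall s δ := Metric.mem_closedBall_self hδ.le
  refine (hasDerivAt_integral_of_dominated_loc_of_deriv_le (μ := σ) (x₀ := s)
    (F := fun τ x => φ ((heat d τ f).1 x))
    (F' := fun τ x => φ' ((heat d τ f).1 x) * (lap ι r d (heat d τ f)).1 x)
    (bound := fun _ => C) (s := Metric.closedBall s δ) (Metric.closedBall_mem_nhds s hδ)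
    ?_ (integrable_of_continuous σ (hφ1 s hss)) ?_ ?_ (integrable_const C) ?_).2
  · filter_upwards [Metric.closedBall_mem_nhds s hδ] with τ hτ using (hφ1 τ hτ).aestronglyMeasurable
  · exact ((hφ'.comp_continuous (heat d s f).1.continuous hs).mul
      (lap ι r d (heat d s f)).1.continuous).aestronglyMeasurable
  · exact Filter.Eventually.of_forall fun x τ hτ => hC (τ, x) ⟨hτ, trivial⟩
  · exact Filter.Eventually.of_forall fun x τ hτ =>
      (hφ _ (hcO τ hτ x)).comp τ (hasDerivAt_heat_apply f τ x)

variable [RotInvariant σ]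

theorem integral_heat {d : ℕ} (f : polySpace ι r d) (s : ℝ) :
    ∫ x, (heat d s f).1 x ∂σ = ∫ x, f.1 x ∂σ := by
  have h : ∀ s, HasDerivAt (fun s => ∫ x, (heat d s f).1 x ∂σ) 0 s := by
    intro s
    have h1 := hasDerivAt_integral_heat σ f (φ := fun y => y) (φ' := fun _ => 1) isOpen_univ
      (fun y _ => hasDerivAt_id y) continuousOn_const (s := s) (fun _ => trivial)
    simpa only [one_mul, integral_lap] using h1
  have h2 := is_const_of_deriv_eq_zero (fun s => (h s).differentiableAt) (fun s => (h s).deriv) s 0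
  simpa only [heat_zero] using h2

/-- The total Fisher information. -/
def totalFisher (f : Sph ι r → ℝ) : ℝ :=
  1 / 2 * ∑ a, fisher σ (EuclideanSpace.single a 1) f

/-- Green's formula against `log f`, with `L_ab log f = L_ab f / f`. As `klFun' = log`, this is the
entropy production of the heat flow. -/
theorem integral_log_mul_lap {d : ℕ} {f : polySpace ι r d} (hf : ∀ x, 0 < f.1 x) :
    ∫ x, Real.log (f.1 x) * (lap ι r d f).1 x ∂σ = - totalFisher σ f.1 := by
  have hl := (sphDiff_poly f).angD_log hf
  have hcl : ∀ a b, Continuous (angD a b fun x => Real.log (f.1 x)) := by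
    intro a b
    rw [show (angD a b fun x => Real.log (f.1 x)) = fun x => angD a b f.1 x / f.1 x from
      funext (hl a b)]
    exact (continuous_angD_poly f a b).div f.1.continuous fun x => (hf x).ne'
  rw [integral_mul_lap σ ((sphDiff_poly f).log hf) (f.1.continuous.log fun x => (hf x).ne') hcl,
    totalFisher]
  congr 1
  simp only [fisher]
  rw [← integral_finsetSum _ fun a _ =>
    integrable_of_continuous σ (continuous_fisherDensity _ f hf), ← integral_const_mul]
  congr 1
  ext x
  congr 1
  refine Finset.sum_congr rfl fun a _ => ?_
  rw [norm_rotField_single, Finset.sum_div]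
  refine Finset.sum_congr rfl fun b _ => ?_
  rw [hl]
  ring

theorem hasDerivAt_entropy_heat {d : ℕ} {f : polySpace ι r d} (hf : ∀ x, 0 < f.1 x) {s : ℝ}
    (hs : 0 ≤ s) : HasDerivAt (fun s => ∫ x, klFun ((heat d s f).1 x) ∂σ)
      (- totalFisher σ (heat d s f).1) s := by
  rw [← integral_log_mul_lap σ (heat_pos hf hs)]
  exact hasDerivAt_integral_heat σ f isOpen_Ioi
    (fun y hy => InformationTheory.hasDerivAt_klFun (ne_of_gt hy))
    (Real.continuousOn_log.mono fun y hy => ne_of_gt hy) (fun x => heat_pos hf hs x)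

end Heat

/-! ### Spectral gap -/

/-- Compactness of the unit sphere of the kernel of `l` turns pointwise positivity into a uniform
bound. The resulting spectral gap may depend on the degree, which suffices since only convergence of
the heat flow is needed. -/
theorem exists_coercive {W : Type*} [NormedAddCommGroup W] [NormedSpace ℝ W]
    [FiniteDimensional ℝ W] (B : W →ₗ[ℝ] W →ₗ[ℝ] ℝ) (l : W →ₗ[ℝ] ℝ)
    (hB : ∀ v, l v = 0 → v ≠ 0 → 0 < B v v) : ∃ c > 0, ∀ v, l v = 0 → c * ‖v‖ ^ 2 ≤ B v v := by
  have : ProperSpace W := FiniteDimensional.proper ℝ W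
  have hBc : Continuous fun v => B v v := by
    have h := ((LinearMap.toContinuousLinearMap : (W →ₗ[ℝ] ℝ) ≃ₗ[ℝ] (W →L[ℝ] ℝ)).toLinearMap
      ∘ₗ B).toContinuousLinearMap.continuous.clm_apply continuous_id
    exact h
  have hlc : Continuous l := l.toContinuousLinearMap.continuous
  have hK : IsCompact (Metric.sphere (0 : W) 1 ∩ {v | l v = 0}) :=
    (isCompact_sphere 0 1).inter_right (isClosed_eq hlc continuous_const)
  have hscale : ∀ v : W, v ≠ 0 → l v = 0 →
      ‖v‖⁻¹ • v ∈ Metric.sphere (0 : W) 1 ∩ {v | l v = 0} := by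
    intro v hv hl
    refine ⟨?_, ?_⟩
    · rw [mem_sphere_zero_iff_norm, norm_smul, norm_inv, norm_norm,
        inv_mul_cancel₀ (norm_ne_zero_iff.2 hv)]
    · simp [hl]
  rcases (Metric.sphere (0 : W) 1 ∩ {v | l v = 0}).eq_empty_or_nonempty with he | hne
  · refine ⟨1, one_pos, fun v hl => ?_⟩
    by_cases hv : v = 0
    · simp [hv]
    · have := hscale v hv hl
      rw [he] at this
      exact this.elim
  · obtain ⟨w, hw, hmin⟩ := hK.exists_isMinOn hne hBc.continuousOn
    have hw0 : w ≠ 0 := by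
      rintro rfl
      simpa using hw.1
    refine ⟨B w w, hB w hw.2 hw0, fun v hl => ?_⟩
    by_cases hv : v = 0
    · simp [hv]
    · have h1 : B w w ≤ B (‖v‖⁻¹ • v) (‖v‖⁻¹ • v) := hmin (hscale v hv hl)
      have h2 : 0 < ‖v‖ := norm_pos_iff.2 hv
      simp only [map_smul, LinearMap.smul_apply, smul_eq_mul] at h1
      calc B w w * ‖v‖ ^ 2 ≤ ‖v‖⁻¹ * (‖v‖⁻¹ * B v v) * ‖v‖ ^ 2 := by gcongr
        _ = B v v := by field_simp

section Gap

variable {ι : Type*} [Fintype ι] {r : ℝ} [hr : Fact (0 < r)]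

/-- The extension is constant on rays, so its derivative at any nonzero point is a rescaling of that
on the sphere. -/
theorem SphDiff.hasFDerivAt_zero_of_grad {f : Sph ι r → ℝ} (hf : SphDiff f)
    (h0 : ∀ x, grad f x = 0) {y : EuclideanSpace ℝ ι} (hy : y ≠ 0) :
    HasFDerivAt (homExt f) (0 : EuclideanSpace ℝ ι →L[ℝ] ℝ) y := by
  obtain ⟨c, hc, hmem⟩ : ∃ c : ℝ, 0 < c ∧ c • y ∈ Metric.sphere (0 : EuclideanSpace ℝ ι) r :=
    ⟨r / ‖y‖, div_pos hr.out (norm_pos_iff.2 hy), scale_mem hy⟩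
  have h1 := hf.hasFDerivAt ⟨c • y, hmem⟩
  rw [h0, map_zero] at h1
  have h2 := h1.comp y ((hasFDerivAt_id y).const_smul c)
  rw [ContinuousLinearMap.zero_comp] at h2
  refine h2.congr_of_eventuallyEq ?_
  filter_upwards [isOpen_ne.mem_nhds hy] with z hz
  show homExt f z = homExt f (c • z)
  rw [homExt_of_ne f hz, homExt_of_ne f (smul_ne_zero hc.ne' hz)]
  congr 1
  ext1
  simp only [norm_smul, smul_smul, Real.norm_of_nonneg hc.le]
  congr 1
  field_simp

/-- On a sphere of positive dimension, a function with vanishing gradient is constant. -/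
theorem SphDiff.eq_of_grad_eq_zero [Nontrivial ι] {f : Sph ι r → ℝ} (hf : SphDiff f)
    (h0 : ∀ x, grad f x = 0) (x y : Sph ι r) : f x = f y := by
  -- With at least two coordinates the punctured space is connected, and a function with zero
  -- derivative on it is constant.
  have hrank : 1 < Module.rank ℝ (EuclideanSpace ℝ ι) := by
    rw [← Module.finrank_eq_rank, finrank_euclideanSpace]
    exact_mod_cast Fintype.one_lt_card
  have hconn := (isConnected_compl_singleton_of_one_lt_rank hrank
    (0 : EuclideanSpace ℝ ι)).isPreconnected
  have hd : ∀ y ∈ ({0}ᶜ : Set (EuclideanSpace ℝ ι)),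
      HasFDerivAt (homExt f) (0 : EuclideanSpace ℝ ι →L[ℝ] ℝ) y := fun y hy =>
    hf.hasFDerivAt_zero_of_grad h0 hy
  have h := isOpen_compl_singleton.is_const_of_fderiv_eq_zero (𝕜 := ℝ) hconn
    (fun y hy => (hd y hy).differentiableAt.differentiableWithinAt)
    (fun y hy => (hd y hy).fderiv) (coe_ne_zero x) (coe_ne_zero y)
  rwa [homExt_coe, homExt_coe] at h

variable [DecidableEq ι] (σ : Measure (Sph ι r)) [IsProbabilityMeasure σ]

/-- The Dirichlet form of the sphere. -/
def dirichlet (d : ℕ) : polySpace ι r d →ₗ[ℝ] polySpace ι r d →ₗ[ℝ] ℝ :=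
  have hi : ∀ (f g : polySpace ι r d), Integrable (fun x =>
      1 / 2 * ∑ a, ∑ b, angD a b g.1 x * angD a b f.1 x) σ := fun f g =>
    integrable_of_continuous σ (continuous_const.mul (continuous_finsetSum _ fun a _ =>
      continuous_finsetSum _ fun b _ => (continuous_angD_poly g a b).mul
        (continuous_angD_poly f a b)))
  have hadd : ∀ (f g : polySpace ι r d) (a b : ι) (x : Sph ι r),
      angD a b (f + g).1 x = angD a b f.1 x + angD a b g.1 x := fun f g a b x =>
    (sphDiff_poly f).angD_add (sphDiff_poly g) a b x
  have hsmul : ∀ (c : ℝ) (f : polySpace ι r d) (a b : ι) (x : Sph ι r),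
      angD a b (c • f).1 x = c * angD a b f.1 x := fun c f a b x =>
    (sphDiff_poly f).angD_const_mul c a b x
  LinearMap.mk₂ ℝ (fun f g => ∫ x, 1 / 2 * ∑ a, ∑ b, angD a b g.1 x * angD a b f.1 x ∂σ)
    (fun _ _ _ => by
      rw [← integral_add (hi _ _) (hi _ _)]
      congr 1
      ext x
      simp only [hadd, mul_add, Finset.sum_add_distrib])
    (fun c f g => by
      rw [smul_eq_mul, ← integral_const_mul]
      congr 1
      ext x
      simp only [hsmul, Finset.mul_sum]
      exact Finset.sum_congr rfl fun a _ => Finset.sum_congr rfl fun b _ => by ring)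
    (fun _ _ _ => by
      rw [← integral_add (hi _ _) (hi _ _)]
      congr 1
      ext x
      simp only [hadd, add_mul, mul_add, Finset.sum_add_distrib])
    (fun c f g => by
      rw [smul_eq_mul, ← integral_const_mul]
      congr 1
      ext x
      simp only [hsmul, Finset.mul_sum]
      exact Finset.sum_congr rfl fun a _ => Finset.sum_congr rfl fun b _ => by ring)

theorem dirichlet_apply {d : ℕ} (f g : polySpace ι r d) :
    dirichlet σ d f g = ∫ x, 1 / 2 * ∑ a, ∑ b, angD a b g.1 x * angD a b f.1 x ∂σ := rfl

/-- Integration of polynomials. -/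
def integralL (d : ℕ) : polySpace ι r d →ₗ[ℝ] ℝ where
  toFun f := ∫ x, f.1 x ∂σ
  map_add' f g := integral_add (integrable_of_continuous σ f.1.continuous)
    (integrable_of_continuous σ g.1.continuous)
  map_smul' c _ := integral_const_mul c _

/-- A Poincaré inequality for polynomials of bounded degree. -/
theorem exists_poincare [Nontrivial ι] [σ.IsOpenPosMeasure] (d : ℕ) :
    ∃ c > 0, ∀ v : polySpace ι r d, ∫ x, v.1 x ∂σ = 0 →
      c * ∫ x, v.1 x ^ 2 ∂σ ≤ dirichlet σ d v v := by
  obtain ⟨c, hc, h⟩ := exists_coercive (W := polySpace ι r d) (dirichlet σ d) (integralL σ d)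
    (by
      intro v hv hv0
      have hcont : Continuous fun x => 1 / 2 * ∑ a, ∑ b, angD a b v.1 x * angD a b v.1 x :=
        continuous_const.mul (continuous_finsetSum _ fun a _ => continuous_finsetSum _ fun b _ =>
          (continuous_angD_poly v a b).mul (continuous_angD_poly v a b))
      have hnn : ∀ x, 0 ≤ 1 / 2 * ∑ a, ∑ b, angD a b v.1 x * angD a b v.1 x := fun x =>
        mul_nonneg (by norm_num) (Finset.sum_nonneg fun a _ => Finset.sum_nonneg fun b _ =>
          mul_self_nonneg _)
      rw [dirichlet_apply]
      refine lt_of_le_of_ne (integral_nonneg hnn) fun h0 => hv0 ?_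
      have h1 := (integral_eq_zero_iff_of_nonneg hnn (integrable_of_continuous σ hcont)).1 h0.symm
      have h2 := (hcont.ae_eq_iff_eq σ continuous_const).1 h1
      have hgrad : ∀ x, grad v.1 x = 0 := by
        intro x
        have h3 := congrFun h2 x
        rw [sum_angD_mul (sphDiff_poly v), real_inner_self_eq_norm_sq] at h3
        have h5 : r ^ 2 * ‖grad v.1 x‖ ^ 2 = 0 := h3
        simpa [hr.out.ne'] using h5
      have hconst := (sphDiff_poly v).eq_of_grad_eq_zero hgrad
      ext x
      have h4 : ∫ y, v.1 y ∂σ = v.1 x := by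
        rw [integral_congr_ae (Filter.Eventually.of_forall fun y => hconst y x)]
        simp
      exact h4.symm.trans hv)
  refine ⟨c, hc, fun v hv => le_trans ?_ (h v hv)⟩
  gcongr
  calc ∫ x, v.1 x ^ 2 ∂σ ≤ ∫ _, ‖v‖ ^ 2 ∂σ := by
        refine integral_mono (integrable_of_continuous σ (v.1.continuous.pow 2))
          (integrable_const _) fun x => ?_
        have h1 : |v.1 x| ≤ ‖v‖ := v.1.norm_coe_le_norm x
        exact sq_le_sq' (abs_le.1 h1).1 (abs_le.1 h1).2
    _ = ‖v‖ ^ 2 := by simp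

variable [RotInvariant σ]

/-- Exponential decay of the variance along the heat flow. -/
theorem exists_integral_sq_heat_le [Nontrivial ι] [σ.IsOpenPosMeasure] {d : ℕ}
    {v : polySpace ι r d} (hv : ∫ x, v.1 x ∂σ = 0) {ε : ℝ} (hε : 0 < ε) :
    ∃ s, 0 ≤ s ∧ ∫ x, (heat d s v).1 x ^ 2 ∂σ ≤ ε := by
  obtain ⟨c, hc, hP⟩ := exists_poincare σ (ι := ι) (r := r) d
  obtain ⟨y, hy⟩ : ∃ y : ℝ → ℝ, y = fun s => ∫ x, (heat d s v).1 x ^ 2 ∂σ := ⟨_, rfl⟩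
  have hd : ∀ s, HasDerivAt y (-2 * dirichlet σ d (heat d s v) (heat d s v)) s := by
    intro s
    have h := hasDerivAt_integral_heat σ v (φ := fun y => y ^ 2) (φ' := fun y => 2 * y)
      isOpen_univ (fun y _ => by simpa using hasDerivAt_pow 2 y)
      (by fun_prop) (s := s) (fun _ => trivial)
    rw [hy]
    refine h.congr_deriv ?_
    simp only [mul_assoc]
    rw [integral_const_mul, integral_mul_lap σ (sphDiff_poly _) (heat d s v).1.continuous
      (continuous_angD_poly _), dirichlet_apply]
    ring
  have hle : ∀ s, -2 * dirichlet σ d (heat d s v) (heat d s v) ≤ -2 * c * y s := by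
    intro s
    have h := hP (heat d s v) (by rw [integral_heat, hv])
    rw [hy]
    linarith
  have hz : ∀ s, HasDerivAt (fun s => y s * Real.exp (2 * c * s))
      (-2 * dirichlet σ d (heat d s v) (heat d s v) * Real.exp (2 * c * s)
        + y s * (Real.exp (2 * c * s) * (2 * c * 1))) s := fun s =>
    (hd s).mul ((hasDerivAt_id s).const_mul (2 * c)).exp
  -- Grönwall: `y' ≤ -2 c y` by the Poincaré inequality.
  have hanti : Antitone fun s => y s * Real.exp (2 * c * s) := by
    refine antitone_of_deriv_nonpos (fun s => (hz s).differentiableAt) fun s => ?_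
    rw [(hz s).deriv]
    have := hle s
    have he := Real.exp_pos (2 * c * s)
    nlinarith
  have hlim : Filter.Tendsto (fun s : ℝ => y 0 * Real.exp (-(2 * c * s))) Filter.atTop (𝓝 0) := by
    have h1 : Filter.Tendsto (fun s : ℝ => 2 * c * s) Filter.atTop Filter.atTop :=
      Filter.tendsto_id.const_mul_atTop (by positivity)
    simpa using (Real.tendsto_exp_neg_atTop_nhds_zero.comp h1).const_mul (y 0)
  obtain ⟨s, hs1, hs0⟩ := ((hlim.eventually (ge_mem_nhds hε)).and
    (Filter.eventually_ge_atTop 0)).exists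
  refine ⟨s, hs0, ?_⟩
  have h1 : y s * Real.exp (2 * c * s) ≤ y 0 * Real.exp (2 * c * 0) := hanti hs0
  have h2 : y s ≤ y 0 * Real.exp (-(2 * c * s)) := by
    rw [Real.exp_neg, ← div_eq_mul_inv, le_div_iff₀ (Real.exp_pos _)]
    simpa using h1
  have h3 : y s ≤ ε := h2.trans hs1
  rwa [hy] at h3

/-! ### Entropy along the heat flow -/

/-- Obtained from `log (u/m) ≤ u/m - 1`. After integration the linear term vanishes when `m` is the
mean, so decay of the variance implies decay of the entropy to `klFun m`. -/
theorem klFun_le_quadratic {m u : ℝ} (hm : 0 < m) (hu : 0 < u) :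
    klFun u ≤ klFun m + Real.log m * (u - m) + (u - m) ^ 2 / m := by
  have h := Real.log_le_sub_one_of_pos (div_pos hu hm)
  rw [Real.log_div hu.ne' hm.ne'] at h
  have h2 : u * (Real.log u - Real.log m) ≤ u * (u / m - 1) := mul_le_mul_of_nonneg_left h hu.le
  have h3 : u * (u / m - 1) = (u - m) + (u - m) ^ 2 / m := by field_simp; ring
  simp only [InformationTheory.klFun_apply]
  nlinarith

theorem continuous_klFun_comp (f : C(Sph ι r, ℝ)) : Continuous fun x => klFun (f x) :=
  InformationTheory.continuous_klFun.comp f.continuous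

theorem klFun_integral_le {f : C(Sph ι r, ℝ)} (hf : ∀ x, 0 < f x) :
    klFun (∫ x, f x ∂σ) ≤ ∫ x, klFun (f x) ∂σ :=
  InformationTheory.convexOn_klFun.map_integral_le
    InformationTheory.continuous_klFun.continuousOn isClosed_Ici
    (Filter.Eventually.of_forall fun x => (hf x).le) (integrable_of_continuous σ f.continuous)
    (integrable_of_continuous σ (continuous_klFun_comp f))

theorem integral_pos_of_pos {f : C(Sph ι r, ℝ)} (hf : ∀ x, 0 < f x) : 0 < ∫ x, f x ∂σ := by
  obtain ⟨m, hm, hmf⟩ := exists_pos_le hf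
  calc 0 < ∫ _, m ∂σ := by simpa using hm
    _ ≤ _ := integral_mono (integrable_const m) (integrable_of_continuous σ f.continuous) hmf

/-- The entropy converges to its minimum along the heat flow. -/
theorem exists_entropy_heat_le [Nontrivial ι] [σ.IsOpenPosMeasure] {d : ℕ} {f : polySpace ι r d}
    (hf : ∀ x, 0 < f.1 x) {ε : ℝ} (hε : 0 < ε) :
    ∃ s, 0 ≤ s ∧ ∫ x, klFun ((heat d s f).1 x) ∂σ ≤ klFun (∫ x, f.1 x ∂σ) + ε := by
  obtain ⟨m, hm⟩ : ∃ m, m = ∫ x, f.1 x ∂σ := ⟨_, rfl⟩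
  have hm0 : 0 < m := hm ▸ integral_pos_of_pos σ hf
  -- Despite its name this is the constant polynomial `m`. It is fixed by the heat flow, so `f -
  -- one` is the mean-zero part whose variance decays.
  obtain ⟨one, hone⟩ : ∃ o : polySpace ι r d, o.1 = algebraMap ℝ C(Sph ι r, ℝ) m :=
    ⟨⟨_, const_mem_polySpace d m⟩, rfl⟩
  have hone' : ∀ x, one.1 x = m := fun x => by rw [hone]; rfl
  have hheat1 : ∀ s x, (heat d s one).1 x = m := by
    intro s x
    have hlap : ∀ τ x, (lap ι r d (heat d τ one)).1 x = 0 := by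
      have h0 : lap ι r d one = 0 := by
        ext x
        rw [lap_apply]
        have h1 : ∀ a b, angDL d a b one = 0 := fun a b => by
          ext y
          rw [angDL_apply, show (one.1 : Sph ι r → ℝ) = fun _ => m from funext hone', angD_const]
          rfl
        simp only [h1]
        simp [show ((0 : C(Sph ι r, ℝ)) : Sph ι r → ℝ) = fun _ => (0 : ℝ) from rfl, angD_const]
      intro τ x
      rw [heat_comm (A := lap ι r d) fun _ => rfl, h0, map_zero]
      rfl
    have h2 := is_const_of_deriv_eq_zero (f := fun s => (heat d s one).1 x)
      (fun s => (hasDerivAt_heat_apply one s x).differentiableAt)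
      (fun s => by rw [(hasDerivAt_heat_apply one s x).deriv, hlap]) s 0
    simpa only [heat_zero, hone'] using h2
  have hv : ∫ x, (f - one).1 x ∂σ = 0 := by
    have h := (integralL σ d).map_sub f one
    change ∫ x, (f - one).1 x ∂σ = ∫ x, f.1 x ∂σ - ∫ x, one.1 x ∂σ at h
    rw [h, ← hm]
    simp [hone']
  obtain ⟨s, hs0, hs⟩ := exists_integral_sq_heat_le σ hv (ε := ε * m) (by positivity)
  refine ⟨s, hs0, ?_⟩
  have hsub : ∀ x, (heat d s (f - one)).1 x = (heat d s f).1 x - m := by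
    intro x
    rw [map_sub, Submodule.coe_sub, ContinuousMap.sub_apply, hheat1]
  simp only [hsub] at hs
  have hc := (heat d s f).1.continuous
  have hi1 : Integrable (fun x => (heat d s f).1 x - m) σ :=
    integrable_of_continuous σ (hc.sub continuous_const)
  have hi2 : Integrable (fun x => ((heat d s f).1 x - m) ^ 2 / m) σ :=
    integrable_of_continuous σ (((hc.sub continuous_const).pow 2).div_const m)
  have hi3 : Integrable (fun x => klFun m + Real.log m * ((heat d s f).1 x - m)) σ :=
    (integrable_const _).add (hi1.const_mul _)
  calc ∫ x, klFun ((heat d s f).1 x) ∂σ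
      ≤ ∫ x, (klFun m + Real.log m * ((heat d s f).1 x - m)
          + ((heat d s f).1 x - m) ^ 2 / m) ∂σ :=
        integral_mono (integrable_of_continuous σ (continuous_klFun_comp _)) (hi3.add hi2)
          fun x => klFun_le_quadratic hm0 (heat_pos hf hs0 x)
    _ = klFun m + (∫ x, ((heat d s f).1 x - m) ^ 2 ∂σ) / m := by
        rw [integral_add hi3 hi2, integral_add (integrable_const _) (hi1.const_mul _),
          integral_const_mul, integral_sub (integrable_of_continuous σ hc) (integrable_const _),
          integral_heat, ← hm, integral_div]
        simp
    _ ≤ klFun m + ε := by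
        gcongr
        rwa [div_le_iff₀ hm0]
    _ = _ := by rw [hm]

/-- A positive operator which commutes with the Laplacian and contracts the Fisher information
contracts the entropy by the same factor. -/
theorem entropy_le_of_fisher_le [Nontrivial ι] [σ.IsOpenPosMeasure] {d : ℕ} {c : ℝ} (hc : 0 ≤ c)
    {A : polySpace ι r d →ₗ[ℝ] polySpace ι r d}
    (hpos : ∀ f : polySpace ι r d, (∀ x, 0 < f.1 x) → ∀ x, 0 < (A f).1 x)
    (hcomm : ∀ f, A (lap ι r d f) = lap ι r d (A f))
    (hmass : ∀ f, ∫ x, (A f).1 x ∂σ = ∫ x, f.1 x ∂σ)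
    (hfisher : ∀ f : polySpace ι r d, (∀ x, 0 < f.1 x) →
      totalFisher σ (A f).1 ≤ c * totalFisher σ f.1)
    {f : polySpace ι r d} (hf : ∀ x, 0 < f.1 x) :
    ∫ x, klFun ((A f).1 x) ∂σ - klFun (∫ x, f.1 x ∂σ)
      ≤ c * (∫ x, klFun (f.1 x) ∂σ - klFun (∫ x, f.1 x ∂σ)) := by
  refine le_of_forall_pos_le_add fun ε hε => ?_
  obtain ⟨s, hs0, hs⟩ := exists_entropy_heat_le σ (hpos f hf) hε
  have hd : ∀ τ, 0 ≤ τ → HasDerivAt (fun τ => c * ∫ x, klFun ((heat d τ f).1 x) ∂σ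
      - ∫ x, klFun ((heat d τ (A f)).1 x) ∂σ)
      (c * (- totalFisher σ (heat d τ f).1) - - totalFisher σ (heat d τ (A f)).1) τ :=
    fun τ hτ => ((hasDerivAt_entropy_heat σ hf hτ).const_mul c).sub
      (hasDerivAt_entropy_heat σ (hpos f hf) hτ)
  -- The derivative is `I(A P_τ f) - c I(P_τ f) ≤ 0`. The values at `0` and at a late time `s` are
  -- then compared: there the entropy of `P_s A f` is within `ε` of `klFun` of the mass, and that of
  -- `P_s f` is at least `klFun` of the mass by Jensen.
  have hanti : AntitoneOn (fun τ => c * ∫ x, klFun ((heat d τ f).1 x) ∂σ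
      - ∫ x, klFun ((heat d τ (A f)).1 x) ∂σ) (Set.Ici 0) := by
    refine antitoneOn_of_deriv_nonpos (convex_Ici 0)
      (fun τ hτ => (hd τ hτ).continuousAt.continuousWithinAt) (fun τ hτ => ?_) fun τ hτ => ?_
    · rw [interior_Ici] at hτ
      exact (hd τ (le_of_lt hτ)).differentiableAt.differentiableWithinAt
    · rw [interior_Ici] at hτ
      have hτ' : 0 ≤ τ := le_of_lt hτ
      rw [(hd τ hτ').deriv, ← heat_comm hcomm]
      have := hfisher (heat d τ f) (heat_pos hf hτ')
      linarith
  have h1 := hanti (Set.mem_Ici.2 le_rfl) (Set.mem_Ici.2 hs0) hs0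
  simp only [heat_zero] at h1
  rw [hmass] at hs
  have h2 := klFun_integral_le σ (f := (heat d s f).1) (heat_pos hf hs0)
  rw [integral_heat] at h2
  have h3 := mul_le_mul_of_nonneg_left h2 hc
  linarith

end Gap

/-! ### How rotation averages, collisions and the marginal act on directional Fisher informations.
-/

/-! ### Averages of polynomials over families of rotations -/

theorem map_integral_of_finiteDimensional {W Ω : Type*} [NormedAddCommGroup W] [NormedSpace ℝ W]
    [FiniteDimensional ℝ W] [MeasurableSpace Ω] {P : Measure Ω} {φ : Ω → W} (hφ : Integrable φ P)
    {W' : Type*} [NormedAddCommGroup W'] [NormedSpace ℝ W'] [CompleteSpace W'] (l : W →ₗ[ℝ] W') :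
    l (∫ ω, φ ω ∂P) = ∫ ω, l (φ ω) ∂P := by
  have : CompleteSpace W := FiniteDimensional.complete ℝ W
  exact (l.toContinuousLinearMap.integral_comp_comm hφ).symm

theorem integrable_map_of_finiteDimensional {W Ω : Type*} [NormedAddCommGroup W] [NormedSpace ℝ W]
    [FiniteDimensional ℝ W] [MeasurableSpace Ω] {P : Measure Ω} {φ : Ω → W} (hφ : Integrable φ P)
    {W' : Type*} [NormedAddCommGroup W'] [NormedSpace ℝ W'] (l : W →ₗ[ℝ] W') :
    Integrable (fun ω => l (φ ω)) P :=
  l.toContinuousLinearMap.integrable_comp hφ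

theorem integral_smul_of_finiteDimensional {W Ω : Type*} [NormedAddCommGroup W] [NormedSpace ℝ W]
    [MeasurableSpace Ω] {P : Measure Ω} (φ : Ω → W) (c : ℝ) :
    ∫ ω, c • φ ω ∂P = c • ∫ ω, φ ω ∂P := integral_smul c φ

section Average

variable {ι : Type*} [Fintype ι] {r : ℝ} [hr : Fact (0 < r)] [DecidableEq ι]
  {Ω : Type*} [TopologicalSpace Ω] [SecondCountableTopology Ω] [MeasurableSpace Ω]
  [OpensMeasurableSpace Ω] (P : Measure Ω) [IsProbabilityMeasure P]
  (T : Ω → EuclideanSpace ℝ ι →ₗᵢ[ℝ] EuclideanSpace ℝ ι)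
  (hT : Continuous fun p : Ω × Sph ι r => onSphere (T p.1) p.2)

include hT

theorem continuous_compL {d : ℕ} (f : polySpace ι r d) : Continuous fun ω => compL d (T ω) f := by
  refine Continuous.subtype_mk ?_ _
  exact (ContinuousMap.curry ⟨fun p : Ω × Sph ι r => f.1 (onSphere (T p.1) p.2),
    f.1.continuous.comp hT⟩).continuous

theorem integrable_compL {d : ℕ} (f : polySpace ι r d) :
    Integrable (fun ω => compL d (T ω) f) P := by
  refine Integrable.of_bound (continuous_compL T hT f).aestronglyMeasurable ‖f‖
    (Filter.Eventually.of_forall fun ω => ?_)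
  show ‖(compL d (T ω) f).1‖ ≤ ‖f.1‖
  exact (ContinuousMap.norm_le _ (norm_nonneg _)).2 fun x => f.1.norm_coe_le_norm _

/-- The average of a polynomial over a family of rotations. -/
def avgL (d : ℕ) : polySpace ι r d →ₗ[ℝ] polySpace ι r d where
  toFun f := ∫ ω, compL d (T ω) f ∂P
  map_add' f g := by
    simp only [map_add]
    exact integral_add (integrable_compL P T hT f) (integrable_compL P T hT g)
  map_smul' c f := by
    simp only [map_smul]
    exact integral_smul_of_finiteDimensional (W := polySpace ι r d) _ c

theorem functional_avgL {d : ℕ} (l : polySpace ι r d →ₗ[ℝ] ℝ) (f : polySpace ι r d) :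
    l (avgL P T hT d f) = ∫ ω, l (compL d (T ω) f) ∂P :=
  map_integral_of_finiteDimensional (W := polySpace ι r d) (integrable_compL P T hT f) l

theorem integrable_functional_compL {d : ℕ} (l : polySpace ι r d →ₗ[ℝ] ℝ) (f : polySpace ι r d) :
    Integrable (fun ω => l (compL d (T ω) f)) P :=
  integrable_map_of_finiteDimensional (W := polySpace ι r d) (integrable_compL P T hT f) l

theorem avgL_apply {d : ℕ} (f : polySpace ι r d) (x : Sph ι r) :
    (avgL P T hT d f).1 x = ∫ ω, f.1 (onSphere (T ω) x) ∂P :=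
  functional_avgL P T hT (evalL d x) f

theorem avgL_pos {d : ℕ} {f : polySpace ι r d} (hf : ∀ x, 0 < f.1 x) (x : Sph ι r) :
    0 < (avgL P T hT d f).1 x := by
  obtain ⟨m, hm, hmf⟩ := exists_pos_le hf
  rw [avgL_apply]
  calc 0 < ∫ _, m ∂P := by simpa using hm
    _ ≤ _ := integral_mono (integrable_const m)
      (integrable_functional_compL P T hT (evalL d x) f) fun ω => hmf _

variable (σ : Measure (Sph ι r)) [IsProbabilityMeasure σ] [RotInvariant σ]

theorem integral_avgL {d : ℕ} (f : polySpace ι r d) :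
    ∫ x, (avgL P T hT d f).1 x ∂σ = ∫ x, f.1 x ∂σ := by
  have h := functional_avgL P T hT (integralL σ d) f
  have h2 : ∀ ω, integralL σ d (compL d (T ω) f) = integralL σ d f := fun ω =>
    integral_rotation σ f.1.continuous (T ω)
  refine h.trans ?_
  simp only [h2, integral_const, probReal_univ, one_smul]
  rfl

theorem lap_avgL [σ.IsOpenPosMeasure] {d : ℕ} (f : polySpace ι r d) :
    avgL P T hT d (lap ι r d f) = lap ι r d (avgL P T hT d f) := by
  ext x
  have h := functional_avgL P T hT (evalL d x ∘ₗ lap ι r d) f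
  rw [avgL_apply]
  refine Eq.trans ?_ h.symm
  simp only [LinearMap.comp_apply, lap_compL σ]
  rfl

/-- Jensen's inequality for the convex functional `fisher σ u`, by integrating the supporting
functional at the average over the family of rotations; `fisher_compL` then moves the rotations onto
`u`. -/
theorem fisher_avgL_le {d : ℕ} (u : EuclideanSpace ℝ ι) {f : polySpace ι r d}
    (hf : ∀ x, 0 < f.1 x) (hi : Integrable (fun ω => fisher σ (T ω u) f.1) P) :
    fisher σ u (avgL P T hT d f).1 ≤ ∫ ω, fisher σ (T ω u) f.1 ∂P := by
  obtain ⟨l, hl, hle⟩ := exists_fisher_support σ u (avgL_pos P T hT hf)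
  rw [← hl, functional_avgL]
  refine integral_mono (integrable_functional_compL P T hT l f) hi fun ω => ?_
  rw [← fisher_compL σ u hf (T ω)]
  exact hle _ fun x => hf _

end Average

/-! ### Markov operators on polynomials -/

section Markov

variable {ι : Type*} [Fintype ι] {r : ℝ} [hr : Fact (0 < r)] [DecidableEq ι]
  (σ : Measure (Sph ι r)) [IsProbabilityMeasure σ] [RotInvariant σ]

/-- Operators which preserve positivity and mass and commute with the Laplacian. -/
structure IsMarkov {d : ℕ} (A : polySpace ι r d →ₗ[ℝ] polySpace ι r d) : Prop where
  pos : ∀ f : polySpace ι r d, (∀ x, 0 < f.1 x) → ∀ x, 0 < (A f).1 x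
  comm : ∀ f, A (lap ι r d f) = lap ι r d (A f)
  mass : ∀ f, ∫ x, (A f).1 x ∂σ = ∫ x, f.1 x ∂σ

variable {σ}

theorem IsMarkov.id {d : ℕ} : IsMarkov σ (1 : polySpace ι r d →ₗ[ℝ] polySpace ι r d) :=
  ⟨fun _ hf => hf, fun _ => rfl, fun _ => rfl⟩

theorem IsMarkov.comp {d : ℕ} {A B : polySpace ι r d →ₗ[ℝ] polySpace ι r d}
    (hA : IsMarkov σ A) (hB : IsMarkov σ B) : IsMarkov σ (A * B) :=
  ⟨fun f hf => hA.pos _ (hB.pos f hf), fun f => by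
    rw [Module.End.mul_apply, hB.comm, hA.comm, Module.End.mul_apply],
    fun f => (hA.mass _).trans (hB.mass f)⟩

theorem IsMarkov.pow {d : ℕ} {A : polySpace ι r d →ₗ[ℝ] polySpace ι r d}
    (hA : IsMarkov σ A) (k : ℕ) : IsMarkov σ (A ^ k) := by
  induction k with
  | zero => exact IsMarkov.id
  | succ k ih => exact pow_succ A k ▸ ih.comp hA

theorem isMarkov_avgL [σ.IsOpenPosMeasure] {Ω : Type*} [TopologicalSpace Ω]
    [SecondCountableTopology Ω] [MeasurableSpace Ω] [OpensMeasurableSpace Ω] (P : Measure Ω)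
    [IsProbabilityMeasure P] (T : Ω → EuclideanSpace ℝ ι →ₗᵢ[ℝ] EuclideanSpace ℝ ι)
    (hT : Continuous fun p : Ω × Sph ι r => onSphere (T p.1) p.2) (d : ℕ) :
    IsMarkov σ (avgL P T hT d) :=
  ⟨fun _ hf => avgL_pos P T hT hf, fun f => lap_avgL P T hT σ f, fun f => integral_avgL P T hT σ f⟩

end Markov

/-! ### Collisions and the Fisher information -/

section Collision

variable {ι : Type*} [Fintype ι] {r : ℝ} [hr : Fact (0 < r)] [DecidableEq ι]

theorem continuous_collision {i j : ι} (hij : i ≠ j) :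
    Continuous fun p : ℝ × Sph ι r => onSphere (collision hij p.1) p.2 := by
  refine Continuous.subtype_mk ?_ _
  refine (PiLp.continuous_toLp 2 _).comp (continuous_pi fun k => ?_)
  by_cases h1 : k = i
  · simp only [h1, if_true]; fun_prop
  · by_cases h2 : k = j
    · subst h2
      simp only [h1, if_true, if_false]; fun_prop
    · simp only [h1, h2, if_false]; fun_prop

theorem collision_single_left {i j : ι} (hij : i ≠ j) (θ : ℝ) :
    collision hij θ (EuclideanSpace.single i 1)
      = Real.cos θ • EuclideanSpace.single i 1 + Real.sin θ • EuclideanSpace.single j (1 : ℝ) := by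
  ext k
  simp only [collision, LinearIsometry.coe_mk, LinearMap.coe_mk, AddHom.coe_mk, PiLp.add_apply,
    PiLp.smul_apply, PiLp.single_apply, smul_eq_mul]
  split_ifs <;> simp_all

theorem collision_single_right {i j : ι} (hij : i ≠ j) (θ : ℝ) :
    collision hij θ (EuclideanSpace.single j 1)
      = (-Real.sin θ) • EuclideanSpace.single i 1 + Real.cos θ • EuclideanSpace.single j (1 : ℝ) := by
  ext k
  simp only [collision, LinearIsometry.coe_mk, LinearMap.coe_mk, AddHom.coe_mk, PiLp.add_apply,
    PiLp.smul_apply, PiLp.single_apply, smul_eq_mul]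
  split_ifs <;> simp_all

theorem collision_single_of_ne {i j k : ι} (hij : i ≠ j) (hki : k ≠ i) (hkj : k ≠ j) (θ : ℝ) :
    collision hij θ (EuclideanSpace.single k 1) = EuclideanSpace.single k (1 : ℝ) := by
  ext l
  simp only [collision, LinearIsometry.coe_mk, LinearMap.coe_mk, AddHom.coe_mk,
    PiLp.single_apply]
  split_ifs <;> simp_all

variable (σ : Measure (Sph ι r)) [IsProbabilityMeasure σ]

/-- The Fisher information in a direction of a coordinate plane. -/
theorem exists_fisher_plane {d : ℕ} {f : polySpace ι r d} (hf : ∀ x, 0 < f.1 x)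
    (u v : EuclideanSpace ℝ ι) : ∃ K : ℝ, ∀ a b : ℝ, fisher σ (a • u + b • v) f.1
      = a ^ 2 * fisher σ u f.1 + b ^ 2 * fisher σ v f.1 + 2 * (a * b) * K := by
  -- The bilinear form polarizing the quadratic form `u ↦ fisher σ u f`. Only its independence of
  -- `a` and `b` matters.
  refine ⟨∫ x, inner ℝ (rotField u f.1 x) (rotField v f.1 x) / f.1 x ∂σ, fun a b => ?_⟩
  have hi : Integrable (fun x => inner ℝ (rotField u f.1 x) (rotField v f.1 x) / f.1 x) σ :=
    integrable_of_continuous σ (((continuous_rotField u f).inner (continuous_rotField v f)).div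
      f.1.continuous fun x => (hf x).ne')
  have hu := (integrable_of_continuous σ (continuous_fisherDensity u f hf)).const_mul (a ^ 2)
  have hv := (integrable_of_continuous σ (continuous_fisherDensity v f hf)).const_mul (b ^ 2)
  simp only [fisher]
  rw [← integral_const_mul, ← integral_const_mul, ← integral_const_mul, ← integral_add hu hv]
  refine Eq.trans ?_ (integral_add (hu.add hv) (hi.const_mul (2 * (a * b))))
  congr 1
  ext x
  rw [rotField_add_left, rotField_smul_left, rotField_smul_left, norm_add_sq_real, norm_smul,
    norm_smul, mul_pow, mul_pow, Real.norm_eq_abs, Real.norm_eq_abs, sq_abs, sq_abs,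
    real_inner_smul_left, real_inner_smul_right]
  ring

variable [RotInvariant σ] (ν : Measure ℝ) [IsProbabilityMeasure ν]

/-- The average of a polynomial over the collisions of a pair. -/
def collisionL (d : ℕ) {i j : ι} (hij : i ≠ j) : polySpace ι r d →ₗ[ℝ] polySpace ι r d :=
  avgL ν (collision hij) (continuous_collision hij) d

theorem integrable_trig {f : ℝ → ℝ} (hf : Continuous f) (hb : ∀ θ, |f θ| ≤ 1) : Integrable f ν :=
  Integrable.of_bound hf.aestronglyMeasurable 1 (Filter.Eventually.of_forall hb)

theorem integral_cos_sq : ∫ θ, Real.cos θ ^ 2 ∂ν = 1 - ∫ θ, Real.sin θ ^ 2 ∂ν := by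
  have h : Integrable (fun θ => Real.sin θ ^ 2) ν := integrable_trig ν (by fun_prop) fun θ => by
    rw [abs_of_nonneg (sq_nonneg _)]
    exact Real.sin_sq_le_one θ
  simp only [Real.cos_sq']
  rw [integral_sub (integrable_const _) h]
  simp

/-- The quadratic form is averaged along the rotated direction; the mixed term carries the factor `∫
a b dν = 0`. For coordinate directions `a` and `b` are, up to sign, sine and cosine. -/
theorem fisher_collisionL_le {d : ℕ} {i j : ι} (hij : i ≠ j) {f : polySpace ι r d}
    (hf : ∀ x, 0 < f.1 x) {u : EuclideanSpace ℝ ι} {a b : ℝ → ℝ} (ha : Continuous a) (hb : Continuous b)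
    (ha1 : ∀ θ, |a θ| ≤ 1) (hb1 : ∀ θ, |b θ| ≤ 1)
    (hu : ∀ θ, collision hij θ u
      = a θ • EuclideanSpace.single i 1 + b θ • EuclideanSpace.single j (1 : ℝ))
    (hab : ∫ θ, a θ * b θ ∂ν = 0) :
    fisher σ u (collisionL ν d hij f).1
      ≤ (∫ θ, a θ ^ 2 ∂ν) * fisher σ (EuclideanSpace.single i 1) f.1
        + (∫ θ, b θ ^ 2 ∂ν) * fisher σ (EuclideanSpace.single j 1) f.1 := by
  obtain ⟨K, hK⟩ := exists_fisher_plane σ hf (EuclideanSpace.single i (1 : ℝ))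
    (EuclideanSpace.single j (1 : ℝ))
  have hi1 : Integrable (fun θ => a θ ^ 2) ν := integrable_trig ν (ha.pow 2) fun θ => by
    rw [abs_pow]; exact pow_le_one₀ (abs_nonneg _) (ha1 θ)
  have hi2 : Integrable (fun θ => b θ ^ 2) ν := integrable_trig ν (hb.pow 2) fun θ => by
    rw [abs_pow]; exact pow_le_one₀ (abs_nonneg _) (hb1 θ)
  have hi3 : Integrable (fun θ => a θ * b θ) ν := integrable_trig ν (ha.mul hb) fun θ => by
    rw [abs_mul]; exact mul_le_one₀ (ha1 θ) (abs_nonneg _) (hb1 θ)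
  have hI := ((hi1.mul_const (fisher σ (EuclideanSpace.single i 1) f.1)).add
    (hi2.mul_const (fisher σ (EuclideanSpace.single j 1) f.1))).add ((hi3.const_mul 2).mul_const K)
  have heq : (fun θ => fisher σ (collision hij θ u) f.1) = _ := funext fun θ => by rw [hu, hK]
  refine (fisher_avgL_le ν _ _ σ u hf (by rw [heq]; exact hI)).trans (le_of_eq ?_)
  rw [heq]
  refine (integral_add ((hi1.mul_const _).add (hi2.mul_const _)) ((hi3.const_mul 2).mul_const K)
    ).trans ?_
  rw [integral_mul_const, integral_const_mul, hab, mul_zero, zero_mul, add_zero]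
  refine (integral_add (hi1.mul_const _) (hi2.mul_const _)).trans ?_
  rw [integral_mul_const, integral_mul_const]

theorem fisher_collisionL_left_le {d : ℕ} {i j : ι} (hij : i ≠ j) {f : polySpace ι r d}
    (hf : ∀ x, 0 < f.1 x) (hsc : ∫ θ, Real.sin θ * Real.cos θ ∂ν = 0) :
    fisher σ (EuclideanSpace.single i 1) (collisionL ν d hij f).1
      ≤ (1 - ∫ θ, Real.sin θ ^ 2 ∂ν) * fisher σ (EuclideanSpace.single i 1) f.1
        + (∫ θ, Real.sin θ ^ 2 ∂ν) * fisher σ (EuclideanSpace.single j 1) f.1 := by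
  rw [← integral_cos_sq]
  exact fisher_collisionL_le σ ν hij hf Real.continuous_cos Real.continuous_sin
    Real.abs_cos_le_one Real.abs_sin_le_one (collision_single_left hij)
    (by simpa only [mul_comm] using hsc)

theorem fisher_collisionL_right_le {d : ℕ} {i j : ι} (hij : i ≠ j) {f : polySpace ι r d}
    (hf : ∀ x, 0 < f.1 x) (hsc : ∫ θ, Real.sin θ * Real.cos θ ∂ν = 0) :
    fisher σ (EuclideanSpace.single j 1) (collisionL ν d hij f).1
      ≤ (∫ θ, Real.sin θ ^ 2 ∂ν) * fisher σ (EuclideanSpace.single i 1) f.1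
        + (1 - ∫ θ, Real.sin θ ^ 2 ∂ν) * fisher σ (EuclideanSpace.single j 1) f.1 := by
  rw [← integral_cos_sq]
  have h := fisher_collisionL_le σ ν hij hf (a := fun θ => -Real.sin θ)
    Real.continuous_sin.neg Real.continuous_cos
    (fun θ => (abs_neg (Real.sin θ)).trans_le (Real.abs_sin_le_one θ)) Real.abs_cos_le_one
    (collision_single_right hij)
    (by simp only [neg_mul, integral_neg, hsc, neg_zero])
  simpa only [neg_sq] using h

theorem fisher_collisionL_of_ne_le {d : ℕ} {i j k : ι} (hij : i ≠ j) (hki : k ≠ i) (hkj : k ≠ j)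
    {f : polySpace ι r d} (hf : ∀ x, 0 < f.1 x) :
    fisher σ (EuclideanSpace.single k 1) (collisionL ν d hij f).1
      ≤ fisher σ (EuclideanSpace.single k 1) f.1 := by
  have heq : (fun θ => fisher σ (collision hij θ (EuclideanSpace.single k 1)) f.1)
      = fun _ => fisher σ (EuclideanSpace.single k 1) f.1 :=
    funext fun θ => by rw [collision_single_of_ne hij hki hkj]
  refine (fisher_avgL_le ν _ _ σ _ hf (by rw [heq]; exact integrable_const _)).trans ?_
  rw [heq]
  simp

/-- The effect of a collision on a weighted sum of directional Fisher informations. -/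
theorem sum_fisher_collisionL_le {d : ℕ} {i j : ι} (hij : i ≠ j) {f : polySpace ι r d}
    (hf : ∀ x, 0 < f.1 x) (hsc : ∫ θ, Real.sin θ * Real.cos θ ∂ν = 0) {p : ι → ℝ}
    (hp : ∀ k, 0 ≤ p k) :
    ∑ k, p k * fisher σ (EuclideanSpace.single k 1) (collisionL ν d hij f).1
      ≤ ∑ k, p k * fisher σ (EuclideanSpace.single k 1) f.1
        + (∫ θ, Real.sin θ ^ 2 ∂ν) * (p j - p i)
          * (fisher σ (EuclideanSpace.single i 1) f.1
            - fisher σ (EuclideanSpace.single j 1) f.1) := by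
  have hsplit : ∀ g : ι → ℝ, ∑ k, g k
      = g i + (g j + ∑ k ∈ (Finset.univ.erase i).erase j, g k) := by
    intro g
    rw [Finset.add_sum_erase _ g (Finset.mem_erase.2 ⟨hij.symm, Finset.mem_univ j⟩),
      Finset.add_sum_erase _ g (Finset.mem_univ i)]
  rw [hsplit, hsplit fun k => p k * fisher σ (EuclideanSpace.single k 1) f.1]
  have h1 := mul_le_mul_of_nonneg_left (fisher_collisionL_left_le σ ν hij hf hsc) (hp i)
  have h2 := mul_le_mul_of_nonneg_left (fisher_collisionL_right_le σ ν hij hf hsc) (hp j)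
  have h3 : ∑ k ∈ (Finset.univ.erase i).erase j,
        p k * fisher σ (EuclideanSpace.single k 1) (collisionL ν d hij f).1
      ≤ ∑ k ∈ (Finset.univ.erase i).erase j, p k * fisher σ (EuclideanSpace.single k 1) f.1 := by
    refine Finset.sum_le_sum fun k hk => mul_le_mul_of_nonneg_left ?_ (hp k)
    simp only [Finset.mem_erase] at hk
    exact fisher_collisionL_of_ne_le σ ν hij hk.2.1 hk.1 hf
  -- The mixture gives `p_i ((1-s) I_i + s I_j) + p_j (s I_i + (1-s) I_j)`, which is `p_i I_i + p_j
  -- I_j + s (p_j - p_i)(I_i - I_j)`.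
  linarith

end Collision

/-! ### Plane rotations as elements of the special orthogonal group -/

section Givens

variable {ι : Type*} [Fintype ι] [DecidableEq ι]

theorem collision_collision {i j : ι} (hij : i ≠ j) (θ φ : ℝ) (x : EuclideanSpace ℝ ι) :
    collision hij θ (collision hij φ x) = collision hij (θ + φ) x := by
  ext k
  simp only [collision, LinearIsometry.coe_mk, LinearMap.coe_mk, AddHom.coe_mk, if_true,
    if_neg hij.symm, Real.cos_add, Real.sin_add]
  split_ifs <;> ring

/-- The matrix of a plane rotation. -/
def collisionMatrix {i j : ι} (hij : i ≠ j) (θ : ℝ) : Matrix ι ι ℝ :=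
  Matrix.of fun k l => collision hij θ (EuclideanSpace.single l 1) k

theorem collisionMatrix_mulVec {i j : ι} (hij : i ≠ j) (θ : ℝ) (x : EuclideanSpace ℝ ι) :
    (collisionMatrix hij θ).mulVec x.ofLp = (collision hij θ x).ofLp := by
  have hx : x = ∑ a, x a • EuclideanSpace.single a (1 : ℝ) := by
    ext k
    simp only [WithLp.ofLp_sum, Finset.sum_apply, PiLp.smul_apply, PiLp.single_apply, smul_eq_mul]
    simp
  funext k
  conv_rhs => rw [hx, map_sum]
  simp [Matrix.mulVec, dotProduct, collisionMatrix, mul_comm]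

theorem collisionMatrix_mul {i j : ι} (hij : i ≠ j) (θ φ : ℝ) :
    collisionMatrix hij θ * collisionMatrix hij φ = collisionMatrix hij (θ + φ) := by
  refine Matrix.ext_of_mulVec_single fun l => ?_
  have h : ∀ ψ, (collisionMatrix hij ψ).mulVec (Pi.single l 1)
      = (collision hij ψ (EuclideanSpace.single l 1)).ofLp := fun ψ =>
    collisionMatrix_mulVec hij ψ (EuclideanSpace.single l 1)
  rw [← Matrix.mulVec_mulVec, h, h, collisionMatrix_mulVec, collision_collision]

theorem collisionMatrix_mem_orthogonal {i j : ι} (hij : i ≠ j) (θ : ℝ) :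
    collisionMatrix hij θ ∈ Matrix.orthogonalGroup ι ℝ := by
  rw [Matrix.mem_orthogonalGroup_iff']
  ext k l
  have h := (collision hij θ).inner_map_map (EuclideanSpace.single k (1 : ℝ))
    (EuclideanSpace.single l (1 : ℝ))
  rw [PiLp.inner_apply, EuclideanSpace.inner_single_left] at h
  simp only [RCLike.inner_apply, conj_trivial, one_mul] at h
  rw [Matrix.mul_apply, Matrix.one_apply]
  simp only [collisionMatrix, Matrix.of_apply]
  rw [PiLp.single_apply] at h
  rw [← h]
  exact Finset.sum_congr rfl fun m _ => mul_comm _ _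

/-- A rotation by `θ` is the square of an orthogonal matrix, the rotation by `θ / 2`, and the
determinant of the latter squares to `1`. -/
theorem det_collisionMatrix {i j : ι} (hij : i ≠ j) (θ : ℝ) : (collisionMatrix hij θ).det = 1 := by
  have h := (Matrix.mem_orthogonalGroup_iff _ _).1 (collisionMatrix_mem_orthogonal hij (θ / 2))
  have h2 := congrArg Matrix.det h
  rw [Matrix.det_mul, Matrix.det_transpose, Matrix.det_one] at h2
  rw [← add_halves θ, ← collisionMatrix_mul, Matrix.det_mul, h2]

theorem exists_reservoirRotation_eq_collision (M : ℕ) {N : ℕ} {i j : Fin N} (hij : i ≠ j)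
    (hij' : (Sum.inr i : Fin M ⊕ Fin N) ≠ Sum.inr j) (θ : ℝ) :
    ∃ A : SO N, ∀ x, reservoirRotation M A x = collision hij' θ x := by
  obtain ⟨B, hB⟩ : ∃ B : SO N, (B : Matrix (Fin N) (Fin N) ℝ) = collisionMatrix hij θ :=
    ⟨⟨_, Matrix.mem_specialOrthogonalGroup_iff.2
      ⟨collisionMatrix_mem_orthogonal hij θ, det_collisionMatrix hij θ⟩⟩, rfl⟩
  -- The inverse compensates the `A⁻¹` in the action on the reservoir variables.
  refine ⟨B⁻¹, fun x => ?_⟩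
  ext k
  simp only [reservoirRotation, LinearIsometry.coe_mk, LinearMap.coe_mk, AddHom.coe_mk, inv_inv,
    hB]
  rcases k with a | b
  · simp [collision]
  · have h := congrFun (collisionMatrix_mulVec hij θ (WithLp.toLp 2 fun j => x (Sum.inr j))) b
    simp only [Sum.elim_inr]
    refine h.trans ?_
    simp only [collision, LinearIsometry.coe_mk, LinearMap.coe_mk, AddHom.coe_mk, Sum.inr.injEq]

end Givens

/-! ### The marginal and the Fisher information -/

section Marginal

variable {M N : ℕ} {r : ℝ} [hr : Fact (0 < r)]

theorem continuous_reservoirRotation :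
    Continuous fun p : SO N × Sph (Fin M ⊕ Fin N) r => onSphere (reservoirRotation M p.1) p.2 := by
  refine Continuous.subtype_mk ?_ _
  refine (PiLp.continuous_toLp 2 _).comp (continuous_pi fun k => ?_)
  rcases k with i | j
  · simp only [Sum.elim_inl]; fun_prop
  · simp only [Sum.elim_inr, Matrix.mulVec, dotProduct]
    refine continuous_finsetSum _ fun l _ => Continuous.mul ?_ (by fun_prop)
    exact (SO_entry_continuous N j l).comp (continuous_inv.comp continuous_fst)

/-- The marginal of a polynomial. -/
def marginalL (M N : ℕ) (r : ℝ) [Fact (0 < r)] (d : ℕ) :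
    polySpace (Fin M ⊕ Fin N) r d →ₗ[ℝ] polySpace (Fin M ⊕ Fin N) r d :=
  avgL (haarSO N) (fun A => reservoirRotation M A) continuous_reservoirRotation d

theorem reservoirRotation_mul (A B : SO N) (x : Velocities M N) :
    reservoirRotation M A (reservoirRotation M B x) = reservoirRotation M (B * A) x := by
  ext k
  simp only [reservoirRotation, LinearIsometry.coe_mk, LinearMap.coe_mk, AddHom.coe_mk]
  rcases k with a | b
  · rfl
  · simp only [Sum.elim_inr, Matrix.mulVec_mulVec, mul_inv_rev]
    rfl

/-- The action composes as `A` after `B ↦ B * A`, so left invariance of the Haar measure is what is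
required. -/
theorem marginalL_invariant {d : ℕ} (f : polySpace (Fin M ⊕ Fin N) r d) (B : SO N)
    (x : Sph (Fin M ⊕ Fin N) r) :
    (marginalL M N r d f).1 (onSphere (reservoirRotation M B) x) = (marginalL M N r d f).1 x := by
  rw [marginalL, avgL_apply, avgL_apply]
  have h : ∀ A : SO N, onSphere (reservoirRotation M A) (onSphere (reservoirRotation M B) x)
      = onSphere (reservoirRotation M (B * A)) x := fun A =>
    Subtype.ext (reservoirRotation_mul A B x.1)
  simp only [h]
  have : (haarSO N).IsMulLeftInvariant := by
    unfold haarSO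
    infer_instance
  exact integral_mul_left_eq_self (μ := haarSO N)
    (fun A => f.1 (onSphere (reservoirRotation M A) x)) B

/-- A marginal is constant along the orbits of reservoir plane rotations, since these belong to
`SO(N)`. -/
theorem angD_marginalL {d : ℕ} (f : polySpace (Fin M ⊕ Fin N) r d) (i j : Fin N)
    (x : Sph (Fin M ⊕ Fin N) r) :
    angD (Sum.inr i) (Sum.inr j) (marginalL M N r d f).1 x = 0 := by
  by_cases hij : i = j
  · rw [hij, angD_self]
  have hij' : (Sum.inr i : Fin M ⊕ Fin N) ≠ Sum.inr j := fun h => hij (Sum.inr_injective h)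
  refine angD_unique (sphDiff_poly _) hij' x ?_
  have h : ∀ θ, (marginalL M N r d f).1 (onSphere (collision hij' θ) x)
      = (marginalL M N r d f).1 x := by
    intro θ
    obtain ⟨A, hA⟩ := exists_reservoirRotation_eq_collision M hij hij' θ
    rw [← marginalL_invariant f A x]
    congr 1
    exact Subtype.ext (hA x).symm
  simp only [h]
  exact hasDerivAt_const _ _

theorem reservoirRotation_single (A : SO N) (i : Fin M) :
    reservoirRotation M A (EuclideanSpace.single (Sum.inl i) 1)
      = EuclideanSpace.single (Sum.inl i) (1 : ℝ) := by
  ext k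
  simp only [reservoirRotation, LinearIsometry.coe_mk, LinearMap.coe_mk, AddHom.coe_mk]
  rcases k with a | b <;> simp [Matrix.mulVec, dotProduct]

variable (σ : Measure (Sph (Fin M ⊕ Fin N) r)) [IsProbabilityMeasure σ] [RotInvariant σ]

/-- Reservoir rotations fix the system directions, so Jensen's inequality involves no mixing. -/
theorem fisher_marginalL_le {d : ℕ} {f : polySpace (Fin M ⊕ Fin N) r d} (hf : ∀ x, 0 < f.1 x)
    (i : Fin M) : fisher σ (EuclideanSpace.single (Sum.inl i) 1) (marginalL M N r d f).1
      ≤ fisher σ (EuclideanSpace.single (Sum.inl i) 1) f.1 := by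
  have heq : (fun A : SO N => fisher σ (reservoirRotation M A
      (EuclideanSpace.single (Sum.inl i) 1)) f.1)
      = fun _ => fisher σ (EuclideanSpace.single (Sum.inl i) 1) f.1 :=
    funext fun A => by rw [reservoirRotation_single]
  refine (fisher_avgL_le (haarSO N) _ _ σ _ hf (by rw [heq]; exact integrable_const _)).trans ?_
  rw [heq]
  simp

/-- The total Fisher information of a marginal is controlled by the system directions. -/
theorem totalFisher_marginalL_le {d : ℕ} {f : polySpace (Fin M ⊕ Fin N) r d}
    (hf : ∀ x, 0 < f.1 x) : totalFisher σ (marginalL M N r d f).1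
      ≤ ∑ i : Fin M, fisher σ (EuclideanSpace.single (Sum.inl i) 1) f.1 := by
  refine le_trans ?_ (Finset.sum_le_sum fun i _ => fisher_marginalL_le σ hf i)
  obtain ⟨g, hg⟩ : ∃ g, g = marginalL M N r d f := ⟨_, rfl⟩
  have hgpos : ∀ x, 0 < g.1 x := hg ▸ avgL_pos _ _ _ hf
  have hi : ∀ u, Integrable (fun x => ‖rotField u g.1 x‖ ^ 2 / g.1 x) σ := fun u =>
    integrable_of_continuous σ (continuous_fisherDensity u g hgpos)
  rw [← hg, totalFisher]
  simp only [fisher]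
  rw [← integral_finsetSum _ fun a _ => hi _, ← integral_finsetSum _ fun a _ => hi _,
    ← integral_const_mul]
  refine integral_mono ((integrable_finsetSum _ fun a _ => hi _).const_mul _)
    (integrable_finsetSum _ fun a _ => hi _) fun x => ?_
  simp only
  rw [← Finset.sum_div, ← Finset.sum_div, mul_div_assoc']
  refine div_le_div_of_nonneg_right ?_ (hgpos x).le
  simp only [norm_rotField_single]
  -- Let `SS` and `SR` be the sums of `(L_ab g)²` over system-system and system-reservoir pairs.
  -- Reservoir-reservoir terms vanish and antisymmetry doubles `SR`, so the total is `½ (SS + 2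
  -- SR)`, while the system directions sum to `SS + SR`.
  rw [Fintype.sum_sum_type]
  simp only [Fintype.sum_sum_type, hg, angD_marginalL]
  have hanti : ∑ j : Fin N, ∑ i : Fin M,
        angD (Sum.inr j) (Sum.inl i) (marginalL M N r d f).1 x ^ 2
      = ∑ i : Fin M, ∑ j : Fin N, angD (Sum.inl i) (Sum.inr j) (marginalL M N r d f).1 x ^ 2 := by
    rw [Finset.sum_comm]
    refine Finset.sum_congr rfl fun i _ => Finset.sum_congr rfl fun j _ => ?_
    simp only [angD]
    ring
  simp only [Finset.sum_add_distrib, hanti]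
  have h1 : 0 ≤ ∑ i : Fin M, ∑ j : Fin M,
      angD (Sum.inl i) (Sum.inl j) (marginalL M N r d f).1 x ^ 2 :=
    Finset.sum_nonneg fun i _ => Finset.sum_nonneg fun j _ => sq_nonneg _
  simp
  linarith

end Marginal

/-! ### Euler steps of the master equation and the dual evolution of weights. -/

/-! ### One step of the evolution -/

section Step

variable {ι : Type*} [Fintype ι] {r : ℝ} [hr : Fact (0 < r)] [DecidableEq ι]
  (ν : Measure ℝ) [IsProbabilityMeasure ν]

/-- The collision operator of a pair on polynomials, the identity for `i = j`. -/
def pairL (d : ℕ) (i j : ι) : polySpace ι r d →ₗ[ℝ] polySpace ι r d :=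
  if hij : i ≠ j then collisionL ν d hij else 1

/-- The step `1 + h ∑ λ_ij (R_ij - 1)` on polynomials. -/
def stepL (d : ℕ) (lam : ι → ι → ℝ) (h : ℝ) : polySpace ι r d →ₗ[ℝ] polySpace ι r d :=
  1 + h • ∑ i, ∑ j, lam i j • ((pairL ν d i j : polySpace ι r d →ₗ[ℝ] polySpace ι r d) - 1)

theorem functional_stepL {d : ℕ} (lam : ι → ι → ℝ) (h : ℝ) {W : Type*} [AddCommGroup W]
    [Module ℝ W] (l : polySpace ι r d →ₗ[ℝ] W) (f : polySpace ι r d) : l (stepL ν d lam h f)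
      = l f + h • ∑ i, ∑ j, lam i j • (l (pairL ν d i j f) - l f) := by
  simp only [stepL, LinearMap.add_apply, LinearMap.smul_apply, LinearMap.sum_apply,
    LinearMap.sub_apply, Module.End.one_apply, map_add, map_smul, map_sum, map_sub]

variable {lam : ι → ι → ℝ} {h : ℝ}

/-- For small `h` the step is a convex combination of the identity and the pair operators. With `l`
a supporting functional of the Fisher information at `stepL f`, this is convexity for that
combination. -/
theorem stepL_le {d : ℕ} (hlam : ∀ i j, 0 ≤ lam i j) (hh : 0 ≤ h)
    (hsmall : h * ∑ i, ∑ j, lam i j ≤ 1) (l : polySpace ι r d →ₗ[ℝ] ℝ) (f : polySpace ι r d)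
    {K : ℝ} {K' : ι → ι → ℝ} (hK : l f ≤ K) (hK' : ∀ i j, l (pairL ν d i j f) ≤ K' i j) :
    l (stepL ν d lam h f) ≤ K + h * ∑ i, ∑ j, lam i j * (K' i j - K) := by
  have h1 : ∀ (c : ℝ) (c' : ι → ι → ℝ), c + h * ∑ i, ∑ j, lam i j * (c' i j - c)
      = (1 - h * ∑ i, ∑ j, lam i j) * c + h * ∑ i, ∑ j, lam i j * c' i j := by
    intro c c'
    simp only [mul_sub, Finset.sum_sub_distrib, ← Finset.sum_mul]
    ring
  rw [functional_stepL]
  simp only [smul_eq_mul]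
  rw [h1, h1]
  refine add_le_add (mul_le_mul_of_nonneg_left hK (by linarith)) (mul_le_mul_of_nonneg_left ?_ hh)
  exact Finset.sum_le_sum fun i _ => Finset.sum_le_sum fun j _ =>
    mul_le_mul_of_nonneg_left (hK' i j) (hlam i j)

variable (σ : Measure (Sph ι r)) [IsProbabilityMeasure σ] [RotInvariant σ] [σ.IsOpenPosMeasure]

theorem isMarkov_pairL (d : ℕ) (i j : ι) : IsMarkov σ (pairL ν d i j : _ →ₗ[ℝ] polySpace ι r d) := by
  unfold pairL
  split_ifs
  · exact isMarkov_avgL ν _ _ d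
  · exact IsMarkov.id

theorem isMarkov_stepL (d : ℕ) (hlam : ∀ i j, 0 ≤ lam i j) (hh : 0 ≤ h)
    (hsmall : h * ∑ i, ∑ j, lam i j < 1) :
    IsMarkov σ (stepL ν d lam h : _ →ₗ[ℝ] polySpace ι r d) := by
  refine ⟨fun f hf x => ?_, fun f => ?_, fun f => ?_⟩
  · have h1 := functional_stepL ν lam h (evalL d x) f
    change (stepL ν d lam h f).1 x = _ at h1
    rw [h1]
    have h2 : h * ∑ i, ∑ j, lam i j * (0 - f.1 x)
        ≤ h * ∑ i, ∑ j, lam i j * ((pairL ν d i j f).1 x - f.1 x) := by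
      gcongr with i _ j _
      · exact hlam i j
      · exact ((isMarkov_pairL ν σ d i j).pos f hf x).le
    have h3 : h * ∑ i, ∑ j, lam i j * (0 - f.1 x) = - (h * ∑ i, ∑ j, lam i j) * f.1 x := by
      simp only [← Finset.sum_mul]
      ring
    have h4 := hf x
    simp only [smul_eq_mul]
    change 0 < f.1 x + h * ∑ i, ∑ j, lam i j * ((pairL ν d i j f).1 x - f.1 x)
    nlinarith
  · have h1 := functional_stepL ν lam h (lap ι r d) f
    have h2 := functional_stepL ν lam h (1 : polySpace ι r d →ₗ[ℝ] polySpace ι r d) (lap ι r d f)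
    simp only [Module.End.one_apply] at h2
    rw [h1, h2]
    simp only [(isMarkov_pairL ν σ d _ _).comm]
  · have h1 := functional_stepL ν lam h (integralL σ d) f
    have h2 : ∀ i j, integralL σ d (pairL ν d i j f) = integralL σ d f := fun i j =>
      (isMarkov_pairL ν σ d i j).mass f
    simp only [h2, sub_self, smul_zero, Finset.sum_const_zero, add_zero] at h1
    exact h1

theorem sum_fisher_pairL_le {d : ℕ} (i j : ι) {f : polySpace ι r d}
    (hf : ∀ x, 0 < f.1 x) (hsc : ∫ θ, Real.sin θ * Real.cos θ ∂ν = 0) {p : ι → ℝ}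
    (hp : ∀ k, 0 ≤ p k) :
    ∑ k, p k * fisher σ (EuclideanSpace.single k 1) (pairL ν d i j f).1
      ≤ ∑ k, p k * fisher σ (EuclideanSpace.single k 1) f.1
        + (∫ θ, Real.sin θ ^ 2 ∂ν) * (p j - p i)
          * (fisher σ (EuclideanSpace.single i 1) f.1
            - fisher σ (EuclideanSpace.single j 1) f.1) := by
  by_cases hij : i = j
  · subst hij
    simp [pairL]
  · rw [pairL, dif_pos hij]
    exact sum_fisher_collisionL_le σ ν hij hf hsc hp

/-- The effect of a step on a weighted sum of directional Fisher informations. -/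
theorem sum_fisher_stepL_le {d : ℕ} (hlam : ∀ i j, 0 ≤ lam i j) (hh : 0 ≤ h)
    (hsmall : h * ∑ i, ∑ j, lam i j < 1) {f : polySpace ι r d}
    (hf : ∀ x, 0 < f.1 x) (hsc : ∫ θ, Real.sin θ * Real.cos θ ∂ν = 0) {p : ι → ℝ}
    (hp : ∀ k, 0 ≤ p k) :
    ∑ k, p k * fisher σ (EuclideanSpace.single k 1) (stepL ν d lam h f).1
      ≤ ∑ k, p k * fisher σ (EuclideanSpace.single k 1) f.1
        + h * ∑ i, ∑ j, lam i j * ((∫ θ, Real.sin θ ^ 2 ∂ν) * (p j - p i)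
          * (fisher σ (EuclideanSpace.single i 1) f.1
            - fisher σ (EuclideanSpace.single j 1) f.1)) := by
  have hstep : ∀ k, fisher σ (EuclideanSpace.single k 1) (stepL ν d lam h f).1
      ≤ fisher σ (EuclideanSpace.single k 1) f.1 + h * ∑ i, ∑ j, lam i j *
        (fisher σ (EuclideanSpace.single k 1) (pairL ν d i j f).1
          - fisher σ (EuclideanSpace.single k 1) f.1) := by
    intro k
    obtain ⟨l, hl, hle⟩ := exists_fisher_support σ (EuclideanSpace.single k (1 : ℝ))
      ((isMarkov_stepL ν σ d hlam hh hsmall).pos f hf)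
    rw [← hl]
    exact stepL_le ν hlam hh hsmall.le l f (hle f hf) fun i j =>
      hle _ ((isMarkov_pairL ν σ d i j).pos f hf)
  calc ∑ k, p k * fisher σ (EuclideanSpace.single k 1) (stepL ν d lam h f).1
      ≤ ∑ k, p k * (fisher σ (EuclideanSpace.single k 1) f.1 + h * ∑ i, ∑ j, lam i j *
        (fisher σ (EuclideanSpace.single k 1) (pairL ν d i j f).1
          - fisher σ (EuclideanSpace.single k 1) f.1)) :=
        Finset.sum_le_sum fun k _ => mul_le_mul_of_nonneg_left (hstep k) (hp k)
    _ = ∑ k, p k * fisher σ (EuclideanSpace.single k 1) f.1 + h * ∑ i, ∑ j, lam i j *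
        (∑ k, p k * fisher σ (EuclideanSpace.single k 1) (pairL ν d i j f).1
          - ∑ k, p k * fisher σ (EuclideanSpace.single k 1) f.1) := by
        simp only [mul_add, Finset.sum_add_distrib]
        congr 1
        simp only [← Finset.sum_sub_distrib, Finset.mul_sum]
        rw [Finset.sum_comm]
        refine Finset.sum_congr rfl fun i _ => ?_
        rw [Finset.sum_comm]
        refine Finset.sum_congr rfl fun j _ => Finset.sum_congr rfl fun k _ => ?_
        ring
    _ ≤ _ := by
        gcongr with i _ j _
        · exact hlam i j
        · rw [sub_le_iff_le_add']
          exact sum_fisher_pairL_le ν σ i j hf hsc hp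

end Step

/-! ### The rates of the Kac generator -/

/-- The collision rates of the system and the reservoir. -/
def rates (M N : ℕ) (lamS lamR mu : ℝ) : Fin M ⊕ Fin N → Fin M ⊕ Fin N → ℝ
  | Sum.inl i, Sum.inl j => if i < j then lamS / ((M : ℝ) - 1) else 0
  | Sum.inl _, Sum.inr _ => mu / (N : ℝ)
  | Sum.inr _, Sum.inl _ => 0
  | Sum.inr i, Sum.inr j => if i < j then lamR / ((N : ℝ) - 1) else 0

/-- For `M = 1` or `N = 1` the prefactor is a division by zero, hence `0`, in agreement with the
empty sum. -/
theorem rates_nonneg {M N : ℕ} (hM : 1 ≤ M) (hN : 1 ≤ N) {lamS lamR mu : ℝ} (hlamS : 0 ≤ lamS)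
    (hlamR : 0 ≤ lamR) (hmu : 0 ≤ mu) (i j : Fin M ⊕ Fin N) : 0 ≤ rates M N lamS lamR mu i j := by
  have h1 : (0 : ℝ) ≤ (M : ℝ) - 1 := sub_nonneg.2 (by exact_mod_cast hM)
  have h2 : (0 : ℝ) ≤ (N : ℝ) - 1 := sub_nonneg.2 (by exact_mod_cast hN)
  rcases i with i | i <;> rcases j with j | j <;> simp only [rates] <;> try split_ifs
  all_goals positivity

theorem sum_rates {M N : ℕ} (lamS lamR mu : ℝ) {W : Type*} [AddCommGroup W] [Module ℝ W]
    (X : Fin M ⊕ Fin N → Fin M ⊕ Fin N → W) :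
    ∑ i, ∑ j, rates M N lamS lamR mu i j • X i j
      = (lamS / ((M : ℝ) - 1)) • (∑ i : Fin M, ∑ j ∈ Finset.Ioi i, X (Sum.inl i) (Sum.inl j))
        + (lamR / ((N : ℝ) - 1)) • (∑ i : Fin N, ∑ j ∈ Finset.Ioi i, X (Sum.inr i) (Sum.inr j))
        + (mu / (N : ℝ)) • (∑ i : Fin M, ∑ j : Fin N, X (Sum.inl i) (Sum.inr j)) := by
  have hIoi : ∀ {n : ℕ} (c : ℝ) (i : Fin n) (Y : Fin n → W),
      ∑ j, (if i < j then c else 0) • Y j = c • ∑ j ∈ Finset.Ioi i, Y j := by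
    intro n c i Y
    have h : Finset.Ioi i = Finset.univ.filter fun j => i < j := by
      ext j
      simp
    rw [h, Finset.sum_filter, Finset.smul_sum]
    refine Finset.sum_congr rfl fun j _ => ?_
    split_ifs <;> simp
  simp only [Fintype.sum_sum_type, rates, Finset.sum_add_distrib, hIoi, zero_smul,
    Finset.sum_const_zero, ← Finset.smul_sum]
  abel

theorem generator_apply (M N : ℕ) (lamS lamR mu : ℝ) (ν : Measure ℝ) [IsProbabilityMeasure ν]
    (F : Lp ℝ 1 (sphereMeasure M N)) : generator M N lamS lamR mu ν F
      = ∑ i, ∑ j, rates M N lamS lamR mu i j • (R M N ν i j F - F) := by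
  rw [sum_rates]
  simp only [generator, add_apply, smul_apply, sum_apply, sub_apply, one_apply_eq_self]

/-! ### Entropy decay on polynomials -/

section PolyDecay

variable {M N : ℕ} {r : ℝ} [hr : Fact (0 < r)] (ν : Measure ℝ) [IsProbabilityMeasure ν]
  (σ : Measure (Sph (Fin M ⊕ Fin N) r)) [IsProbabilityMeasure σ] [RotInvariant σ]
  [σ.IsOpenPosMeasure] {lamS lamR mu h : ℝ}

/-- Weights which are constant on the system and on the reservoir. -/
def weights (M N : ℕ) (α β : ℝ) : Fin M ⊕ Fin N → ℝ := Sum.elim (fun _ => α) fun _ => β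

/-- Collisions within the system or within the reservoir have no effect on block-constant weights.
Those between the blocks form a two-state exchange: `α - β` is multiplied by `1 - h s μ (1 + M/N)`
and `M α + N β` is conserved. -/
theorem weights_step {M N : ℕ} (hN : 1 ≤ N) (lamS lamR mu h s α β : ℝ) (K : Fin M ⊕ Fin N → ℝ) :
    ∑ k, weights M N α β k * K k + h * ∑ i, ∑ j, rates M N lamS lamR mu i j *
        (s * (weights M N α β j - weights M N α β i) * (K i - K j))
      = ∑ k, weights M N (α - h * s * mu * (α - β)) (β + h * s * mu * (M / N) * (α - β)) k * K k := by
  have hN' : (N : ℝ) ≠ 0 := by positivity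
  have h1 := sum_rates (M := M) (N := N) lamS lamR mu fun i j =>
    s * (weights M N α β j - weights M N α β i) * (K i - K j)
  simp only [smul_eq_mul] at h1
  rw [h1]
  simp only [weights, Fintype.sum_sum_type, Sum.elim_inl, Sum.elim_inr, sub_self, mul_zero,
    zero_mul, Finset.sum_const_zero, zero_add, ← Finset.mul_sum, Finset.sum_sub_distrib,
    Finset.sum_const, Finset.card_univ, Fintype.card_fin, nsmul_eq_mul]
  field_simp
  ring

/-- The weights after `k` steps of the evolution. -/
def decayWeight (M N : ℕ) (γ : ℝ) (k : ℕ) : Fin M ⊕ Fin N → ℝ :=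
  weights M N (M / (M + N) + N / (M + N) * (1 - γ) ^ k) (M / (M + N) * (1 - (1 - γ) ^ k))

variable (hM : 1 ≤ M) (hN : 1 ≤ N) (hlamS : 0 ≤ lamS) (hlamR : 0 ≤ lamR) (hmu : 0 ≤ mu)
  (hh : 0 ≤ h) (hsmall : h * ∑ i, ∑ j, rates M N lamS lamR mu i j < 1)
  (hγ : h * (∫ θ, Real.sin θ ^ 2 ∂ν) * mu * (1 + M / N) ≤ 1)
  (hsc : ∫ θ, Real.sin θ * Real.cos θ ∂ν = 0)

include hM hN hlamS hlamR hmu hh hsmall hγ hsc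

theorem sum_fisher_pow_le {d : ℕ} (k : ℕ) {f : polySpace (Fin M ⊕ Fin N) r d}
    (hf : ∀ x, 0 < f.1 x) :
    ∑ i : Fin M, fisher σ (EuclideanSpace.single (Sum.inl i) 1)
        ((stepL ν d (rates M N lamS lamR mu) h ^ k) f).1
      ≤ ∑ a, decayWeight M N (h * (∫ θ, Real.sin θ ^ 2 ∂ν) * mu * (1 + M / N)) k a
          * fisher σ (EuclideanSpace.single a 1) f.1 := by
  obtain ⟨s, hs⟩ : ∃ s, s = ∫ θ, Real.sin θ ^ 2 ∂ν := ⟨_, rfl⟩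
  obtain ⟨γ, hγ'⟩ : ∃ γ, γ = h * s * mu * (1 + M / N) := ⟨_, rfl⟩
  have hs0 : 0 ≤ s := hs ▸ integral_nonneg fun θ => sq_nonneg _
  have hγ0 : 0 ≤ γ := by rw [hγ']; positivity
  have hN' : (0 : ℝ) < N := by exact_mod_cast hN
  have hlam := rates_nonneg hM hN hlamS hlamR hmu
  rw [← hs, ← hγ'] at hγ ⊢
  have hsum : (M : ℝ) + N ≠ 0 := by positivity
  induction k generalizing f with
  | zero =>
    refine le_of_eq ?_
    have h1 : (M : ℝ) / (M + N) + N / (M + N) = 1 := by field_simp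
    simp [decayWeight, weights, Fintype.sum_sum_type, h1]
  | succ k ih =>
    have hq0 : 0 ≤ (1 - γ) ^ k := pow_nonneg (by linarith) k
    have hq1 : (1 - γ) ^ k ≤ 1 := pow_le_one₀ (by linarith) (by linarith)
    rw [pow_succ, Module.End.mul_apply]
    -- The new step acts first on `f`: the induction hypothesis is used at `stepL f`, and the extra
    -- step is absorbed into the weights, which therefore evolve by the adjoint.
    refine (ih ((isMarkov_stepL ν σ d hlam hh hsmall).pos f hf)).trans ?_
    refine (sum_fisher_stepL_le ν σ hlam hh hsmall hf hsc ?_).trans (le_of_eq ?_)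
    · rintro (a | a)
      · simp only [decayWeight, weights, Sum.elim_inl]
        positivity
      · simp only [decayWeight, weights, Sum.elim_inr]
        have : 0 ≤ 1 - (1 - γ) ^ k := by linarith
        positivity
    · rw [← hs, decayWeight, weights_step hN, decayWeight]
      have h1 : (M : ℝ) / (M + N) + N / (M + N) * (1 - γ) ^ k - M / (M + N) * (1 - (1 - γ) ^ k)
          = (1 - γ) ^ k := by
        field_simp
        ring
      have h2 : h * s * mu = γ * (N / (M + N)) := by
        rw [hγ']
        field_simp
        ring
      have h3 : γ * ((N : ℝ) / (M + N)) * (M / N) = γ * (M / (M + N)) := by field_simp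
      rw [h1, h2, h3, pow_succ]
      congr 1
      ext a
      congr 2
      · ring
      · ring

/-- Entropy decay for positive polynomials. -/
theorem entropy_pow_le [Nontrivial (Fin M ⊕ Fin N)] {d : ℕ} (k : ℕ)
    {f : polySpace (Fin M ⊕ Fin N) r d} (hf : ∀ x, 0 < f.1 x) :
    ∫ x, klFun ((marginalL M N r d ((stepL ν d (rates M N lamS lamR mu) h ^ k) f)).1 x) ∂σ
        - klFun (∫ x, f.1 x ∂σ)
      ≤ 2 * (M / (M + N) + N / (M + N)
          * (1 - h * (∫ θ, Real.sin θ ^ 2 ∂ν) * mu * (1 + M / N)) ^ k)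
        * (∫ x, klFun (f.1 x) ∂σ - klFun (∫ x, f.1 x ∂σ)) := by
  have hlam := rates_nonneg hM hN hlamS hlamR hmu
  have hmark : IsMarkov σ (stepL ν d (rates M N lamS lamR mu) h ^ k) :=
    (isMarkov_stepL ν σ d hlam hh hsmall).pow k
  have hmarg : IsMarkov σ (marginalL M N r d) := isMarkov_avgL _ _ _ d
  have hcomp := hmarg.comp hmark
  obtain ⟨γ, hγ'⟩ : ∃ γ, γ = h * (∫ θ, Real.sin θ ^ 2 ∂ν) * mu * (1 + M / N) := ⟨_, rfl⟩
  have hq0 : 0 ≤ (1 - γ) ^ k := pow_nonneg (by rw [hγ']; linarith) k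
  rw [← hγ']
  refine entropy_le_of_fisher_le σ (by positivity) hcomp.pos hcomp.comm hcomp.mass
    (fun g hg => ?_) hf
  rw [Module.End.mul_apply]
  refine (totalFisher_marginalL_le σ (hmark.pos g hg)).trans
    ((sum_fisher_pow_le ν σ hM hN hlamS hlamR hmu hh hsmall hγ hsc k hg).trans ?_)
  rw [← hγ', totalFisher, mul_assoc, mul_left_comm, ← mul_assoc 2, show (2 : ℝ) * (1 / 2) = 1 by
    norm_num, one_mul, Finset.mul_sum]
  -- Every weight is bounded by the system weight, because their difference is `(1-γ)^k ≥ 0`. The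
  -- factor `2` has already cancelled the `1 / 2` in the total Fisher information.
  refine Finset.sum_le_sum fun a _ => mul_le_mul_of_nonneg_right ?_ (fisher_nonneg σ _ hg)
  rcases a with a | a
  · exact le_rfl
  · simp only [decayWeight, weights, Sum.elim_inr]
    have h1 : (0 : ℝ) ≤ M / (M + N) * (1 - γ) ^ k := by positivity
    have h2 : (0 : ℝ) ≤ N / (M + N) * (1 - γ) ^ k := by positivity
    linarith

end PolyDecay

/-! ### Passage from positive polynomials and Euler steps to densities in `L¹` and the semigroup. -/

/-! ### Polynomials in `L¹` -/

section LOne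

theorem averageOp_coeFn {Ω X : Type*} [MeasurableSpace Ω] [MeasurableSpace X]
    (P : Measure Ω) [IsProbabilityMeasure P] (σ : Measure X) [IsFiniteMeasure σ]
    (T : Ω → X → X) (hT : Measurable (Function.uncurry T))
    (hσ : ∀ ω, MeasurePreserving (T ω) σ σ) {f : X → ℝ} (hf : Integrable f σ) :
    averageOp P σ T hT hσ (hf.toL1 f) =ᵐ[σ] fun x => ∫ ω, f (T ω x) ∂P := by
  have h1 : averageOp P σ T hT hσ (hf.toL1 f) =ᵐ[σ] fun x => ∫ ω, hf.toL1 f (T ω x) ∂P :=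
    Integrable.coeFn_toL1 (integrable_family P σ T hT hσ (hf.toL1 f)).integral_prod_left
  have h2 := Measure.ae_ae_of_ae_prod
    ((measurePreserving_family P σ T hT hσ).quasiMeasurePreserving.ae hf.coeFn_toL1)
  filter_upwards [h1, h2] with x hx hx2
  rw [hx]
  exact integral_congr_ae hx2

/-- Polynomials as elements of `L¹`. -/
def polyL1 {ι : Type*} [Fintype ι] {r : ℝ} (σ : Measure (Sph ι r)) [IsProbabilityMeasure σ]
    (d : ℕ) : polySpace ι r d →ₗ[ℝ] Lp ℝ 1 σ where
  toFun f := (integrable_of_continuous σ f.1.continuous).toL1 f.1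
  map_add' _ _ := Integrable.toL1_add _ _ _ _
  map_smul' c f := Integrable.toL1_smul _ (integrable_of_continuous σ f.1.continuous) c

theorem polyL1_coeFn {ι : Type*} [Fintype ι] {r : ℝ} (σ : Measure (Sph ι r))
    [IsProbabilityMeasure σ] {d : ℕ} (f : polySpace ι r d) : polyL1 σ d f =ᵐ[σ] f.1 :=
  Integrable.coeFn_toL1 (integrable_of_continuous σ f.1.continuous)

variable {M N : ℕ} [hr : Fact (0 < Real.sqrt ((M : ℝ) + N))]
  [IsProbabilityMeasure (sphereMeasure M N)] (ν : Measure ℝ) [IsProbabilityMeasure ν]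

theorem R_polyL1 {d : ℕ} (i j : Fin M ⊕ Fin N)
    (f : polySpace (Fin M ⊕ Fin N) (Real.sqrt ((M : ℝ) + N)) d) :
    R M N ν i j (polyL1 (sphereMeasure M N) d f)
      = polyL1 (sphereMeasure M N) d (pairL ν d i j f) := by
  by_cases hij : i = j
  · simp [R, pairL, hij]
  · rw [R, dif_pos hij, pairL, dif_pos hij]
    refine Lp.ext ?_
    filter_upwards [averageOp_coeFn ν (sphereMeasure M N) _ (measurable_collision hij)
        (fun θ => measurePreserving_onSphere (collision hij θ))
        (integrable_of_continuous _ f.1.continuous),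
      polyL1_coeFn (sphereMeasure M N) (collisionL ν d hij f)] with x h1 h2
    rw [h2, collisionL, avgL_apply]
    exact h1

theorem marginal_polyL1 {d : ℕ} (f : polySpace (Fin M ⊕ Fin N) (Real.sqrt ((M : ℝ) + N)) d) :
    marginal M N (polyL1 (sphereMeasure M N) d f)
      = polyL1 (sphereMeasure M N) d (marginalL M N _ d f) := by
  refine Lp.ext ?_
  filter_upwards [averageOp_coeFn (haarSO N) (sphereMeasure M N) _
      (measurable_reservoirRotation M N)
      (fun A => measurePreserving_onSphere (reservoirRotation M A))
      (integrable_of_continuous _ f.1.continuous),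
    polyL1_coeFn (sphereMeasure M N) (marginalL M N _ d f)] with x h1 h2
  rw [h2, marginalL, avgL_apply]
  exact h1

theorem step_polyL1 {d : ℕ} (lamS lamR mu h : ℝ)
    (f : polySpace (Fin M ⊕ Fin N) (Real.sqrt ((M : ℝ) + N)) d) :
    (1 + h • generator M N lamS lamR mu ν) (polyL1 (sphereMeasure M N) d f)
      = polyL1 (sphereMeasure M N) d (stepL ν d (rates M N lamS lamR mu) h f) := by
  rw [functional_stepL, add_apply, smul_apply, one_apply_eq_self, generator_apply]
  simp only [R_polyL1]

theorem step_pow_polyL1 {d : ℕ} (lamS lamR mu h : ℝ) (k : ℕ)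
    (f : polySpace (Fin M ⊕ Fin N) (Real.sqrt ((M : ℝ) + N)) d) :
    ((1 + h • generator M N lamS lamR mu ν) ^ k) (polyL1 (sphereMeasure M N) d f)
      = polyL1 (sphereMeasure M N) d ((stepL ν d (rates M N lamS lamR mu) h ^ k) f) := by
  induction k generalizing f with
  | zero => rfl
  | succ k ih =>
    rw [pow_succ, pow_succ, Module.End.mul_apply, ← ih, ← step_polyL1]
    rfl

end LOne

/-! ### Elementary bounds for the entropy function -/

theorem klFun_le_sq {x : ℝ} (hx : 0 ≤ x) : klFun x ≤ (x - 1) ^ 2 := by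
  rw [klFun_apply]
  rcases hx.eq_or_lt with rfl | hx'
  · norm_num
  · nlinarith [mul_le_mul_of_nonneg_left (Real.log_le_sub_one_of_pos hx') hx]

theorem klFun_mono {x y : ℝ} (hx : 1 ≤ x) (hxy : x ≤ y) : klFun x ≤ klFun y := by
  rw [klFun_apply, klFun_apply]
  have hx0 : 0 < x := by linarith
  have hy0 : 0 < y := by linarith
  have h1 : 0 ≤ Real.log x := Real.log_nonneg hx
  have h2 : Real.log (x / y) ≤ x / y - 1 := Real.log_le_sub_one_of_pos (by positivity)
  rw [Real.log_div hx0.ne' hy0.ne'] at h2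
  have h3 : y * (x / y) = x := by field_simp
  nlinarith [mul_le_mul_of_nonneg_left h2 hy0.le, mul_nonneg (sub_nonneg.2 hxy) h1]

/-- Dominates the entropies of truncations. Monotonicity beyond `1` handles `n ≥ 1`; the added `1`
is `klFun 0`, needed for `n = 0`. -/
theorem klFun_min_le {x : ℝ} (hx : 0 ≤ x) (n : ℕ) : klFun (min x n) ≤ klFun x + 1 := by
  rcases le_total x n with h | h
  · rw [min_eq_left h]; linarith
  · rw [min_eq_right h]
    rcases n.eq_zero_or_pos with rfl | hn
    · have := klFun_nonneg hx
      rw [Nat.cast_zero, klFun_zero]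
      linarith
    · have := klFun_mono (by exact_mod_cast hn) h
      linarith

/-! ### Lower semicontinuity of the entropy -/

/-- Lower semicontinuity: a subsequence converges almost everywhere, and Fatou's lemma applies
because the lower integrals involve nonnegative functions. -/
theorem lintegral_klFun_le_of_tendsto {X : Type*} [MeasurableSpace X] {σ : Measure X}
    {G : ℕ → Lp ℝ 1 σ} {F : Lp ℝ 1 σ} (hG : Tendsto G atTop (𝓝 F)) {C : ℕ → ENNReal} {c : ENNReal}
    (hC : Tendsto C atTop (𝓝 c))
    (hle : ∀ᶠ n in atTop, ∫⁻ x, ENNReal.ofReal (klFun (G n x)) ∂σ ≤ C n) :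
    ∫⁻ x, ENNReal.ofReal (klFun (F x)) ∂σ ≤ c := by
  obtain ⟨ns, hns, hae⟩ := (tendstoInMeasure_of_tendsto_Lp hG).exists_seq_tendsto_ae
  have hcont : Continuous fun y : ℝ => ENNReal.ofReal (klFun y) :=
    ENNReal.continuous_ofReal.comp continuous_klFun
  calc ∫⁻ x, ENNReal.ofReal (klFun (F x)) ∂σ
      = ∫⁻ x, Filter.liminf (fun i => ENNReal.ofReal (klFun (G (ns i) x))) atTop ∂σ := by
        refine lintegral_congr_ae ?_
        filter_upwards [hae] with x hx
        exact (((hcont.tendsto _).comp hx).liminf_eq).symm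
    _ ≤ Filter.liminf (fun i => ∫⁻ x, ENNReal.ofReal (klFun (G (ns i) x)) ∂σ) atTop :=
        lintegral_liminf_le fun i => hcont.measurable.comp (Lp.stronglyMeasurable _).measurable
    _ ≤ Filter.liminf (fun i => C (ns i)) atTop :=
        Filter.liminf_le_liminf (hns.tendsto_atTop.eventually hle)
    _ = c := (hC.comp hns.tendsto_atTop).liminf_eq

/-! ### Approximation by positive polynomials -/

section Approximation

theorem tendsto_toL1_klFun {X : Type*} [MeasurableSpace X] {σ : Measure X}
    {h : ℕ → X → ℝ} {F : X → ℝ} (hh : ∀ n, Integrable (h n) σ) (hF : Integrable F σ)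
    {b b' : X → ℝ} (hb : Integrable b σ) (hb' : Integrable b' σ)
    (hhb : ∀ n, ∀ᵐ x ∂σ, |h n x| ≤ b x) (hhb' : ∀ n, ∀ᵐ x ∂σ, |klFun (h n x)| ≤ b' x)
    (hlim : ∀ᵐ x ∂σ, Tendsto (fun n => h n x) atTop (𝓝 (F x))) :
    Tendsto (fun n => ((hh n).toL1 (h n), ∫ x, klFun (h n x) ∂σ)) atTop
      (𝓝 (hF.toL1 F, ∫ x, klFun (F x) ∂σ)) := by
  refine Tendsto.prodMk_nhds ?_ ?_
  · rw [tendsto_iff_norm_sub_tendsto_zero]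
    have heq : ∀ n, ‖(hh n).toL1 (h n) - hF.toL1 F‖ = ∫ x, ‖h n x - F x‖ ∂σ := fun n => by
      rw [← Integrable.toL1_sub, L1.norm_of_fun_eq_integral_norm]
      rfl
    simp only [heq]
    rw [← integral_zero X ℝ (μ := σ)]
    refine tendsto_integral_of_dominated_convergence (fun x => b x + ‖F x‖)
      (fun n => ((hh n).sub hF).norm.aestronglyMeasurable) (hb.add hF.norm) (fun n => ?_) ?_
    · filter_upwards [hhb n] with x hx
      rw [norm_norm]
      exact (norm_sub_le _ _).trans (add_le_add_left hx _)
    · filter_upwards [hlim] with x hx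
      simpa using (hx.sub_const (F x)).norm
  · refine tendsto_integral_of_dominated_convergence b'
      (fun n => continuous_klFun.comp_aestronglyMeasurable (hh n).aestronglyMeasurable) hb' hhb' ?_
    filter_upwards [hlim] with x hx
    exact (continuous_klFun.tendsto _).comp hx

variable {ι : Type*} [Fintype ι] {r : ℝ}

/-- The algebra of polynomials on the sphere. -/
def polyAlgebra (ι : Type*) [Fintype ι] (r : ℝ) : Subalgebra ℝ C(Sph ι r, ℝ) where
  carrier := {g | ∃ d, g ∈ polySpace ι r d}
  algebraMap_mem' c := ⟨0, const_mem_polySpace 0 c⟩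
  mul_mem' := by
    rintro f g ⟨m, hf⟩ ⟨n, hg⟩
    refine ⟨m + n, ?_⟩
    rw [polySpace, pow_add]
    exact Submodule.mul_mem_mul hf hg
  add_mem' := by
    rintro f g ⟨m, hf⟩ ⟨n, hg⟩
    have h1 : ∀ k, (1 : C(Sph ι r, ℝ)) ∈ polySpace ι r k := fun k => by
      simpa using const_mem_polySpace (ι := ι) (r := r) k 1
    refine ⟨m + n, Submodule.add_mem _ ?_ ?_⟩
    · rw [polySpace, pow_add, ← mul_one f]
      exact Submodule.mul_mem_mul hf (h1 n)
    · rw [polySpace, pow_add, ← one_mul g]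
      exact Submodule.mul_mem_mul (h1 m) hg

theorem dense_polyAlgebra : Dense (polyAlgebra ι r : Set C(Sph ι r, ℝ)) := by
  have hsep : (polyAlgebra ι r).SeparatesPoints := by
    intro x y hxy
    by_contra! hcon
    refine hxy (Subtype.ext ?_)
    ext a
    refine hcon (coordFn r a) ⟨coordFn r a, ⟨1, ?_⟩, rfl⟩
    rw [polySpace, pow_one]
    exact coordFn_mem_affineSpace a
  have h := ContinuousMap.subalgebra_topologicalClosure_eq_top_of_separatesPoints _ hsep
  rw [dense_iff_closure_eq, ← Subalgebra.topologicalClosure_coe, h]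
  rfl

variable (σ : Measure (Sph ι r)) [IsProbabilityMeasure σ]

/-- The pairs `(f, ∫ klFun f)` for positive polynomials `f`, in `L¹ × ℝ`. -/
def polyGraph : Set (Lp ℝ 1 σ × ℝ) :=
  {p | ∃ (d : ℕ) (f : polySpace ι r d), (∀ x, 0 < f.1 x) ∧
    p = (polyL1 σ d f, ∫ x, klFun (f.1 x) ∂σ)}

/-- Both components depend continuously on `g` in the uniform norm. Adding `1/(n+1)` makes `g`
strictly positive, and positive functions form an open set, in which polynomials are dense by
Stone-Weierstrass. -/
theorem mem_closure_polyGraph_of_continuous {g : C(Sph ι r, ℝ)} (hg : ∀ x, 0 ≤ g x) :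
    (((integrable_of_continuous σ g.continuous).toL1 g, ∫ x, klFun (g x) ∂σ) : Lp ℝ 1 σ × ℝ)
      ∈ closure (polyGraph σ) := by
  set Φ : C(Sph ι r, ℝ) → Lp ℝ 1 σ × ℝ := fun g => (ContinuousMap.toLp 1 σ ℝ g,
    ∫ x, ContinuousMap.toLp (E := ℝ) 1 σ ℝ (ContinuousMap.comp ⟨klFun, continuous_klFun⟩ g) x ∂σ)
    with hΦ
  have hΦc : Continuous Φ := by
    refine (ContinuousMap.toLp (E := ℝ) 1 σ ℝ).continuous.prodMk ?_
    exact continuous_integral.comp ((ContinuousMap.toLp (E := ℝ) 1 σ ℝ).continuous.comp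
      (ContinuousMap.continuous_postcomp _))
  have hval : ∀ g, Φ g = ((integrable_of_continuous σ g.continuous).toL1 g,
      ∫ x, klFun (g x) ∂σ) := by
    intro g
    refine Prod.ext (Lp.ext ?_) (integral_congr_ae ?_)
    · exact (ContinuousMap.coeFn_toLp σ g).trans
        (Integrable.coeFn_toL1 (integrable_of_continuous σ g.continuous)).symm
    · exact ContinuousMap.coeFn_toLp σ _
  have hU : IsOpen {g : C(Sph ι r, ℝ) | Set.MapsTo g Set.univ (Set.Ioi 0)} :=
    ContinuousMap.isOpen_setOfPred_mapsTo isCompact_univ isOpen_Ioi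
  have hsub : Φ '' ({g : C(Sph ι r, ℝ) | Set.MapsTo g Set.univ (Set.Ioi 0)} ∩ polyAlgebra ι r)
      ⊆ polyGraph σ := by
    rintro _ ⟨f, ⟨hf, d, hd⟩, rfl⟩
    exact ⟨d, ⟨f, hd⟩, fun x => hf (Set.mem_univ x), hval f⟩
  have hlim : Tendsto (fun n : ℕ => g + (1 / ((n : ℝ) + 1)) • (1 : C(Sph ι r, ℝ)))
      atTop (𝓝 g) := by
    simpa using ((tendsto_one_div_add_atTop_nhds_zero_nat (𝕜 := ℝ)).smul_const
      (1 : C(Sph ι r, ℝ))).const_add g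
  rw [← hval]
  refine mem_closure_of_tendsto ((hΦc.tendsto g).comp hlim) (Filter.Eventually.of_forall ?_)
    |> fun h => (closure_minimal (closure_mono hsub) isClosed_closure) h
  intro n
  refine image_closure_subset_closure_image hΦc ⟨_, ?_, rfl⟩
  refine dense_polyAlgebra.open_subset_closure_inter hU ?_
  intro x _
  have : (0 : ℝ) < 1 / ((n : ℝ) + 1) := by positivity
  have := hg x
  simp only [ContinuousMap.add_apply, ContinuousMap.smul_apply, ContinuousMap.one_apply,
    smul_eq_mul, mul_one,
    Set.mem_Ioi]
  linarith

/-- Continuous `L¹` approximants, clipped to `[0, m]`, keep the almost everywhere limit and make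
dominated convergence available for the entropies. -/
theorem mem_closure_polyGraph_of_bounded {F : Sph ι r → ℝ} (hF : Integrable F σ) {m : ℝ}
    (h0 : ∀ᵐ x ∂σ, 0 ≤ F x) (hm : ∀ᵐ x ∂σ, F x ≤ m) (hm0 : 0 ≤ m) :
    ((hF.toL1 F, ∫ x, klFun (F x) ∂σ) : Lp ℝ 1 σ × ℝ) ∈ closure (polyGraph σ) := by
  have hdense := ContinuousMap.toLp_denseRange (α := Sph ι r) ℝ σ ℝ (p := 1) ENNReal.one_ne_top
  obtain ⟨u, hu, hlim⟩ := mem_closure_iff_seq_limit.1 (hdense (hF.toL1 F))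
  choose g hg using hu
  obtain ⟨ns, -, hae⟩ := (tendstoInMeasure_of_tendsto_Lp hlim).exists_seq_tendsto_ae
  set c : ℕ → C(Sph ι r, ℝ) := fun n =>
    ⟨fun x => max 0 (min (g (ns n) x) m), by fun_prop⟩ with hc
  have hc0 : ∀ n x, 0 ≤ c n x := fun n x => le_max_left _ _
  have hcm : ∀ n x, c n x ≤ m := fun n x => max_le hm0 (min_le_right _ _)
  have hcF : ∀ᵐ x ∂σ, Tendsto (fun n => c n x) atTop (𝓝 (F x)) := by
    have hall : ∀ᵐ x ∂σ, ∀ n, u (ns n) x = g (ns n) x := ae_all_iff.2 fun n => by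
      rw [← hg]
      exact ContinuousMap.coeFn_toLp σ _
    filter_upwards [hae, h0, hm, hall, hF.coeFn_toL1] with x h1 h2 h3 h4 h5
    rw [h5] at h1
    simp only [h4] at h1
    have h6 := (tendsto_const_nhds (x := (0 : ℝ))).max (h1.min (tendsto_const_nhds (x := m)))
    rwa [min_eq_left h3, max_eq_right h2] at h6
  refine isClosed_closure.mem_of_tendsto (tendsto_toL1_klFun
    (fun n => integrable_of_continuous σ (c n).continuous) hF
    (integrable_const m) (integrable_const (m ^ 2 + 1)) (fun n => ?_) (fun n => ?_) hcF)
    (Filter.Eventually.of_forall fun n => mem_closure_polyGraph_of_continuous σ (hc0 n))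
  · refine Filter.Eventually.of_forall fun x => ?_
    rw [abs_of_nonneg (hc0 n x)]
    exact hcm n x
  · refine Filter.Eventually.of_forall fun x => ?_
    rw [abs_of_nonneg (klFun_nonneg (hc0 n x))]
    nlinarith [klFun_le_sq (hc0 n x), hc0 n x, hcm n x]

/-- Truncation at height `n`; finiteness of the entropy provides the dominating function `klFun F +
1`. -/
theorem mem_closure_polyGraph {F : Sph ι r → ℝ} (hF : Integrable F σ)
    (h0 : ∀ᵐ x ∂σ, 0 ≤ F x) (hk : Integrable (fun x => klFun (F x)) σ) :
    ((hF.toL1 F, ∫ x, klFun (F x) ∂σ) : Lp ℝ 1 σ × ℝ) ∈ closure (polyGraph σ) := by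
  have hint : ∀ n : ℕ, Integrable (fun x => min (F x) n) σ := fun n =>
    hF.inf (integrable_const (n : ℝ))
  refine isClosed_closure.mem_of_tendsto (tendsto_toL1_klFun (h := fun n x => min (F x) n) hint hF
    hF (hk.add (integrable_const 1)) (fun n => ?_) (fun n => ?_) ?_)
    (Filter.Eventually.of_forall fun n => mem_closure_polyGraph_of_bounded σ (hint n) (m := n)
      ?_ (Filter.Eventually.of_forall fun x => min_le_right _ _) n.cast_nonneg)
  · filter_upwards [h0] with x hx
    rw [abs_of_nonneg (le_min hx n.cast_nonneg)]
    exact min_le_left _ _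
  · filter_upwards [h0] with x hx
    rw [abs_of_nonneg (klFun_nonneg (le_min hx n.cast_nonneg))]
    exact klFun_min_le hx n
  · filter_upwards [h0] with x hx
    obtain ⟨n, hn⟩ := exists_nat_ge (F x)
    refine tendsto_const_nhds.congr' ?_
    filter_upwards [Filter.eventually_ge_atTop n] with k hk
    exact (min_eq_left (hn.trans (by exact_mod_cast hk))).symm
  · filter_upwards [h0] with x hx
    exact le_min hx n.cast_nonneg

/-- A nonnegative integrable function of finite entropy is the limit in `L¹` of positive
polynomials whose entropies converge. -/
theorem exists_poly_tendsto {F : Lp ℝ 1 σ} (h0 : ∀ᵐ x ∂σ, 0 ≤ F x)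
    (hk : Integrable (fun x => klFun (F x)) σ) :
    ∃ (d : ℕ → ℕ) (f : ∀ n, polySpace ι r (d n)), (∀ n x, 0 < (f n).1 x) ∧
      Tendsto (fun n => polyL1 σ (d n) (f n)) atTop (𝓝 F) ∧
      Tendsto (fun n => ∫ x, klFun ((f n).1 x) ∂σ) atTop (𝓝 (∫ x, klFun (F x) ∂σ)) := by
  have h := mem_closure_polyGraph σ (L1.integrable_coeFn F) h0 hk
  rw [Integrable.toL1_coeFn] at h
  obtain ⟨u, hu, hlim⟩ := mem_closure_iff_seq_limit.1 h
  choose d f hf hfu using hu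
  refine ⟨d, f, hf, ?_, ?_⟩
  · simpa [Function.comp_def, hfu] using (continuous_fst.tendsto _).comp hlim
  · simpa [Function.comp_def, hfu] using (continuous_snd.tendsto _).comp hlim

end Approximation

/-! ### Euler's limit for the exponential -/

section Euler

/-- Telescoping of the difference of powers. -/
theorem norm_pow_sub_pow_le {A : Type*} [NormedRing A] (h1 : ‖(1 : A)‖ ≤ 1) {a b : A} {C : ℝ}
    (hC : 1 ≤ C) (ha : ‖a‖ ≤ C) (hb : ‖b‖ ≤ C) (n : ℕ) :
    ‖a ^ n - b ^ n‖ ≤ n * C ^ n * ‖a - b‖ := by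
  have hC0 : 0 ≤ C := by linarith
  have hpow : ∀ n : ℕ, ‖a ^ n‖ ≤ C ^ n := fun n => by
    induction n with
    | zero => simpa using h1
    | succ n ih =>
      rw [pow_succ, pow_succ]
      exact (norm_mul_le _ _).trans (mul_le_mul ih ha (norm_nonneg _) (by positivity))
  induction n with
  | zero => simp
  | succ n ih =>
    have h : a ^ (n + 1) - b ^ (n + 1) = a ^ n * (a - b) + (a ^ n - b ^ n) * b := by
      rw [pow_succ, pow_succ]
      noncomm_ring
    rw [h]
    calc ‖a ^ n * (a - b) + (a ^ n - b ^ n) * b‖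
        ≤ C ^ n * ‖a - b‖ + n * C ^ n * ‖a - b‖ * C := by
          refine (norm_add_le _ _).trans (add_le_add ?_ ?_)
          · exact (norm_mul_le _ _).trans
              (mul_le_mul_of_nonneg_right (hpow n) (norm_nonneg _))
          · exact (norm_mul_le _ _).trans (mul_le_mul ih hb (norm_nonneg _) (by positivity))
      _ ≤ C ^ n * C * ‖a - b‖ + n * C ^ n * ‖a - b‖ * C := by
          have : C ^ n ≤ C ^ n * C := le_mul_of_one_le_right (by positivity) hC
          gcongr
      _ = ((n + 1 : ℕ) : ℝ) * C ^ (n + 1) * ‖a - b‖ := by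
          push_cast
          ring

/-- Compare `a = 1 + x/n` with `b = e^{x/n}`, whose `n`-th power is `e^x`. The differentiability of
`u ↦ e^{ux}` at `0` gives `n ‖a - b‖ → 0`, and telescoping costs only a bounded factor. -/
theorem tendsto_one_add_smul_pow_exp {A : Type*} [NormedRing A] [NormedAlgebra ℝ A]
    [CompleteSpace A] (h1 : ‖(1 : A)‖ ≤ 1) (x : A) :
    Tendsto (fun n : ℕ => (1 + (1 / (n : ℝ)) • x) ^ n) atTop (𝓝 (NormedSpace.exp x)) := by
  let _ : NormedAlgebra ℚ A := NormedAlgebra.restrictScalars ℚ ℝ A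
  have hder : HasDerivAt (fun u : ℝ => NormedSpace.exp (u • x)) x 0 := by
    simpa using hasDerivAt_exp_smul_const x (0 : ℝ)
  have hinv : Tendsto (fun n : ℕ => 1 / (n : ℝ)) atTop (𝓝 0) :=
    tendsto_one_div_atTop_nhds_zero_nat
  have hsmall : Tendsto (fun n : ℕ => (n : ℝ) *
      ‖(1 + (1 / (n : ℝ)) • x) - NormedSpace.exp ((1 / (n : ℝ)) • x)‖) atTop (𝓝 0) := by
    have ho := ((hasDerivAt_iff_isLittleO.1 hder).comp_tendsto hinv).norm_left.tendsto_div_nhds_zero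
    rw [tendsto_zero_iff_norm_tendsto_zero] at ho ⊢
    refine ho.congr fun n => ?_
    simp only [Function.comp_apply, sub_zero, zero_smul, NormedSpace.exp_zero, norm_mul,
      norm_norm, div_div_eq_mul_div, div_one, mul_comm ‖(n : ℝ)‖]
    rw [norm_sub_rev]
    congr 2
    abel
  have hexp : ∀ᶠ n : ℕ in atTop, NormedSpace.exp ((1 / (n : ℝ)) • x) ^ n = NormedSpace.exp x := by
    filter_upwards [Filter.eventually_gt_atTop 0] with n hn
    have hn' : (n : ℝ) ≠ 0 := by exact_mod_cast hn.ne'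
    rw [← NormedSpace.exp_nsmul, ← Nat.cast_smul_eq_nsmul ℝ, smul_smul, mul_one_div_cancel hn',
      one_smul]
  rw [tendsto_iff_norm_sub_tendsto_zero]
  have hK := hsmall.const_mul (Real.exp (‖x‖ + 1))
  rw [mul_zero] at hK
  refine squeeze_zero' (Filter.Eventually.of_forall fun n => norm_nonneg _) ?_ hK
  filter_upwards [hexp, Filter.eventually_gt_atTop 0,
    hsmall.eventually (gt_mem_nhds zero_lt_one)] with n he hn hs
  have hn' : (0 : ℝ) < n := by exact_mod_cast hn
  obtain ⟨a, ha⟩ : ∃ a, a = 1 + (1 / (n : ℝ)) • x := ⟨_, rfl⟩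
  obtain ⟨b, hb⟩ : ∃ b, b = NormedSpace.exp ((1 / (n : ℝ)) • x) := ⟨_, rfl⟩
  rw [← he, ← ha, ← hb]
  rw [← ha, ← hb] at hs
  have hna : ‖a‖ ≤ 1 + ‖x‖ / n := by
    rw [ha]
    refine (norm_add_le _ _).trans (add_le_add h1 ?_)
    rw [norm_smul, Real.norm_of_nonneg (by positivity)]
    exact le_of_eq (by ring)
  have hab : ‖a - b‖ ≤ 1 / n := by
    rw [le_div_iff₀ hn']
    linarith
  -- This common bound for `‖a‖` and `‖b‖` leaves room for `‖a - b‖ ≤ 1/n`, and its `n`-th power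
  -- stays below `e^{‖x‖+1}`.
  have hC : (1 : ℝ) ≤ 1 + (‖x‖ + 1) / n := by
    have : 0 ≤ (‖x‖ + 1) / n := by positivity
    linarith
  have hna' : ‖a‖ ≤ 1 + (‖x‖ + 1) / n := by
    rw [add_div]
    have : (0 : ℝ) ≤ 1 / n := by positivity
    linarith
  have hnb : ‖b‖ ≤ 1 + (‖x‖ + 1) / n := by
    have h2 : ‖b‖ ≤ ‖a‖ + ‖a - b‖ := by
      have := norm_sub_le a (a - b)
      rwa [sub_sub_cancel] at this
    rw [add_div]
    linarith
  have hCn : (1 + (‖x‖ + 1) / n) ^ n ≤ Real.exp (‖x‖ + 1) := by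
    calc (1 + (‖x‖ + 1) / n) ^ n ≤ Real.exp ((‖x‖ + 1) / n) ^ n := by
          gcongr
          linarith [Real.add_one_le_exp ((‖x‖ + 1) / n)]
      _ = Real.exp (‖x‖ + 1) := by
          rw [← Real.exp_nat_mul]
          congr 1
          field_simp
  refine (norm_pow_sub_pow_le h1 hC hna' hnb n).trans ?_
  calc (n : ℝ) * (1 + (‖x‖ + 1) / n) ^ n * ‖a - b‖
      ≤ n * Real.exp (‖x‖ + 1) * ‖a - b‖ := by gcongr
    _ = Real.exp (‖x‖ + 1) * (n * ‖a - b‖) := by ring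

end Euler

/-! ### The uniform measure on the energy sphere -/

section SphereMeasure

variable {M N : ℕ}

theorem energy_pos (hN : 1 ≤ N) : 0 < Real.sqrt ((M : ℝ) + N) := by
  have : (1 : ℝ) ≤ N := by exact_mod_cast hN
  exact Real.sqrt_pos.2 (by positivity)

theorem nontrivial_index (hM : 1 ≤ M) (hN : 1 ≤ N) : Nontrivial (Fin M ⊕ Fin N) :=
  ⟨⟨Sum.inl ⟨0, hM⟩, Sum.inr ⟨0, hN⟩, Sum.inl_ne_inr⟩⟩

theorem toSphere_univ_ne_zero (hN : 1 ≤ N) :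
    (volume : Measure (Velocities M N)).toSphere Set.univ ≠ 0 := by
  have : Nonempty (Fin M ⊕ Fin N) := ⟨Sum.inr ⟨0, hN⟩⟩
  have : Nontrivial (Velocities M N) := inferInstance
  rw [Ne, Measure.measure_univ_eq_zero]
  exact Measure.toSphere_ne_zero _

theorem isProbabilityMeasure_sphereMeasure (hN : 1 ≤ N) :
    IsProbabilityMeasure (sphereMeasure M N) where
  measure_univ := by
    rw [sphereMeasure, Measure.smul_apply,
      Measure.map_apply (measurable_dilate M N) MeasurableSet.univ, Set.preimage_univ, smul_eq_mul]
    exact ENNReal.inv_mul_cancel (toSphere_univ_ne_zero hN) (measure_ne_top _ _)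

instance instRotInvariantSphereMeasure : RotInvariant (sphereMeasure M N) :=
  ⟨measurePreserving_onSphere⟩

theorem isOpenPosMeasure_sphereMeasure (hN : 1 ≤ N) : (sphereMeasure M N).IsOpenPosMeasure where
  open_pos U hU hne := by
    have hc : Continuous (dilate M N) := Continuous.subtype_mk (by fun_prop) _
    rw [sphereMeasure, Measure.smul_apply, Measure.map_apply hc.measurable hU.measurableSet,
      smul_eq_mul]
    refine mul_ne_zero (ENNReal.inv_ne_zero.2 (measure_ne_top _ _))
      ((hU.preimage hc).measure_ne_zero _ ?_)
    obtain ⟨x, hx⟩ := hne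
    have hr := energy_pos (M := M) hN
    refine ⟨⟨(Real.sqrt ((M : ℝ) + N))⁻¹ • (x : Velocities M N), ?_⟩, ?_⟩
    · rw [mem_sphere_zero_iff_norm, norm_smul, norm_eq_of_mem_sphere x, norm_inv,
        Real.norm_of_nonneg hr.le, inv_mul_cancel₀ hr.ne']
    · have : dilate M N ⟨(Real.sqrt ((M : ℝ) + N))⁻¹ • (x : Velocities M N), by
          rw [mem_sphere_zero_iff_norm, norm_smul, norm_eq_of_mem_sphere x, norm_inv,
            Real.norm_of_nonneg hr.le, inv_mul_cancel₀ hr.ne']⟩ = x :=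
        Subtype.ext (smul_inv_smul₀ hr.ne' _)
      rw [Set.mem_preimage, this]
      exact hx

end SphereMeasure

/-! ### The entropy of a probability density -/

/-- `klFun F` differs from `F log F` by `1 - F`, which integrates to zero at mass one. The right
side makes nonnegativity evident and avoids the difference of two integrals. -/
theorem entropy_eq_lintegral_klFun {X : Type*} [MeasurableSpace X] {σ : Measure X}
    [IsProbabilityMeasure σ] {F : X → ℝ} (hF : Integrable F σ) (h0 : ∀ᵐ x ∂σ, 0 ≤ F x)
    (h1 : ∫ x, F x ∂σ = 1) :
    entropy σ F = ((∫⁻ x, ENNReal.ofReal (klFun (F x)) ∂σ : ENNReal) : EReal) := by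
  set P := ∫⁻ x, ENNReal.ofReal (F x * Real.log (F x)) ∂σ
  set Q := ∫⁻ x, ENNReal.ofReal (-(F x * Real.log (F x))) ∂σ with hQ
  set K := ∫⁻ x, ENNReal.ofReal (klFun (F x)) ∂σ
  have hm := hF.aestronglyMeasurable.aemeasurable
  have hη : AEMeasurable (fun x => F x * Real.log (F x)) σ := hm.mul hm.log
  have hη' : AEMeasurable (fun x => -(F x * Real.log (F x))) σ := hη.neg
  have hG : ∫⁻ x, ENNReal.ofReal (F x) ∂σ = 1 := by
    rw [← ofReal_integral_eq_lintegral_ofReal hF h0, h1, ENNReal.ofReal_one]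
  have hneg : ∀ y : ℝ, 0 ≤ y → -(y * Real.log y) ≤ 1 := fun y hy => by
    have := klFun_nonneg hy
    rw [klFun_apply] at this
    linarith
  have hQle : Q ≤ 1 := by
    calc Q ≤ ∫⁻ _, 1 ∂σ := by
          refine lintegral_mono_ae ?_
          filter_upwards [h0] with x hx
          rw [← ENNReal.ofReal_one]
          exact ENNReal.ofReal_le_ofReal (hneg _ hx)
      _ = 1 := by simp
  have hQtop : Q ≠ ⊤ := ne_top_of_le_ne_top ENNReal.one_ne_top hQle
  -- The identity is arranged without subtraction since `P` and `K` may be infinite; the `1` on the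
  -- right is the mass of `F`. Cancelling `Q` afterwards is legitimate because `Q ≤ 1`.
  have hsum : P + 1 = K + Q + 1 := by
    have e1 : P + 1 = ∫⁻ x, (ENNReal.ofReal (F x * Real.log (F x)) + 1) ∂σ := by
      rw [lintegral_add_right _ measurable_const]
      simp [P]
    have e2 : K + Q + 1 = ∫⁻ x, (ENNReal.ofReal (klFun (F x))
        + ENNReal.ofReal (-(F x * Real.log (F x))) + ENNReal.ofReal (F x)) ∂σ := by
      rw [lintegral_add_right' _ hm.ennreal_ofReal,
        lintegral_add_right' _ hη'.ennreal_ofReal, hG]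
    rw [e1, e2]
    refine lintegral_congr_ae ?_
    filter_upwards [h0] with x hx
    have hk := klFun_nonneg hx
    rw [← ENNReal.ofReal_one]
    rcases le_total 0 (F x * Real.log (F x)) with h | h
    · rw [ENNReal.ofReal_of_nonpos (neg_nonpos.2 h), add_zero,
        ← ENNReal.ofReal_add h zero_le_one, ← ENNReal.ofReal_add hk hx, klFun_apply]
      congr 1
      ring
    · rw [ENNReal.ofReal_of_nonpos h, zero_add,
        ← ENNReal.ofReal_add hk (neg_nonneg.2 h),
        ← ENNReal.ofReal_add (add_nonneg hk (neg_nonneg.2 h)) hx, klFun_apply]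
      congr 1
      ring
  have hPK : P = K + Q := (ENNReal.add_left_inj ENNReal.one_ne_top).1 hsum
  rw [entropy]
  change (P : EReal) - (Q : EReal) = (K : EReal)
  rw [hPK, EReal.coe_ennreal_add]
  lift Q to NNReal using hQtop with q
  exact EReal.add_sub_cancel_right (b := (q : ℝ))

/-! ### Entropy decay in `L¹` -/

theorem ae_nonneg_of_tendsto {X : Type*} [MeasurableSpace X] {σ : Measure X}
    {G : ℕ → Lp ℝ 1 σ} {F : Lp ℝ 1 σ} (hG : Tendsto G atTop (𝓝 F))
    (h : ∀ n, ∀ᵐ x ∂σ, 0 ≤ G n x) : ∀ᵐ x ∂σ, 0 ≤ F x := by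
  obtain ⟨ns, -, hae⟩ := (tendstoInMeasure_of_tendsto_Lp hG).exists_seq_tendsto_ae
  filter_upwards [hae, ae_all_iff.2 h] with x hx hx0
  exact ge_of_tendsto' hx fun i => hx0 (ns i)

section Decay

variable {M N : ℕ}

/-- Nonnegativity, the mass and the entropy bound for the marginal of an iterated Euler step of the
master equation. -/
theorem marginal_step_pow (hM : 1 ≤ M) (hN : 1 ≤ N) {lamS lamR mu : ℝ} (hlamS : 0 ≤ lamS)
    (hlamR : 0 ≤ lamR) (hmu : 0 ≤ mu) (ν : Measure ℝ) [IsProbabilityMeasure ν]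
    (hsc : ∫ θ, Real.sin θ * Real.cos θ ∂ν = 0) {h : ℝ} (hh : 0 ≤ h)
    (hsmall : h * ∑ i, ∑ j, rates M N lamS lamR mu i j < 1)
    (hγ : h * (∫ θ, Real.sin θ ^ 2 ∂ν) * mu * (1 + M / N) ≤ 1) (k : ℕ)
    {F : Lp ℝ 1 (sphereMeasure M N)} (h0 : ∀ᵐ x ∂(sphereMeasure M N), 0 ≤ F x)
    (h1 : ∫ x, F x ∂(sphereMeasure M N) = 1)
    (hk : Integrable (fun x => klFun (F x)) (sphereMeasure M N)) :
    (∀ᵐ x ∂(sphereMeasure M N),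
        0 ≤ marginal M N (((1 + h • generator M N lamS lamR mu ν) ^ k) F) x) ∧
      ∫ x, marginal M N (((1 + h • generator M N lamS lamR mu ν) ^ k) F) x ∂(sphereMeasure M N) = 1 ∧
      ∫⁻ x, ENNReal.ofReal (klFun
          (marginal M N (((1 + h • generator M N lamS lamR mu ν) ^ k) F) x)) ∂(sphereMeasure M N)
        ≤ ENNReal.ofReal (2 * (M / (M + N) + N / (M + N)
            * (1 - h * (∫ θ, Real.sin θ ^ 2 ∂ν) * mu * (1 + M / N)) ^ k)
          * ∫ x, klFun (F x) ∂(sphereMeasure M N)) := by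
  have : Fact (0 < Real.sqrt ((M : ℝ) + N)) := ⟨energy_pos hN⟩
  have : Nontrivial (Fin M ⊕ Fin N) := nontrivial_index hM hN
  have : IsProbabilityMeasure (sphereMeasure M N) := isProbabilityMeasure_sphereMeasure hN
  have : (sphereMeasure M N).IsOpenPosMeasure := isOpenPosMeasure_sphereMeasure hN
  obtain ⟨C, hC⟩ : ∃ C, C = 2 * ((M : ℝ) / (M + N) + N / (M + N)
      * (1 - h * (∫ θ, Real.sin θ ^ 2 ∂ν) * mu * (1 + M / N)) ^ k) := ⟨_, rfl⟩
  obtain ⟨T, hT⟩ : ∃ T : Lp ℝ 1 (sphereMeasure M N) →L[ℝ] Lp ℝ 1 (sphereMeasure M N),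
      T = (1 + h • generator M N lamS lamR mu ν) ^ k := ⟨_, rfl⟩
  rw [← hC, ← hT]
  obtain ⟨d, f, hf, hlim, hent⟩ := exists_poly_tendsto (sphereMeasure M N) h0 hk
  obtain ⟨g, hg⟩ : ∃ g : ∀ n, polySpace (Fin M ⊕ Fin N) (Real.sqrt ((M : ℝ) + N)) (d n),
      ∀ n, g n = marginalL M N _ (d n) ((stepL ν (d n) (rates M N lamS lamR mu) h ^ k) (f n)) :=
    ⟨_, fun _ => rfl⟩
  have hmark : ∀ n, IsMarkov (sphereMeasure M N) (marginalL M N (Real.sqrt ((M : ℝ) + N)) (d n)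
      * stepL ν (d n) (rates M N lamS lamR mu) h ^ k) := fun n =>
    IsMarkov.comp (isMarkov_avgL _ _ _ _)
      ((isMarkov_stepL ν (sphereMeasure M N) (d n) (rates_nonneg hM hN hlamS hlamR hmu) hh hsmall).pow k)
  have hgpos : ∀ n x, 0 < (g n).1 x := fun n => by
    rw [hg]
    exact (hmark n).pos (f n) (hf n)
  have hpoly : ∀ n, marginal M N (T (polyL1 (sphereMeasure M N) (d n) (f n))) = polyL1 (sphereMeasure M N) (d n) (g n) := fun n => by
    rw [hT, step_pow_polyL1, marginal_polyL1, hg]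
  have hgl : Tendsto (fun n => polyL1 (sphereMeasure M N) (d n) (g n)) atTop (𝓝 (marginal M N (T F))) := by
    simp only [← hpoly]
    exact (((marginal M N).continuous.comp T.continuous).tendsto F).comp hlim
  have hmass : Tendsto (fun n => ∫ x, (f n).1 x ∂(sphereMeasure M N)) atTop (𝓝 1) := by
    rw [← h1]
    refine ((continuous_integral.tendsto F).comp hlim).congr fun n => ?_
    exact integral_congr_ae (polyL1_coeFn (sphereMeasure M N) (f n))
  refine ⟨?_, ?_, ?_⟩
  · refine ae_nonneg_of_tendsto hgl fun n => ?_
    filter_upwards [polyL1_coeFn (sphereMeasure M N) (g n)] with x hx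
    rw [hx]
    exact (hgpos n x).le
  · refine tendsto_nhds_unique ((continuous_integral.tendsto _).comp hgl) (hmass.congr fun n => ?_)
    have h3 : ∫ x, (g n).1 x ∂(sphereMeasure M N) = ∫ x, (f n).1 x ∂(sphereMeasure M N) := by
      rw [hg]
      exact (hmark n).mass (f n)
    rw [← h3]
    exact (integral_congr_ae (polyL1_coeFn (sphereMeasure M N) (g n))).symm
  · have hkm : Tendsto (fun n => klFun (∫ x, (f n).1 x ∂(sphereMeasure M N))) atTop (𝓝 0) := by
      rw [← klFun_one]
      exact (continuous_klFun.tendsto 1).comp hmass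
    -- The approximants need not have mass one, hence the corrections by `klFun` of the mass; they
    -- disappear in the limit as `klFun 1 = 0`.
    have hbound : Tendsto (fun n => C * (∫ x, klFun ((f n).1 x) ∂(sphereMeasure M N) - klFun (∫ x, (f n).1 x ∂(sphereMeasure M N)))
        + klFun (∫ x, (f n).1 x ∂(sphereMeasure M N))) atTop (𝓝 (C * ∫ x, klFun (F x) ∂(sphereMeasure M N))) := by
      simpa using ((hent.sub hkm).const_mul C).add hkm
    refine lintegral_klFun_le_of_tendsto hgl ((ENNReal.continuous_ofReal.tendsto _).comp hbound)
      (Filter.Eventually.of_forall fun n => ?_)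
    have hle := entropy_pow_le ν (sphereMeasure M N) hM hN hlamS hlamR hmu hh hsmall hγ hsc k (hf n)
    rw [← hC, ← hg] at hle
    calc ∫⁻ x, ENNReal.ofReal (klFun (polyL1 (sphereMeasure M N) (d n) (g n) x)) ∂(sphereMeasure M N)
        = ∫⁻ x, ENNReal.ofReal (klFun ((g n).1 x)) ∂(sphereMeasure M N) := by
          refine lintegral_congr_ae ?_
          filter_upwards [polyL1_coeFn (sphereMeasure M N) (g n)] with x hx
          rw [hx]
      _ = ENNReal.ofReal (∫ x, klFun ((g n).1 x) ∂(sphereMeasure M N)) :=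
          (ofReal_integral_eq_lintegral_ofReal
            (integrable_of_continuous (sphereMeasure M N) (continuous_klFun_comp (g n).1))
            (Filter.Eventually.of_forall fun x => klFun_nonneg (hgpos n x).le)).symm
      _ ≤ _ := ENNReal.ofReal_le_ofReal (by linarith)

/-- Nonnegativity, the mass and the entropy bound for the marginal of a solution of the master
equation whose initial datum is a density of finite entropy. -/
theorem marginal_evolution (hM : 1 ≤ M) (hN : 1 ≤ N) {lamS lamR mu : ℝ} (hlamS : 0 ≤ lamS)
    (hlamR : 0 ≤ lamR) (hmu : 0 ≤ mu) (ν : Measure ℝ) [IsProbabilityMeasure ν]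
    (hsc : ∫ θ, Real.sin θ * Real.cos θ ∂ν = 0) {t : ℝ} (ht : 0 ≤ t)
    {F : Lp ℝ 1 (sphereMeasure M N)} (h0 : ∀ᵐ x ∂(sphereMeasure M N), 0 ≤ F x)
    (h1 : ∫ x, F x ∂(sphereMeasure M N) = 1)
    (hk : Integrable (fun x => klFun (F x)) (sphereMeasure M N)) :
    (∀ᵐ x ∂(sphereMeasure M N), 0 ≤ marginal M N (evolution M N lamS lamR mu ν t F) x) ∧
      ∫ x, marginal M N (evolution M N lamS lamR mu ν t F) x ∂(sphereMeasure M N) = 1 ∧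
      ∫⁻ x, ENNReal.ofReal (klFun
          (marginal M N (evolution M N lamS lamR mu ν t F) x)) ∂(sphereMeasure M N)
        ≤ ENNReal.ofReal (2 * (M / (M + N) + N / (M + N)
            * Real.exp (-(t * ((∫ θ, Real.sin θ ^ 2 ∂ν) * mu * (1 + M / N)))))
          * ∫ x, klFun (F x) ∂(sphereMeasure M N)) := by
  obtain ⟨κ, hκ⟩ : ∃ κ, κ = (∫ θ, Real.sin θ ^ 2 ∂ν) * mu * (1 + (M : ℝ) / N) := ⟨_, rfl⟩
  rw [← hκ]
  have hinv : Tendsto (fun n : ℕ => 1 / (n : ℝ) * t) atTop (𝓝 0) := by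
    simpa using (tendsto_one_div_atTop_nhds_zero_nat (𝕜 := ℝ)).mul_const t
  have hev : ∀ c : ℝ, ∀ᶠ n : ℕ in atTop, 1 / (n : ℝ) * t * c < 1 := fun c => by
    have := hinv.mul_const c
    rw [zero_mul] at this
    exact this.eventually (gt_mem_nhds zero_lt_one)
  have hlim : Tendsto (fun n : ℕ => marginal M N
      (((1 + (1 / (n : ℝ) * t) • generator M N lamS lamR mu ν) ^ n) F)) atTop
      (𝓝 (marginal M N (evolution M N lamS lamR mu ν t F))) := by
    have hE := tendsto_one_add_smul_pow_exp (ContinuousLinearMap.norm_id_le)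
      (t • generator M N lamS lamR mu ν)
    simp only [smul_smul] at hE
    exact ((marginal M N).continuous.tendsto _).comp
      (((ContinuousLinearMap.apply ℝ _ F).continuous.tendsto _).comp hE)
  -- For large `n` the step `t / n` meets both smallness conditions: convexity of the Euler step,
  -- and nonnegativity of `1 - γ`.
  have hn := (hev (∑ i, ∑ j, rates M N lamS lamR mu i j)).and (hev κ)
  have hstep := fun (n : ℕ) (hn : 1 / (n : ℝ) * t * (∑ i, ∑ j, rates M N lamS lamR mu i j) < 1 ∧
      1 / (n : ℝ) * t * κ < 1) =>
    marginal_step_pow hM hN hlamS hlamR hmu ν hsc (h := 1 / (n : ℝ) * t) (by positivity) hn.1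
      (by rw [mul_assoc, mul_assoc, ← mul_assoc (∫ θ, Real.sin θ ^ 2 ∂ν), ← hκ]; exact hn.2.le)
      n h0 h1 hk
  refine ⟨?_, ?_, ?_⟩
  · obtain ⟨n₀, hn₀⟩ := Filter.eventually_atTop.1 hn
    exact ae_nonneg_of_tendsto (hlim.comp (Filter.tendsto_add_atTop_nat n₀)) fun n =>
      (hstep _ (hn₀ _ (Nat.le_add_left _ _))).1
  · exact tendsto_nhds_unique ((continuous_integral.tendsto _).comp hlim)
      (tendsto_const_nhds.congr' (hn.mono fun n hn => (hstep n hn).2.1.symm))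
  · refine lintegral_klFun_le_of_tendsto hlim tendsto_const_nhds ?_
    filter_upwards [hn, Filter.eventually_gt_atTop 0] with n hn hn0
    refine (hstep n hn).2.2.trans (ENNReal.ofReal_le_ofReal ?_)
    have hn0' : (n : ℝ) ≠ 0 := by exact_mod_cast hn0.ne'
    have hpow : (1 - 1 / (n : ℝ) * t * (∫ θ, Real.sin θ ^ 2 ∂ν) * mu * (1 + M / N)) ^ n
        ≤ Real.exp (-(t * κ)) := by
      have h2 : 1 - 1 / (n : ℝ) * t * (∫ θ, Real.sin θ ^ 2 ∂ν) * mu * (1 + M / N)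
          = 1 - 1 / (n : ℝ) * t * κ := by
        rw [hκ]
        ring
      have h3 : Real.exp (-(t * κ)) = Real.exp (-(1 / (n : ℝ) * t * κ)) ^ n := by
        rw [← Real.exp_nat_mul]
        congr 1
        field_simp
      rw [h2, h3]
      -- Since `1 - y ≤ e^{-y}`, the exponential bound holds for each admissible `n`, so Fatou's
      -- lemma is applied with a constant right side.
      exact pow_le_pow_left₀ (by linarith [hn.2]) (Real.one_sub_le_exp_neg _) n
    have hI : 0 ≤ ∫ x, klFun (F x) ∂(sphereMeasure M N) :=
      integral_nonneg_of_ae (h0.mono fun x hx => klFun_nonneg hx)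
    gcongr

end Decay

theorem entropy_marginal_evolution_le {M N : ℕ} (hM : 1 ≤ M) (hN : 1 ≤ N) {lamS lamR mu : ℝ}
    (hlamS : 0 ≤ lamS) (hlamR : 0 ≤ lamR) (hmu : 0 ≤ mu) (ν : Measure ℝ) [IsProbabilityMeasure ν]
    (hsc : ∫ θ, Real.sin θ * Real.cos θ ∂ν = 0) {t : ℝ} (ht : 0 ≤ t)
    {F : Lp ℝ 1 (sphereMeasure M N)} (h0 : ∀ᵐ x ∂(sphereMeasure M N), 0 ≤ F x)
    (h1 : ∫ x, F x ∂(sphereMeasure M N) = 1) {c : ℝ} (hc : 0 < c)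
    (hle : 2 * (M / (M + N) + N / (M + N)
      * Real.exp (-(t * ((∫ θ, Real.sin θ ^ 2 ∂ν) * mu * (1 + M / N))))) ≤ c) :
    entropy (sphereMeasure M N) (marginal M N (evolution M N lamS lamR mu ν t F))
      ≤ (c : EReal) * entropy (sphereMeasure M N) F := by
  have : IsProbabilityMeasure (sphereMeasure M N) := isProbabilityMeasure_sphereMeasure hN
  rw [entropy_eq_lintegral_klFun (L1.integrable_coeFn F) h0 h1]
  -- For infinite initial entropy the right side is `c * ⊤ = ⊤`, which is where `0 < c` enters.
  by_cases htop : ∫⁻ x, ENNReal.ofReal (klFun (F x)) ∂(sphereMeasure M N) = ⊤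
  · rw [htop, EReal.coe_ennreal_top, EReal.coe_mul_top_of_pos hc]
    exact le_top
  have hkm : AEStronglyMeasurable (fun x => klFun (F x)) (sphereMeasure M N) :=
    continuous_klFun.comp_aestronglyMeasurable (L1.integrable_coeFn F).aestronglyMeasurable
  have hk0 : 0 ≤ᵐ[sphereMeasure M N] fun x => klFun (F x) := h0.mono fun x hx => klFun_nonneg hx
  have hk : Integrable (fun x => klFun (F x)) (sphereMeasure M N) :=
    (lintegral_ofReal_ne_top_iff_integrable hkm hk0).1 htop
  obtain ⟨g0, g1, g2⟩ := marginal_evolution hM hN hlamS hlamR hmu ν hsc ht h0 h1 hk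
  rw [entropy_eq_lintegral_klFun (L1.integrable_coeFn _) (g0) g1,
    ← ofReal_integral_eq_lintegral_ofReal hk hk0]
  have hI : 0 ≤ ∫ x, klFun (F x) ∂(sphereMeasure M N) := integral_nonneg_of_ae hk0
  calc _ ≤ ((ENNReal.ofReal (c * ∫ x, klFun (F x) ∂(sphereMeasure M N)) : ENNReal) : EReal) :=
        EReal.coe_ennreal_le_coe_ennreal_iff.2
          (g2.trans (ENNReal.ofReal_le_ofReal (mul_le_mul_of_nonneg_right hle hI)))
    _ = _ := by
        rw [EReal.coe_ennreal_ofReal, EReal.coe_ennreal_ofReal, max_eq_left hI,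
          max_eq_left (by positivity), EReal.coe_mul]

end KacReservoir

end

theorem corollary4 (M N : ℕ) (hM : 1 ≤ M) (hN : 1 ≤ N)
    (lamS lamR mu : ℝ) (hlamS : 0 ≤ lamS) (hlamR : 0 ≤ lamR) (hmu : 0 ≤ mu)
    (ν : Measure ℝ) [IsProbabilityMeasure ν] (hν : ν (Set.Icc (-Real.pi) Real.pi)ᶜ = 0)
    (hsc : ∫ θ, Real.sin θ * Real.cos θ ∂ν = 0)
    (F₀ : Lp ℝ 1 (KacReservoir.sphereMeasure M N))
    (hF₀ : ∀ᵐ x ∂(KacReservoir.sphereMeasure M N), 0 ≤ F₀ x)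
    (hF₀1 : ∫ x, F₀ x ∂(KacReservoir.sphereMeasure M N) = 1)
    (hinv : ∀ A : KacReservoir.SO N, ∀ᵐ x ∂(KacReservoir.sphereMeasure M N),
      F₀ (KacReservoir.onSphere (KacReservoir.reservoirRotation M A) x) = F₀ x)
    (t : ℝ) (ht : 0 ≤ t) :
    KacReservoir.entropy (KacReservoir.sphereMeasure M N)
        (KacReservoir.marginal M N (KacReservoir.evolution M N lamS lamR mu ν t F₀)) ≤
      ((2 * ((M : ℝ) / (M + N)
          + Real.exp (-((mu * ∫ θ, Real.sin θ ^ 2 ∂ν) * t)) * ((N : ℝ) / (M + N)))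
        + (M : ℝ) / N : ℝ) : EReal) *
      KacReservoir.entropy (KacReservoir.sphereMeasure M N) F₀ := by
  have hM' : (0 : ℝ) < M := by exact_mod_cast hM
  have hN' : (0 : ℝ) < N := by exact_mod_cast hN
  refine KacReservoir.entropy_marginal_evolution_le hM hN hlamS hlamR hmu ν hsc ht hF₀ hF₀1
    (by positivity) ?_
  have hs : 0 ≤ ∫ θ, Real.sin θ ^ 2 ∂ν := integral_nonneg fun θ => sq_nonneg _
  -- The rate obtained exceeds the asserted one by the factor `1 + M/N ≥ 1`, and the summand `M/N`
  -- of the prefactor only enlarges the bound.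
  have hexp : Real.exp (-(t * ((∫ θ, Real.sin θ ^ 2 ∂ν) * mu * (1 + (M : ℝ) / N))))
      ≤ Real.exp (-((mu * ∫ θ, Real.sin θ ^ 2 ∂ν) * t)) := by
    refine Real.exp_le_exp.2 (neg_le_neg ?_)
    have h1 : 0 ≤ mu * (∫ θ, Real.sin θ ^ 2 ∂ν) * t * ((M : ℝ) / N) := by positivity
    linarith
  have h2 : (0 : ℝ) ≤ M / N := by positivity
  have h3 := mul_le_mul_of_nonneg_left hexp (show (0 : ℝ) ≤ N / (M + N) by positivity)
  linarith
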